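/- Let $N\ge 1$, $\lambda>0$, and for $\mathbf n\in\mathbb Z^N$ put $|\mathbf n|=n_1+\dots+n_N$ and $\tilde n_j=n_j+\lambda(N+1-j)$. Consider the Calogero Hamiltonian and its ground state $$H=\sum_{j=1}^N\bigl(-\partial_{x_j}^2+x_j^2\bigr)+2\lambda(\lambda-1)\sum_{j<k}\frac1{(x_j-x_k)^2},\qquad \psi_0(\mathbf x)=\prod_{j=1}^N e^{-x_j^2/2}\prod_{j<k}|x_k-x_j|^\lambda ,$$ and the numbers $E_{\mathbf n}=2|\mathbf n|+N(1+\lambda(N-1))$. (On the region $x_1<\dots<x_N$ the absolute values can be omitted.) For $a\in\mathbb R$ let $(z)_m=z(z+1)\cdots(z+m-1)$ and let $$p_a(y)=\sum_{s\ge0}c_s(a)\,y^{a-2s},\qquad c_s(a)=(-1)^s\frac{(a-2s+1)_{2s}}{4^s\,s!}$$ (a formal series). For $s\in\mathbb N_0$ and $n\in\mathbb Z$ let $$b_s(n,a)=(-1)^s\frac{(a-2s+1)_{2s}}{4^s s!}+\sum_{j=1}^s(-1)^{j+s}\sum_{0\le s_j<s_{j-1}<\dots<s_1<s}\frac{(a-2s_j+1)_{2s_j}\,(a+n-2s+1)_{2(s-s_j)}}{4^s\,s_j!\,(s_{j-1}-s_j)!\cdots(s_1-s_2)!\,(s-s_1)!}.$$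 For $\mathbf m\in\mathbb Z^N$ let $f^{(H)}_{\mathbf m}(\mathbf x)$ be the coefficient of $(y_1\cdots y_N)^{-1}$ in the formal Laurent series $$\prod_{j=1}^N p_{\tilde m_j-1}(y_j)\,y_j^{\lambda(j-N-1)}\;\frac{\prod_{j<k}(1-y_j/y_k)^{\lambda}}{\prod_{j,k=1}^N(1-x_j/y_k)^{\lambda}},$$ where the last factors are expanded in binomial series in $y_j/y_k$ ($j<k$) and $x_j/y_k$. For $1\le j<k\le N$, integers $t,u,\nu\ge0$ and $\mathbf m\in\mathbb Z^N$ let $$\mathbf E_{jk}^{tu,\nu}=(1+2t-\nu)\mathbf e_j+(1+2u+\nu)\mathbf e_k,$$ $$g_{jk}^{tu}(\nu;\mathbf m)=2\lambda(\lambda-1)\,\nu\;b_t(\nu-1,\ \tilde m_j+2t-\nu)\;b_u(-1-\nu,\ \tilde m_k+2u+\nu),$$ and for $\mathbf n,\mathbf m\in\mathbb Z^N$, with $\delta_{\mathbf n}(\mathbf m)$ the Kronecker delta, $$\beta_{\mathbf n}(\mathbf m)=\delta_{\mathbf n}(\mathbf m)+\sum_{s=1}^\infty\sum_{j_1<k_1}\sum_{t_1,u_1,\nu_1=0}^\infty\cdots\sum_{j_s<k_s}\sum_{t_s,u_s,\nu_s=0}^\infty\delta_{\mathbf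 n}\Bigl(\mathbf m+\sum_{r=1}^s\mathbf E_{j_rk_r}^{t_ru_r,\nu_r}\Bigr)\prod_{r=1}^s\frac{g_{j_rk_r}^{t_ru_r}\bigl(\nu_r;\mathbf n-\sum_{\ell=1}^r\mathbf E_{j_\ell k_\ell}^{t_\ell u_\ell,\nu_\ell}\bigr)}{4\sum_{\ell=1}^r(1+t_\ell+u_\ell)} .$$ Then, for every $\mathbf n\in\mathbb Z^N$: for each $\mathbf m$ only finitely many terms of the expanded Laurent series contribute to $f^{(H)}_{\mathbf m}$, for each $\mathbf m$ only finitely many terms in the sum for $\beta_{\mathbf n}(\mathbf m)$ are non-zero, and only finitely many terms in $$P_{\mathbf n}=\sum_{\mathbf m\in\mathbb Z^N}\beta_{\mathbf n}(\mathbf m)\,f^{(H)}_{\mathbf m}$$ are non-zero; and $P_{\mathbf n}$ is a reduced polynomial eigenfunction of the Calogero model with eigenvalue $E_{\mathbf n}$, i.e. $P_{\mathbf n}$ is a symmetric polynomial and $H(\psi_0P_{\mathbf n})=E_{\mathbf n}\,\psi_0P_{\mathbf n}$ at all $\mathbf x\in\mathbb R^N$ with pairwise distinct coordinates. Moreover $P_{\mathbf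 n}\neq0$ whenever $\mathbf n$ is a partition ($n_1\ge\dots\ge n_N\ge0$). -/

import Mathlib

namespace Calogero

noncomputable section

/-! ### The Calogero model

Particles are indexed by `Fin N`, so the one-based index of `j : Fin N` is `j + 1`. -/

/-- The Calogero Hamiltonian
`∑ⱼ (-∂²/∂xⱼ² + xⱼ²) + 2 lam (lam - 1) ∑_{j<k} 1 / (xⱼ - xₖ)²`, applied to `ψ` at `x`. -/
def hamiltonian {N : ℕ} (lam : ℝ) (ψ : (Fin N → ℝ) → ℝ) (x : Fin N → ℝ) : ℝ :=
  ∑ j, (-(iteratedDeriv 2 (fun t : ℝ => ψ (Function.update x j t)) (x j)) + x j ^ 2 * ψ x)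
    + 2 * lam * (lam - 1) * (∑ j, ∑ k ∈ Finset.Ioi j, 1 / (x j - x k) ^ 2) * ψ x

/-- The ground state `∏ⱼ exp (-xⱼ²/2) ∏_{j<k} |xₖ - xⱼ|^lam`. On `x₁ < ⋯ < x_N` the absolute values
can be dropped; on any other ordering of the particles they only change a constant phase. -/
def groundState {N : ℕ} (lam : ℝ) (x : Fin N → ℝ) : ℝ :=
  (∏ j, Real.exp (-(1 / 2) * x j ^ 2)) * ∏ j, ∏ k ∈ Finset.Ioi j, |x k - x j| ^ lam

/-- `E_n = 2 (n₁ + ⋯ + n_N) + N (1 + lam (N - 1))`. -/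
def energy {N : ℕ} (lam : ℝ) (n : Fin N → ℤ) : ℝ :=
  2 * (∑ j, (n j : ℝ)) + N * (1 + lam * (N - 1))

/-- `P` is a symmetric polynomial, and `groundState * P` solves the Schrödinger equation with
eigenvalue `E` at every configuration of pairwise distinct particle positions. -/
structure IsReducedEigenfunction {N : ℕ} (lam E : ℝ) (P : MvPolynomial (Fin N) ℝ) : Prop where
  symmetric : P.IsSymmetric
  schroedinger : ∀ x : Fin N → ℝ, Function.Injective x →
    hamiltonian lam (fun y => groundState lam y * MvPolynomial.eval y P) x
      = E * (groundState lam x * MvPolynomial.eval x P)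

/-! ### Generalized Hermite series -/

/-- The Pochhammer symbol `(z)_n = z (z + 1) ⋯ (z + n - 1)`. -/
def poch (z : ℝ) (n : ℕ) : ℝ := (ascPochhammer ℝ n).eval z

/-- The coefficient of `x ^ (a - 2s)` in the generalized Hermite series
`p_a(x) = ∑_s c_s(a) x ^ (a - 2s)`. -/
def hermiteCoeff (s : ℕ) (a : ℝ) : ℝ :=
  (-1) ^ s * poch (a - 2 * s + 1) (2 * s) / (4 ^ s * s.factorial)

/-- The coefficients `b_s(n, a)` of `x ^ n p_a(x) = ∑_s b_s(n, a) p_{a+n-2s}(x)`, given explicitly by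
a sum over the strict chains `s = σ 0 > σ 1 > ⋯ > σ j ≥ 0` of length `1 ≤ j ≤ s`. -/
def bCoeff (s : ℕ) (n : ℤ) (a : ℝ) : ℝ :=
  (-1) ^ s * poch (a - 2 * s + 1) (2 * s) / (4 ^ s * s.factorial)
    + ∑ j ∈ Finset.Icc 1 s, (-1) ^ (j + s) *
        ∑ σ : Fin (j + 1) → Fin (s + 1) with StrictAnti σ ∧ σ 0 = Fin.last s,
          poch (a - 2 * (σ (Fin.last j) : ℕ) + 1) (2 * (σ (Fin.last j) : ℕ))
              * poch (a + n - 2 * s + 1) (2 * (s - (σ (Fin.last j) : ℕ)))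
            / (4 ^ s * ((σ (Fin.last j) : ℕ).factorial : ℝ)
                * ∏ i : Fin j, (((σ i.castSucc : ℕ) - (σ i.succ : ℕ)).factorial : ℝ))

/-! ### The building blocks -/

/-- The shifted label: `ñⱼ = nⱼ + lam (N + 1 - j)` for the one-based index `j`. -/
def tilde {N : ℕ} (lam : ℝ) (n : Fin N → ℤ) (j : Fin N) : ℝ :=
  n j + lam * (N + 1 - ((j : ℕ) + 1))

/-- The pairs `j < k`. -/
abbrev Pairs (N : ℕ) : Type := {p : Fin N × Fin N // p.1 < p.2}

/-- A term in the expansion of the formal multi-variable Laurent series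
`∏ⱼ p_{ñⱼ-1}(yⱼ) yⱼ ^ (lam (j-N-1)) · ∏_{j<k} (1 - yⱼ/yₖ)^lam · ∏_{r,i} (1 - x_r/y_i)^(-lam)`:
one summand is chosen in each `p_{ñⱼ-1}(yⱼ)` and in each of the binomial series. -/
structure LaurentTerm (N : ℕ) where
  /-- the summand of `p_{ñⱼ-1}(yⱼ)` -/
  herm : Fin N → ℕ
  /-- the summand of `(1 - yⱼ/yₖ)^lam` -/
  kap : Pairs N → ℕ
  /-- the summand of `(1 - x_r/y_i)^(-lam)` -/
  nu : Fin N → Fin N → ℕ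

/-- The exponent of `y_i` in a term of the Laurent series. -/
def LaurentTerm.exponent {N : ℕ} (lam : ℝ) (n : Fin N → ℤ) (c : LaurentTerm N) (i : Fin N) : ℝ :=
  (tilde lam n i - 1 - 2 * c.herm i) + lam * (((i : ℕ) + 1) - N - 1)
    + (∑ p : Pairs N, (c.kap p : ℝ) *
        ((Pi.single p.1.1 1 : Fin N → ℝ) i - (Pi.single p.1.2 1 : Fin N → ℝ) i))
    - ∑ r, (c.nu r i : ℝ)

/-- The coefficient, a polynomial in `x`, of a term of the Laurent series. -/
def LaurentTerm.coeff {N : ℕ} (lam : ℝ) (n : Fin N → ℤ) (c : LaurentTerm N) :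
    MvPolynomial (Fin N) ℝ :=
  MvPolynomial.C (∏ j, hermiteCoeff (c.herm j) (tilde lam n j - 1))
    * MvPolynomial.C (∏ p : Pairs N, (-1) ^ c.kap p * Ring.choose lam (c.kap p))
    * ∏ r, ∏ i, (MvPolynomial.C ((-1) ^ c.nu r i * Ring.choose (-lam) (c.nu r i))
        * MvPolynomial.X r ^ c.nu r i)

/-- The terms of the Laurent series that are proportional to `(y₁ ⋯ y_N)⁻¹`. -/
def residueTerms {N : ℕ} (lam : ℝ) (n : Fin N → ℤ) : Set (LaurentTerm N) :=
  {c | ∀ i, c.exponent lam n i = -1}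

/-- `f^{(H)}_n`: the coefficient of `(y₁ ⋯ y_N)⁻¹` in the formal Laurent series. -/
def fH {N : ℕ} (lam : ℝ) (n : Fin N → ℤ) : MvPolynomial (Fin N) ℝ :=
  ∑ᶠ c ∈ residueTerms lam n, c.coeff lam n

/-! ### The coefficients of the eigenfunctions -/

/-- The summation indices `j < k` and `t, u, ν ≥ 0` of one link of a chain. -/
structure Step (N : ℕ) where
  /-- the pair `(j, k)` -/
  pair : Pairs N
  /-- the index `t` -/
  t : ℕ
  /-- the index `u` -/
  u : ℕ
  /-- the index `ν` -/
  nu : ℕ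

/-- `𝐄 = (1 + 2t - ν) eⱼ + (1 + 2u + ν) eₖ`. -/
def Step.shift {N : ℕ} (c : Step N) : Fin N → ℤ :=
  Pi.single c.pair.1.1 (1 + 2 * (c.t : ℤ) - c.nu) + Pi.single c.pair.1.2 (1 + 2 * (c.u : ℤ) + c.nu)

/-- `g = 2 lam (lam - 1) ν b_t(ν - 1, m̃ⱼ + 2t - ν) b_u(-1 - ν, m̃ₖ + 2u + ν)`. -/
def Step.weight {N : ℕ} (lam : ℝ) (m : Fin N → ℤ) (c : Step N) : ℝ :=
  2 * lam * (lam - 1) * c.nu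
    * bCoeff c.t ((c.nu : ℤ) - 1) (tilde lam m c.pair.1.1 + 2 * c.t - c.nu)
    * bCoeff c.u (-1 - (c.nu : ℤ)) (tilde lam m c.pair.1.2 + 2 * c.u + c.nu)

/-- A chain of `s ≥ 1` links. -/
abbrev Chain (N : ℕ) : Type := Σ s : {s : ℕ // 1 ≤ s}, (Fin s.1 → Step N)

/-- The contribution
`δ_n(m + ∑_r 𝐄_r) ∏_r g_r(n - ∑_{l ≤ r} 𝐄_l) / (4 ∑_{l ≤ r} (1 + t_l + u_l))` of a chain. -/
def chainTerm {N : ℕ} (lam : ℝ) (n m : Fin N → ℤ) (c : Chain N) : ℝ :=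
  (if n = m + ∑ r, (c.2 r).shift then 1 else 0)
    * ∏ r, (c.2 r).weight lam (n - ∑ l ∈ Finset.Iic r, (c.2 l).shift)
        / (4 * ∑ l ∈ Finset.Iic r, (1 + ((c.2 l).t : ℝ) + ((c.2 l).u : ℝ)))

/-- The coefficient `β_n(m)`. -/
def beta {N : ℕ} (lam : ℝ) (n m : Fin N → ℤ) : ℝ :=
  (if n = m then 1 else 0) + ∑ᶠ c : Chain N, chainTerm lam n m c

/-- `P_n = ∑_m β_n(m) f^{(H)}_m`. -/
def eigenPoly {N : ℕ} (lam : ℝ) (n : Fin N → ℤ) : MvPolynomial (Fin N) ℝ :=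
  ∑ᶠ m : Fin N → ℤ, beta lam n m • fH lam m

end

end Calogero

/-! Conjugating by the ground state turns $H$ into $\hat H+E_0$, where $\hat
H=\sum_r(-\partial_r^2+2x_r\partial_r)-2\lambda\sum_{r\ne s}(x_r-x_s)^{-1}\partial_r$ and
$E_0=N(1+\lambda(N-1))$ (`hamiltonian_groundState_mul`). It remains to solve $\hat HP=2|\mathbf
n|P$.

All formal series are power series in $1/y_1$ and $y_i/y_{i+1}$. The monomial $y^{-m}$ has as
exponents there the tail sums $\sum_{i\ge l}m_i$; their total, the height, gives the finiteness
statements. Over $\mathbb R$ this ring is a domain, so identities between the series of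
$1/(y_i-x_r)$ and $1/(y_i-y_k)$ are proved by clearing denominators.

The function $\prod_{j<k}(y_k-y_j)^\lambda\prod_{r,i}(y_i-x_r)^{-\lambda}$ is a kernel function:
`kernel_identity` exchanges the second-order operator in $x$ for $\sum_i\partial_{y_i}^2$ minus
$\lambda(\lambda-1)\sum_{i\ne k}(y_i-y_k)^{-2}$. Taking a coefficient allows integration by parts,
which moves $\partial_{y_i}^2$ onto $p_a$. The equation $p_a''=2yp_a'-2ap_a$ then produces the
eigenvalue (`laurentCoeff_mul_logDerivative`). The remaining interaction is expanded by
$(y_j-y_k)^{-2}=\sum_{\nu\ge1}\nu y_j^{\nu-1}y_k^{-\nu-1}$ and $y^np_a=\sum_sb_s(n,a)p_{a+n-2s}$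
(`sum_bCoeff_mul_hermiteCoeff`). The result is the triangular action $\hat Hf_m=2|m|f_m+\sum
g(m-\mathbf E)f_{m-\mathbf E}$ (`reducedHamiltonian_fH`). Removing the last link of a chain shows
$2(|n|-|m|)\beta_n(m)=\sum g(m)\beta_n(m+\mathbf E)$ (`beta_recursion`), which is the eigenvalue
equation for $\sum\beta_n(m)f_m$.

For non-vanishing, let $d=|n|$. The degree-$d$ part of $P_n$ is that of $f_n$, namely
$(\mathrm{id}\otimes A)G_d$, where $G_d$ is the degree-$d$ part of $\prod(1-x_ry_i)^{-\lambda}$ and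
$A$ is a linear functional. Since $\lambda>0$, $G_d$ is a combination with positive coefficients of
the products $p_\mu(x)p_\mu(y)$ of power sums. If $P_n=0$, then $(A\otimes A)G_d=0$ is a positive
combination of the squares $A(p_\mu)^2$, so $A$ kills every symmetric polynomial of degree $d$. But
$A$ is positive on the symmetrization of $X^n$, by the rearrangement inequality. -/

namespace Calogero

noncomputable section

open Finset

/-! ### Tail sums -/

/-- The tail sum `∑_{i ≥ l} mᵢ`. -/
def tail {N : ℕ} (m : Fin N → ℤ) (l : ℕ) : ℤ :=
  ∑ i ∈ univ.filter fun i : Fin N => l ≤ i.val, m i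

/-- The weighted sum `∑ᵢ (i + 1) mᵢ`, i.e. the sum of all tail sums. -/
def height {N : ℕ} (m : Fin N → ℤ) : ℤ := ∑ i : Fin N, ((i : ℤ) + 1) * m i

variable {N : ℕ}

lemma tail_add (m n : Fin N → ℤ) (l : ℕ) : tail (m + n) l = tail m l + tail n l := by
  simp [tail, sum_add_distrib]

lemma tail_sub (m n : Fin N → ℤ) (l : ℕ) : tail (m - n) l = tail m l - tail n l := by
  simp [tail, sum_sub_distrib]

lemma tail_zero_right (m : Fin N → ℤ) : tail m 0 = ∑ i, m i := by simp [tail]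

lemma tail_single (i : Fin N) (a : ℤ) (l : ℕ) :
    tail (Pi.single i a) l = if l ≤ (i : ℕ) then a else 0 := by
  simp [tail, Pi.single_apply]

lemma tail_self (m : Fin N → ℤ) (l : ℕ) (hl : N ≤ l) : tail m l = 0 := by
  unfold tail
  rw [Finset.filter_false_of_mem, sum_empty]
  intro i _; omega

lemma tail_sub_tail_succ (m : Fin N → ℤ) (i : Fin N) : tail m i - tail m (i + 1) = m i := by
  unfold tail
  rw [sub_eq_iff_eq_add]
  have : (univ.filter fun j : Fin N => (i : ℕ) ≤ j)
      = insert i (univ.filter fun j : Fin N => (i : ℕ) + 1 ≤ j) := by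
    ext j; simp [Fin.ext_iff]; omega
  rw [this, sum_insert (by simp)]

lemma sum_tail (m : Fin N → ℤ) : ∑ l ∈ range N, tail m l = height m := by
  unfold tail height
  simp_rw [sum_filter]
  rw [sum_comm]
  refine sum_congr rfl fun i _ => ?_
  rw [← sum_filter]
  have : ((range N).filter fun l => l ≤ (i : ℕ)) = range (i + 1) := by
    ext l; simp; omega
  simp [this]

lemma height_add (m n : Fin N → ℤ) : height (m + n) = height m + height n := by
  simp [height, mul_add, sum_add_distrib]

lemma height_sum {ι : Type*} (s : Finset ι) (f : ι → Fin N → ℤ) :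
    height (∑ r ∈ s, f r) = ∑ r ∈ s, height (f r) := by
  simp only [height, Finset.sum_apply, mul_sum]
  rw [sum_comm]

/-- The tail sums are non-negative with total at most `H`, so each lies in `[0, H]`, and every entry
is a difference of two consecutive ones. -/
lemma finite_setOf_tail_nonneg (H : ℤ) :
    {m : Fin N → ℤ | (∀ l, 0 ≤ tail m l) ∧ height m ≤ H}.Finite := by
  refine (Set.finite_Icc (fun _ => -H) (fun _ => H)).subset ?_
  rintro m ⟨h0, hH⟩
  have hb : ∀ l, tail m l ≤ H := by
    intro l
    have h00 : 0 ≤ height m := by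
      rw [← sum_tail]; exact sum_nonneg fun l _ => h0 l
    by_cases hl : l < N
    · refine le_trans ?_ hH
      rw [← sum_tail]
      exact single_le_sum (f := fun l => tail m l) (fun l _ => h0 l) (mem_range.2 hl)
    · rw [tail_self m l (by omega)]; omega
  refine ⟨fun i => ?_, fun i => ?_⟩
  · have := tail_sub_tail_succ m i
    have := h0 i; have := hb (i + 1)
    show -H ≤ m i
    omega
  · have := tail_sub_tail_succ m i
    have := hb i; have := h0 (i + 1)
    show m i ≤ H
    omega

/-! ### Chains -/

lemma Step.sum_shift (c : Step N) : ∑ i, c.shift i = 2 * (1 + c.t + c.u) := by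
  simp [Step.shift, sum_add_distrib]; ring

/-- In the height, `ν` enters with coefficient `k - j ≥ 1`, because it is moved from position `j` to
the later position `k`. This is what bounds all three indices, although the shift itself may have
negative entries. -/
lemma Step.height_shift (c : Step N) :
    1 + (c.t : ℤ) + c.u + c.nu ≤ height c.shift := by
  have h : height c.shift = ((c.pair.1.1 : ℕ) + 1) * (1 + 2 * (c.t : ℤ) - c.nu)
      + ((c.pair.1.2 : ℕ) + 1) * (1 + 2 * (c.u : ℤ) + c.nu) := by
    simp [height, Step.shift, mul_add, sum_add_distrib, Pi.single_apply]
  have hlt : ((c.pair.1.1 : ℕ) : ℤ) + 1 ≤ (c.pair.1.2 : ℕ) := by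
    have : (c.pair.1.1 : ℕ) < c.pair.1.2 := c.pair.2
    omega
  rw [h]
  have h1 : (0 : ℤ) ≤ (c.pair.1.1 : ℕ) := by positivity
  have h2 : (0 : ℤ) ≤ c.t := by positivity
  have h3 : (0 : ℤ) ≤ c.u := by positivity
  have h4 : (0 : ℤ) ≤ c.nu := by positivity
  nlinarith [mul_nonneg h1 h2, mul_nonneg h1 h3, mul_nonneg (sub_nonneg.2 hlt) h3,
    mul_nonneg (sub_nonneg.2 hlt) h4]

lemma finite_setOf_step (H : ℕ) : {c : Step N | c.t ≤ H ∧ c.u ≤ H ∧ c.nu ≤ H}.Finite := by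
  have hf : Function.Injective
      (fun c : Step N => (c.pair, c.t, c.u, c.nu)) := by
    rintro ⟨a, b, c, d⟩ ⟨a', b', c', d'⟩ h
    simp only [Prod.mk.injEq] at h
    obtain ⟨rfl, rfl, rfl, rfl⟩ := h
    rfl
  refine Set.Finite.of_finite_image (f := fun c : Step N => (c.pair, c.t, c.u, c.nu))
    (((Set.finite_univ (α := Pairs N)).prod ((Set.finite_Iic H).prod
      ((Set.finite_Iic H).prod (Set.finite_Iic H)))).subset ?_) hf.injOn
  rintro _ ⟨c, ⟨h1, h2, h3⟩, rfl⟩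
  simp [h1, h2, h3]

/-- Chains of any length `s ≥ 0`. -/
abbrev Links (N : ℕ) : Type := Σ s : ℕ, (Fin s → Step N)

/-- The contribution of a chain of any length; the empty chain contributes `δ_n(m)`. -/
def linksTerm (lam : ℝ) (n m : Fin N → ℤ) (c : Links N) : ℝ :=
  (if n = m + ∑ r, (c.2 r).shift then 1 else 0)
    * ∏ r, (c.2 r).weight lam (n - ∑ l ∈ Finset.Iic r, (c.2 l).shift)
        / (4 * ∑ l ∈ Finset.Iic r, (1 + ((c.2 l).t : ℝ) + ((c.2 l).u : ℝ)))

lemma eq_of_linksTerm_ne_zero {lam : ℝ} {n m : Fin N → ℤ} {c : Links N}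
    (h : linksTerm lam n m c ≠ 0) : n = m + ∑ r, (c.2 r).shift := by
  by_contra hn
  simp [linksTerm, hn] at h

/-- Every link raises the height by at least `1 + t + u + ν`, so `height n - height m` bounds both
the length of the chain and all of its indices. -/
lemma finite_setOf_links (n m : Fin N → ℤ) :
    {c : Links N | n = m + ∑ r, (c.2 r).shift}.Finite := by
  set H : ℕ := (height n - height m).toNat
  refine ((Set.finite_Iic H).biUnion (t := fun s => Sigma.mk s '' Set.pi Set.univ
    fun _ => {c : Step N | c.t ≤ H ∧ c.u ≤ H ∧ c.nu ≤ H})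
    fun s _ => (Set.Finite.pi fun _ => finite_setOf_step H).image _).subset ?_
  rintro ⟨s, c⟩ h
  have h' : ∑ r, height (c r).shift = height n - height m := by
    have := congrArg height (h : n = m + ∑ r, (c r).shift)
    rw [height_add, height_sum] at this
    dsimp only at this ⊢
    omega
  have hpos : ∀ r, 0 ≤ height (c r).shift := fun r => by
    have := (c r).height_shift; omega
  have hle : ∀ r, height (c r).shift ≤ height n - height m := fun r => by
    rw [← h']
    exact single_le_sum (f := fun r => height (c r).shift) (fun r _ => hpos r) (mem_univ r)
  have hs : (s : ℤ) ≤ height n - height m := by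
    rw [← h']
    calc (s : ℤ) = ∑ _r : Fin s, (1 : ℤ) := by simp
      _ ≤ _ := sum_le_sum fun r _ => by have := (c r).height_shift; omega
  refine Set.mem_biUnion (show s ∈ Set.Iic H by rw [Set.mem_Iic]; omega) ⟨c, fun r _ => ?_, rfl⟩
  show (c r).t ≤ H ∧ (c r).u ≤ H ∧ (c r).nu ≤ H
  have := (c r).height_shift
  have := hle r
  omega

lemma finite_support_linksTerm (lam : ℝ) (n m : Fin N → ℤ) :
    (Function.support (linksTerm lam n m)).Finite :=
  (finite_setOf_links n m).subset fun _ hc => eq_of_linksTerm_ne_zero hc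

/-- Chains of length `s ≥ 1` among all chains. -/
def linksEquiv : Option (Chain N) ≃ Links N where
  toFun o := o.elim ⟨0, Fin.elim0⟩ fun c => ⟨c.1.1, c.2⟩
  invFun c := match c with
    | ⟨0, _⟩ => none
    | ⟨s + 1, d⟩ => some ⟨⟨s + 1, by omega⟩, d⟩
  left_inv o := by
    rcases o with _ | ⟨⟨s, hs⟩, d⟩
    · rfl
    · cases s with
      | zero => omega
      | succ s => rfl
  right_inv c := by
    rcases c with ⟨_ | s, d⟩
    · simp [funext_iff]
    · rfl

/-- A chain of length `s ≥ 1` is a shorter chain followed by its last link. -/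
def chainEquiv : Links N × Step N ≃ Chain N where
  toFun p := ⟨⟨p.1.1 + 1, by omega⟩, Fin.snoc (α := fun _ => Step N) p.1.2 p.2⟩
  invFun c := match c with
    | ⟨⟨0, h⟩, _⟩ => absurd h (by omega)
    | ⟨⟨s + 1, _⟩, d⟩ => (⟨s, Fin.init (α := fun _ => Step N) d⟩, d (Fin.last s))
  left_inv p := by
    rcases p with ⟨⟨s, d⟩, c⟩
    simp
  right_inv c := by
    rcases c with ⟨⟨_ | s, hs⟩, d⟩
    · omega
    · simp

lemma finite_support_chainTerm (lam : ℝ) (n m : Fin N → ℤ) :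
    (Function.support (chainTerm lam n m)).Finite := by
  have hinj : Function.Injective (fun c : Chain N => linksEquiv (some c)) :=
    linksEquiv.injective.comp (Option.some_injective _)
  refine ((finite_support_linksTerm lam n m).preimage hinj.injOn).subset fun c hc => hc

lemma beta_eq_finsum (lam : ℝ) (n m : Fin N → ℤ) :
    beta lam n m = ∑ᶠ c : Links N, linksTerm lam n m c := by
  have h1 : (fun o : Option (Chain N) => linksTerm lam n m (linksEquiv o)) ∘ some
      = chainTerm lam n m := rfl
  have hfin : (Function.support fun o : Option (Chain N) =>
      linksTerm lam n m (linksEquiv o)).Finite :=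
    (finite_support_linksTerm lam n m).preimage linksEquiv.injective.injOn
  rw [← finsum_comp_equiv linksEquiv, beta,
    ← finsum_mem_univ (fun o => linksTerm lam n m (linksEquiv o)), ← Set.range_some_union_none,
    finsum_mem_union' (by simp) (hfin.subset Set.inter_subset_right)
      (hfin.subset Set.inter_subset_right), finsum_mem_singleton, add_comm]
  congr 1
  · rw [finsum_mem_range (Option.some_injective _)]; rfl
  · show _ = linksTerm lam n m ⟨0, Fin.elim0⟩
    unfold linksTerm
    dsimp only
    rw [Fin.sum_univ_zero, Fin.prod_univ_zero, add_zero, mul_one]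

/-- On the support of the Kronecker delta, the last factor has its weight evaluated at `n - ∑ 𝐄 =
m`. Its denominator `4 ∑ (1 + t + u)` is `2 (|n| - |m|)`, since each shift has total `2 (1 + t +
u)`. -/
lemma linksTerm_snoc (lam : ℝ) (n m : Fin N → ℤ) (c : Links N) (d : Step N) :
    2 * ((∑ i, (n i : ℝ)) - ∑ i, (m i : ℝ)) * chainTerm lam n m (chainEquiv (c, d))
      = d.weight lam m * linksTerm lam n (m + d.shift) c := by
  rcases c with ⟨s, c⟩
  have hterm : chainTerm lam n m (chainEquiv (⟨s, c⟩, d))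
      = linksTerm lam n m ⟨s + 1, Fin.snoc (α := fun _ => Step N) c d⟩ := rfl
  rw [hterm]
  unfold linksTerm
  dsimp only
  have hIic : ∀ r : Fin s, (Finset.Iic r.castSucc : Finset (Fin (s + 1)))
      = (Finset.Iic r).map Fin.castSuccEmb := by
    intro r; ext x
    simp only [mem_Iic, mem_map, Fin.coe_castSuccEmb]
    constructor
    · intro h
      have hx : (x : ℕ) < s := lt_of_le_of_lt (Fin.le_def.1 h) r.2
      exact ⟨⟨x, hx⟩, Fin.le_def.2 (Fin.le_def.1 h), rfl⟩
    · rintro ⟨y, hy, rfl⟩; simpa using hy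
  have hlast : (Finset.Iic (Fin.last s) : Finset (Fin (s + 1))) = univ := by
    ext x; simp [Fin.le_last]
  rw [Fin.prod_univ_castSucc, Fin.sum_univ_castSucc]
  simp only [Fin.snoc_castSucc, Fin.snoc_last, hIic, hlast, sum_map, Fin.coe_castSuccEmb,
    Fin.sum_univ_castSucc]
  have hcomm : m + (∑ r, (c r).shift + d.shift) = m + d.shift + ∑ r, (c r).shift := by abel
  rw [hcomm]
  by_cases h : n = m + d.shift + ∑ r, (c r).shift
  · have hm : n - (∑ r, (c r).shift + d.shift) = m := by rw [h]; abel
    have hs : (∑ i, (n i : ℝ)) - ∑ i, (m i : ℝ)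
        = 2 * (∑ l, (1 + ((c l).t : ℝ) + ((c l).u : ℝ)) + (1 + (d.t : ℝ) + d.u)) := by
      have h2 : (∑ i, n i) - ∑ i, m i
          = 2 * (∑ l, (1 + ((c l).t : ℤ) + ((c l).u : ℤ)) + (1 + (d.t : ℤ) + d.u)) := by
        conv_lhs => rw [h]
        simp only [Pi.add_apply, Finset.sum_apply, sum_add_distrib, Step.sum_shift]
        rw [sum_comm]
        simp only [Step.sum_shift, ← mul_sum, sum_add_distrib]
        ring
      exact_mod_cast h2
    rw [hm, if_pos h, hs]
    have hne : (∑ l, (1 + ((c l).t : ℝ) + ((c l).u : ℝ)) + (1 + (d.t : ℝ) + d.u)) ≠ 0 := by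
      positivity
    field_simp
    ring
  · simp [h]

/-- The prefactor kills the empty chain, which requires `n = m`. All other chains are split into
their last link and the rest by `linksTerm_snoc`. -/
lemma beta_recursion (lam : ℝ) (n m : Fin N → ℤ) :
    2 * ((∑ i, (n i : ℝ)) - ∑ i, (m i : ℝ)) * beta lam n m
      = ∑ᶠ d : Step N, d.weight lam m * beta lam n (m + d.shift) := by
  have hfin : (Function.support fun p : Links N × Step N =>
      p.2.weight lam m * linksTerm lam n (m + p.2.shift) p.1).Finite := by
    refine ((finite_support_chainTerm lam n m).preimage chainEquiv.injective.injOn).subset ?_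
    rintro ⟨c, d⟩ hp
    simp only [Function.mem_support, ← linksTerm_snoc] at hp
    exact right_ne_zero_of_mul hp
  have h1 : 2 * ((∑ i, (n i : ℝ)) - ∑ i, (m i : ℝ)) * beta lam n m
      = ∑ᶠ p : Links N × Step N, p.2.weight lam m * linksTerm lam n (m + p.2.shift) p.1 := by
    have h0 : 2 * ((∑ i, (n i : ℝ)) - ∑ i, (m i : ℝ)) * (if n = m then (1 : ℝ) else 0) = 0 := by
      split_ifs with h
      · simp [h]
      · simp
    rw [beta, mul_add, h0, zero_add, mul_finsum,
      ← finsum_comp_equiv chainEquiv]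
    exact finsum_congr fun ⟨c, d⟩ => linksTerm_snoc lam n m c d
  rw [h1, ← finsum_comp_equiv (Equiv.prodComm (Step N) (Links N)), finsum_curry]
  · refine finsum_congr fun d => ?_
    rw [beta_eq_finsum, mul_finsum]
    rfl
  · exact hfin.preimage (Equiv.injective _).injOn

/-! ### Triangularity of `β`. -/

lemma exists_of_beta_ne_zero {lam : ℝ} {n m : Fin N → ℤ} (h : beta lam n m ≠ 0) :
    ∃ c : Links N, n = m + ∑ r, (c.2 r).shift := by
  rw [beta_eq_finsum] at h
  obtain ⟨c, hc⟩ : ∃ c, linksTerm lam n m c ≠ 0 := by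
    by_contra! h'
    exact h (finsum_eq_zero_of_forall_eq_zero h')
  exact ⟨c, eq_of_linksTerm_ne_zero hc⟩

lemma height_le_of_beta_ne_zero {lam : ℝ} {n m : Fin N → ℤ} (h : beta lam n m ≠ 0) :
    height m ≤ height n := by
  obtain ⟨c, hc⟩ := exists_of_beta_ne_zero h
  rw [hc, height_add, height_sum]
  have : 0 ≤ ∑ r, height (c.2 r).shift := sum_nonneg fun r _ => by
    have := (c.2 r).height_shift; omega
  omega

lemma sum_lt_or_eq_of_beta_ne_zero {lam : ℝ} {n m : Fin N → ℤ} (h : beta lam n m ≠ 0) :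
    m = n ∨ ∑ i, m i < ∑ i, n i := by
  obtain ⟨⟨s, c⟩, hc⟩ := exists_of_beta_ne_zero h
  dsimp only at c hc
  cases s with
  | zero => left; simp [hc]
  | succ s =>
    right
    rw [hc]
    simp only [Pi.add_apply, Finset.sum_apply, sum_add_distrib]
    rw [sum_comm]
    simp only [Step.sum_shift]
    have : 0 < ∑ r, 2 * (1 + ((c r).t : ℤ) + (c r).u) := by positivity
    omega

lemma beta_self (lam : ℝ) (n : Fin N → ℤ) : beta lam n n = 1 := by
  rw [beta, if_pos rfl, finsum_eq_zero_of_forall_eq_zero, add_zero]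
  rintro ⟨⟨s, hs⟩, c⟩
  rw [chainTerm, if_neg, zero_mul]
  intro h
  dsimp only at c h
  have h2 : ∑ i, n i = ∑ i, n i + ∑ r, 2 * (1 + ((c r).t : ℤ) + (c r).u) := by
    have := congrArg (fun f : Fin N → ℤ => ∑ i, f i) h
    simp only [Pi.add_apply, Finset.sum_apply, sum_add_distrib] at this
    rw [sum_comm (s := univ (α := Fin N))] at this
    simpa only [Step.sum_shift] using this
  have : 0 < ∑ r, 2 * (1 + ((c r).t : ℤ) + (c r).u) :=
    sum_pos (fun r _ => by positivity) ⟨⟨0, hs⟩, mem_univ _⟩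
  omega

end

end Calogero

namespace Calogero

noncomputable section

open Finset

/-! ### The coefficients `b_s(n, a)` -/

/-- The sum of `g (σ j) / ∏ᵢ (σ i - σ (i + 1))!` over all chains `s = σ 0 > σ 1 > ⋯ > σ j`. -/
def chainSum (g : ℕ → ℝ) : ℕ → ℕ → ℝ
  | 0, s => g s
  | j + 1, s => ∑ r ∈ range s, chainSum g j r / ((s - r).factorial : ℝ)

/-- Induction on the length: deleting the first entry `s` of a chain leaves a chain that starts at
some `r < s` and costs the factor `1 / (s - r)!`. -/
lemma sum_strictAnti_eq_chainSum (g : ℕ → ℝ) (M j : ℕ) (s : Fin M) :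
    ∑ σ : Fin (j + 1) → Fin M with StrictAnti σ ∧ σ 0 = s,
      g (σ (Fin.last j)) / ∏ i : Fin j, (((σ i.castSucc : ℕ) - (σ i.succ : ℕ)).factorial : ℝ)
      = chainSum g j s := by
  induction j generalizing s with
  | zero =>
    rw [sum_eq_single (fun _ => s)]
    · simp [chainSum]
    · intro σ hσ hne
      refine absurd (funext fun i => ?_) hne
      obtain rfl : i = 0 := Fin.ext (by omega)
      exact (mem_filter.1 hσ).2.2
    · intro h
      refine absurd (mem_filter.2 ⟨mem_univ _, fun x y hxy => ?_, rfl⟩) h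
      exact absurd (Fin.lt_def.1 hxy) (by omega)
  | succ j ih =>
    have hcons : ∀ y : Fin (j + 1) → Fin M,
        StrictAnti (Fin.cons (α := fun _ => Fin M) s y) ↔ y 0 < s ∧ StrictAnti y := by
      intro y
      constructor
      · intro h
        refine ⟨by simpa using h (Fin.succ_pos 0), fun a b hab => ?_⟩
        simpa using h (Fin.succ_lt_succ_iff.2 hab)
      · rintro ⟨h0, h⟩ a b hab
        induction b using Fin.cases with
        | zero => exact absurd hab (Fin.not_lt_zero _)
        | succ b =>
          induction a using Fin.cases with
          | zero =>
            simp only [Fin.cons_succ, Fin.cons_zero]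
            exact lt_of_le_of_lt (h.antitone (Fin.zero_le b)) h0
          | succ a => simpa using h (Fin.succ_lt_succ_iff.1 hab)
    have hrange : ∑ r ∈ range s, chainSum g j r / (((s : ℕ) - r).factorial : ℝ)
        = ∑ r : Fin M, if r < s then chainSum g j r / (((s : ℕ) - r).factorial : ℝ) else 0 := by
      rw [← sum_filter]
      refine sum_nbij' (fun r => if h : r < M then ⟨r, h⟩ else s) (fun r => r) ?_ ?_ ?_ ?_ ?_
      · intro r hr
        have hr := mem_range.1 hr
        simp only [dif_pos (hr.trans s.2), mem_filter, mem_univ, true_and]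
        exact Fin.lt_def.2 hr
      · intro r hr
        exact mem_range.2 (Fin.lt_def.1 (mem_filter.1 hr).2)
      · intro r hr
        have hr := mem_range.1 hr
        simp [hr.trans s.2]
      · intro r _; simp
      · intro r hr
        have hr := mem_range.1 hr
        simp [hr.trans s.2]
    rw [sum_filter, ← (Fin.consEquiv fun _ : Fin (j + 2) => Fin M).sum_comp, Fintype.sum_prod_type,
      sum_eq_single s _ (by simp), chainSum, hrange]
    · simp only [← ih, sum_filter, sum_div, ite_div, zero_div]
      have : ∀ r : Fin M, (if r < s then ∑ y : Fin (j + 1) → Fin M, (if StrictAnti y ∧ y 0 = r then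
            g (y (Fin.last j))
              / (∏ i : Fin j, (((y i.castSucc : ℕ) - (y i.succ : ℕ)).factorial : ℝ))
              / (((s : ℕ) - r).factorial : ℝ) else 0) else 0)
          = ∑ y : Fin (j + 1) → Fin M, if y 0 = r then if StrictAnti y ∧ r < s then
            g (y (Fin.last j))
              / (∏ i : Fin j, (((y i.castSucc : ℕ) - (y i.succ : ℕ)).factorial : ℝ))
              / (((s : ℕ) - r).factorial : ℝ) else 0 else 0 := by
        intro r
        split_ifs with h
        · refine sum_congr rfl fun y _ => ?_
          by_cases h1 : y 0 = r <;> simp [h1, h]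
        · exact (sum_eq_zero fun y _ => by simp [h]).symm
      refine Eq.trans ?_ (sum_congr rfl fun r _ => (this r).symm)
      rw [sum_comm]
      refine sum_congr rfl fun y _ => ?_
      rw [sum_ite_eq, if_pos (mem_univ _)]
      simp only [Fin.consEquiv, Equiv.coe_fn_mk, hcons, Fin.cons_zero, and_true,
        and_comm (a := StrictAnti y)]
      congr 1
      rw [Fin.prod_univ_succ, ← Fin.succ_last]
      simp only [Fin.cons_succ, Fin.castSucc_zero, Fin.cons_zero, ← Fin.succ_castSucc]
      rw [div_div, mul_comm]
    · intro r _ hr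
      refine sum_eq_zero fun y _ => if_neg ?_
      rintro ⟨-, h⟩
      exact hr (by simpa [Fin.consEquiv] using h)

lemma chainSum_eq_zero (g : ℕ → ℝ) {j s : ℕ} (h : s < j) : chainSum g j s = 0 := by
  induction j generalizing s with
  | zero => omega
  | succ j ih =>
    rw [chainSum]
    refine sum_eq_zero fun r hr => ?_
    rw [ih (by have := mem_range.1 hr; omega), zero_div]

/-- The alternating sum over all chains starting at `s`. -/
def altChainSum (g : ℕ → ℝ) (s : ℕ) : ℝ := ∑ j ∈ range (s + 1), (-1) ^ j * chainSum g j s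

lemma altChainSum_eq (g : ℕ → ℝ) {s M : ℕ} (h : s < M) :
    ∑ j ∈ range M, (-1) ^ j * chainSum g j s = altChainSum g s := by
  symm
  refine sum_subset (range_subset_range.2 h) fun j _ hj => ?_
  rw [chainSum_eq_zero, mul_zero]
  simpa using hj

/-- By the recursion for `chainSum`, the chains with `j + 1` steps from `s` cancel against those
with `j` steps from all `r < s`. The alternating sum thus inverts convolution with `1 / k!`. -/
lemma sum_altChainSum_div (g : ℕ → ℝ) (s : ℕ) :
    ∑ p ∈ antidiagonal s, altChainSum g p.1 * (1 / (p.2.factorial : ℝ)) = g s := by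
  rw [Nat.sum_antidiagonal_eq_sum_range_succ
    (fun i j => altChainSum g i * (1 / (j.factorial : ℝ))), sum_range_succ]
  have h : altChainSum g s
      = g s - ∑ r ∈ range s, altChainSum g r * (1 / ((s - r).factorial : ℝ)) := by
    rw [altChainSum, sum_range_succ', chainSum, eq_sub_iff_add_eq, add_right_comm]
    have : ∑ j ∈ range s, (-1 : ℝ) ^ (j + 1) * chainSum g (j + 1) s
        + ∑ r ∈ range s, altChainSum g r * (1 / ((s - r).factorial : ℝ)) = 0 := by
      have h1 : ∑ r ∈ range s, altChainSum g r * (1 / ((s - r).factorial : ℝ))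
          = ∑ r ∈ range s, ∑ j ∈ range s,
            ((-1) ^ j * chainSum g j r) * (1 / ((s - r).factorial : ℝ)) := by
        refine sum_congr rfl fun r hr => ?_
        rw [← altChainSum_eq g (mem_range.1 hr), sum_mul]
      rw [h1, sum_comm, ← sum_add_distrib]
      refine sum_eq_zero fun j _ => ?_
      rw [chainSum, mul_sum, ← sum_add_distrib]
      refine sum_eq_zero fun r _ => ?_
      rw [pow_succ]; ring
    rw [this]; ring
  simp only [Nat.sub_self, Nat.factorial_zero, Nat.cast_one, div_one, mul_one]
  linarith

lemma sum_antidiagonal_neg_one_pow_div (K : ℕ) :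
    ∑ p ∈ antidiagonal K, (1 / (p.1.factorial : ℝ)) * ((-1) ^ p.2 / (p.2.factorial : ℝ))
      = if K = 0 then 1 else 0 := by
  have h := congrArg (PowerSeries.coeff K) (PowerSeries.exp_mul_exp_neg_eq_one (A := ℝ))
  rw [PowerSeries.coeff_mul, PowerSeries.coeff_one] at h
  rw [← h]
  refine sum_congr rfl fun p _ => ?_
  simp [PowerSeries.evalNegHom, PowerSeries.coeff_rescale, PowerSeries.coeff_exp, div_eq_mul_inv]

/-- The generating function times `exp` is that of `g`; multiplying by `exp(-X)` collapses the
nested sum to a single convolution. -/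
lemma altChainSum_closed (g : ℕ → ℝ) (s : ℕ) :
    altChainSum g s
      = ∑ p ∈ antidiagonal s, g p.1 * ((-1) ^ p.2 / (p.2.factorial : ℝ)) := by
  have h1 : PowerSeries.mk (altChainSum g) * PowerSeries.exp ℝ = PowerSeries.mk g := by
    ext s
    rw [PowerSeries.coeff_mul, PowerSeries.coeff_mk, ← sum_altChainSum_div g s]
    simp [PowerSeries.coeff_exp]
  have h2 : PowerSeries.mk (altChainSum g)
      = PowerSeries.mk g * PowerSeries.evalNegHom (PowerSeries.exp ℝ) := by
    rw [← h1, mul_assoc, PowerSeries.exp_mul_exp_neg_eq_one, mul_one]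
  have h3 := congrArg (PowerSeries.coeff s) h2
  rw [PowerSeries.coeff_mk, PowerSeries.coeff_mul] at h3
  rw [h3]
  refine sum_congr rfl fun p _ => ?_
  simp [PowerSeries.evalNegHom, PowerSeries.coeff_rescale, PowerSeries.coeff_exp, div_eq_mul_inv]

/-! ### Closed form of `b_s(n, a)` and the expansion of `xⁿ p_a(x)`. -/

lemma poch_mul (z : ℝ) (m k : ℕ) : poch z m * poch (z + m) k = poch z (m + k) := by
  rw [poch, poch, poch, ← ascPochhammer_mul, Polynomial.eval_mul, Polynomial.eval_comp]
  simp

lemma bCoeff_eq_sum (s : ℕ) (n : ℤ) (a : ℝ) :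
    bCoeff s n a = ∑ p ∈ antidiagonal s, hermiteCoeff p.1 a
      * (poch (a + n - 2 * s + 1) (2 * p.2) / (4 ^ p.2 * p.2.factorial)) := by
  -- The outer `s` is frozen inside `g`: only the end point `r` of a chain varies, so the chain sums
  -- started at smaller indices use the same `g`.
  set g : ℕ → ℝ := fun r => poch (a - 2 * r + 1) (2 * r)
    * poch (a + n - 2 * s + 1) (2 * (s - r)) / (4 ^ s * (r.factorial : ℝ)) with hg
  have h1 : bCoeff s n a = (-1) ^ s * altChainSum g s := by
    rw [altChainSum, sum_range_succ', chainSum, mul_add, mul_sum, bCoeff, add_comm]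
    congr 1
    · rw [range_eq_Ico, sum_Ico_add' (fun j => (-1 : ℝ) ^ s * ((-1) ^ j * chainSum g j s)) 0 s 1]
      refine sum_congr (by ext j; simp) fun j _ => ?_
      have hcs := sum_strictAnti_eq_chainSum g (s + 1) j (Fin.last s)
      rw [Fin.val_last] at hcs
      rw [← hcs, pow_add, mul_comm ((-1 : ℝ) ^ j), mul_assoc]
      congr 2
      refine sum_congr rfl fun σ _ => ?_
      simp only [hg]
      rw [div_div]
    · simp [hg, poch]
      ring
  rw [h1, altChainSum_closed, mul_sum]
  refine sum_congr rfl fun p hp => ?_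
  obtain rfl := (HasAntidiagonal.mem_antidiagonal.1 hp).symm
  have hsq : ((-1 : ℝ) ^ p.2) * (-1) ^ p.2 = 1 := by rw [← mul_pow]; simp
  simp only [hg, hermiteCoeff, Nat.add_sub_cancel_left, pow_add]
  field_simp
  linear_combination (poch (a - 2 * p.1 + 1) (2 * p.1)
    * poch (a + n - 2 * ((p.1 + p.2 : ℕ) : ℝ) + 1) (2 * p.2)) * hsq

/-- The coefficients of `xⁿ p_a(x) = ∑_s b_s(n, a) p_{a+n-2s}(x)`. -/
lemma sum_bCoeff_mul_hermiteCoeff (s : ℕ) (n : ℤ) (a : ℝ) :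
    ∑ p ∈ antidiagonal s, bCoeff p.1 n a * hermiteCoeff p.2 (a + n - 2 * p.1)
      = hermiteCoeff s a := by
  simp_rw [bCoeff_eq_sum, sum_mul]
  -- The two adjacent Pochhammer symbols, of lengths `2q` and `2v`, join into one of length `2 (v +
  -- q)`. For fixed `v + q` the rest is a coefficient of `exp(X) exp(-X) = 1`, so only `v + q = 0`
  -- survives.
  rw [sum_sigma', sum_bij' (t := (antidiagonal s).sigma fun p => antidiagonal p.2)
    (g := fun x => hermiteCoeff x.1.1 a * (poch (a + n - 2 * s + 1) (2 * x.1.2) / 4 ^ x.1.2)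
      * ((1 / (x.2.1.factorial : ℝ)) * ((-1) ^ x.2.2 / (x.2.2.factorial : ℝ))))
    (i := fun x _ => ⟨(x.2.1, x.2.2 + x.1.2), (x.2.2, x.1.2)⟩)
    (j := fun x _ => ⟨(x.1.1 + x.2.1, x.2.2), (x.1.1, x.2.1)⟩)]
  · rw [← sum_sigma' (f := fun (p q : ℕ × ℕ) =>
      hermiteCoeff p.1 a * (poch (a + n - 2 * s + 1) (2 * p.2) / 4 ^ p.2)
      * ((1 / (q.1.factorial : ℝ)) * ((-1) ^ q.2 / (q.2.factorial : ℝ))))]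
    simp_rw [← mul_sum, sum_antidiagonal_neg_one_pow_div]
    rw [sum_eq_single (s, 0)]
    · simp [poch]
    · rintro ⟨p, q⟩ hp hne
      have : q ≠ 0 := by
        rintro rfl
        simp at hp
        exact hne (by simp [hp])
      simp [this]
    · simp
  all_goals
    rintro ⟨⟨p, q⟩, ⟨u, v⟩⟩ h
    simp only [mem_sigma, HasAntidiagonal.mem_antidiagonal] at h ⊢
    obtain ⟨h1, h2⟩ := h
  · exact ⟨by rw [← h1, ← h2, add_assoc], trivial⟩
  · exact ⟨by rw [← h1, ← h2, add_assoc], trivial⟩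
  · subst h2; rfl
  · subst h2; rfl
  · subst h2 h1
    have hp := poch_mul (a + n - 2 * ((u + v + q : ℕ) : ℝ) + 1) (2 * q) (2 * v)
    have e : a + n - 2 * ((u + v + q : ℕ) : ℝ) + 1 + ((2 * q : ℕ) : ℝ)
        = a + n - 2 * ((u + v : ℕ) : ℝ) + 1 := by push_cast; ring
    rw [e] at hp
    have e2 : a + n - 2 * ((u + v : ℕ) : ℝ) - 2 * q + 1
        = a + n - 2 * ((u + v + q : ℕ) : ℝ) + 1 := by push_cast; ring
    rw [show 2 * (v + q) = 2 * q + 2 * v by ring, ← hp]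
    simp only [hermiteCoeff, e2, pow_add]
    field_simp

end

end Calogero

namespace Calogero

noncomputable section

open Finset

/-! ### Sums over pairs -/

variable {N : ℕ}

lemma two_mul_sum_Ioi {R : Type*} [CommRing R] (h : Fin N → Fin N → R)
    (hsymm : ∀ i j, h i j = h j i) (hdiag : ∀ i, h i i = 0) :
    2 * ∑ i, ∑ j ∈ Ioi i, h i j = ∑ i, ∑ j, h i j := by
  have h1 : ∀ i, ∑ j, h i j = ∑ j ∈ Ioi i, h i j + ∑ j ∈ Iio i, h i j := by
    intro i
    have hu : (univ : Finset (Fin N)) = insert i (Ioi i ∪ Iio i) := by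
      ext j
      rcases lt_trichotomy j i with h | h | h <;> simp [h]
    rw [hu, sum_insert (by simp), hdiag, zero_add, sum_union]
    rw [disjoint_left]
    intro j hj hj'
    exact absurd (mem_Ioi.1 hj) (mem_Iio.1 hj').asymm
  simp_rw [h1, sum_add_distrib]
  have h2 : ∑ i, ∑ j ∈ Iio i, h i j = ∑ i, ∑ j ∈ Ioi i, h i j := by
    rw [sum_comm' (t' := univ) (s' := fun j => Ioi j) (by simp)]
    exact sum_congr rfl fun i _ => sum_congr rfl fun j _ => hsymm _ _
  rw [h2, two_mul]

/-- If `d i j` behaves like `1 / (xᵢ - xⱼ)`, the off-diagonal terms of `∑ᵢ (∑ⱼ d i j)²` cancel. -/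
lemma sum_sq_eq_of_cyclic {R : Type*} [CommRing R] (h3 : ∀ a : R, 3 * a = 0 → a = 0)
    (d : Fin N → Fin N → R) (hanti : ∀ i j, d i j = -d j i) (hdiag : ∀ i, d i i = 0)
    (hcyc : ∀ i j k, i ≠ j → j ≠ k → k ≠ i → d i j * d j k + d j k * d k i + d k i * d i j = 0) :
    ∑ i, (∑ j, d i j) ^ 2 = ∑ i, ∑ j, d i j ^ 2 := by
  -- Pairwise distinct indices contribute zero by the cyclic relation, coinciding ones contribute
  -- squares. Summed over all triples, each side of the claim appears three times, hence `h3`.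
  have key : ∀ i k l, d i k * d i l + d k l * d k i + d l i * d l k
      = (if k = l then d i k ^ 2 else 0) + (if l = i then d k l ^ 2 else 0)
        + (if i = k then d l i ^ 2 else 0) := by
    intro i k l
    by_cases h1 : k = l
    · subst h1
      by_cases h2 : k = i
      · subst h2; simp [hdiag]
      · simp [hdiag, h2, Ne.symm h2, sq]
    · by_cases h2 : l = i
      · subst h2
        simp [hdiag, h1, Ne.symm h1, sq]
      · by_cases h4 : i = k
        · subst h4; simp [hdiag, h2, Ne.symm h2, sq]
        · simp only [h1, h2, h4, if_false]
          have := hcyc i k l h4 h1 h2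
          rw [hanti i l, hanti k i, hanti l k]
          linear_combination -this
  have hcycle : ∀ f : Fin N → Fin N → Fin N → R,
      ∑ i, ∑ k, ∑ l, f k l i = ∑ i, ∑ k, ∑ l, f i k l := by
    intro f
    rw [sum_comm]
    refine sum_congr rfl fun k _ => sum_comm
  have hsum : ∑ i, ∑ k, ∑ l, (d i k * d i l + d k l * d k i + d l i * d l k)
      = 3 * ∑ i, (∑ j, d i j) ^ 2 := by
    simp_rw [sum_add_distrib]
    rw [hcycle (fun a b c => d a b * d a c), ← hcycle (fun a b c => d c a * d c b)]
    simp_rw [sq, sum_mul_sum]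
    ring
  have hsum2 : ∑ i, ∑ k, ∑ l, ((if k = l then d i k ^ 2 else 0)
      + (if l = i then d k l ^ 2 else 0) + (if i = k then d l i ^ 2 else 0))
      = 3 * ∑ i, ∑ j, d i j ^ 2 := by
    simp_rw [sum_add_distrib]
    rw [hcycle (fun a b c => if b = c then d a b ^ 2 else 0),
      ← hcycle (fun a b c => if a = b then d c a ^ 2 else 0)]
    simp
    ring
  simp_rw [key] at hsum
  have := h3 (∑ i, (∑ j, d i j) ^ 2 - ∑ i, ∑ j, d i j ^ 2) (by
    rw [mul_sub, ← hsum, ← hsum2, sub_self])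
  exact sub_eq_zero.1 this

/-! ### The reduced Hamiltonian -/

open MvPolynomial in
/-- The reduced Hamiltonian `ψ₀⁻¹ (H - E₀) ψ₀`, applied to a polynomial and evaluated at `x`. -/
def reducedHamiltonian (lam : ℝ) (x : Fin N → ℝ) (P : MvPolynomial (Fin N) ℝ) : ℝ :=
  ∑ r, (-(eval x (pderiv r (pderiv r P))) + 2 * x r * eval x (pderiv r P))
    - 2 * lam * ∑ r, ∑ s, (eval x (pderiv r P)) / (x r - x s)

lemma hasDerivAt_update (x : Fin N → ℝ) (j i : Fin N) (t : ℝ) :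
    HasDerivAt (fun t => Function.update x j t i) (if i = j then 1 else 0) t := by
  by_cases h : i = j
  · subst h; simpa using hasDerivAt_id' t
  · simpa [Function.update_of_ne h, h] using hasDerivAt_const t (x i)

lemma hasDerivAt_eval_update (x : Fin N → ℝ) (j : Fin N) (P : MvPolynomial (Fin N) ℝ) (t : ℝ) :
    HasDerivAt (fun t => MvPolynomial.eval (Function.update x j t) P)
      (MvPolynomial.eval (Function.update x j t) (MvPolynomial.pderiv j P)) t := by
  induction P using MvPolynomial.induction_on with
  | C a => simpa using hasDerivAt_const t a
  | add p q hp hq => simpa using hp.fun_add hq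
  | mul_X p i hp =>
    have := hp.fun_mul (hasDerivAt_update x j i t)
    simp only [map_mul, MvPolynomial.eval_X, Derivation.leibniz, smul_eq_mul, map_add,
      MvPolynomial.pderiv_X]
    refine this.congr_deriv ?_
    by_cases h : i = j
    · subst h; simp; ring
    · simp [h]
      ring

/-- The logarithm of the ground state. -/
def logGroundState (lam : ℝ) (y : Fin N → ℝ) : ℝ :=
  ∑ i, (-(1 / 2) * y i ^ 2) + lam / 2 * ∑ i, ∑ k, Real.log (y i - y k)

/-- `Real.log` is the logarithm of the absolute value and vanishes at `0`, so half of the full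
double sum is the sum over pairs, for every ordering of the particles. -/
lemma groundState_eq_exp (lam : ℝ) {y : Fin N → ℝ} (hy : Function.Injective y) :
    groundState lam y = Real.exp (logGroundState lam y) := by
  rw [groundState, logGroundState, Real.exp_add, Real.exp_sum]
  congr 1
  have h2 := two_mul_sum_Ioi (fun i k => Real.log (y i - y k))
    (fun i j => by rw [← Real.log_neg_eq_log, neg_sub]) (fun i => by simp)
  rw [← h2, show lam / 2 * (2 * ∑ i, ∑ j ∈ Ioi i, Real.log (y i - y j))
    = ∑ i, ∑ j ∈ Ioi i, lam * Real.log (y i - y j) by simp_rw [← mul_sum]; ring, Real.exp_sum]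
  refine prod_congr rfl fun i _ => ?_
  rw [Real.exp_sum]
  refine prod_congr rfl fun j hj => ?_
  have hne : y j - y i ≠ 0 := sub_ne_zero.2 fun h => (mem_Ioi.1 hj).ne' (hy h)
  rw [Real.rpow_def_of_pos (abs_pos.2 hne), Real.log_abs, ← Real.log_neg_eq_log, neg_sub, mul_comm]

/-- The logarithmic derivative `-yⱼ + lam ∑_{k ≠ j} 1 / (yⱼ - yₖ)` of the ground state. -/
def groundDrift (lam : ℝ) (j : Fin N) (y : Fin N → ℝ) : ℝ := -y j + lam * ∑ k, 1 / (y j - y k)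

lemma hasDerivAt_logGroundState (lam : ℝ) (x : Fin N → ℝ) (j : Fin N) (t : ℝ)
    (hy : Function.Injective (Function.update x j t)) :
    HasDerivAt (fun t => logGroundState lam (Function.update x j t))
      (groundDrift lam j (Function.update x j t)) t := by
  have h1 : HasDerivAt (fun t => ∑ i, (-(1 / 2) * Function.update x j t i ^ 2))
      (∑ i, (-(1 / 2) * (2 * Function.update x j t i * if i = j then 1 else 0))) t := by
    refine HasDerivAt.fun_sum fun i _ => HasDerivAt.const_mul _ ?_
    simpa using (hasDerivAt_update x j i t).fun_pow 2
  have h2 : HasDerivAt (fun t => ∑ i, ∑ k,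
        Real.log (Function.update x j t i - Function.update x j t k))
      (∑ i, ∑ k, ((if i = j then 1 else 0) - (if k = j then 1 else 0))
        / (Function.update x j t i - Function.update x j t k)) t := by
    refine HasDerivAt.fun_sum fun i _ => HasDerivAt.fun_sum fun k _ => ?_
    by_cases hik : i = k
    · subst hik; simpa using hasDerivAt_const t (0 : ℝ)
    · exact ((hasDerivAt_update x j i t).sub (hasDerivAt_update x j k t)).log
        (sub_ne_zero.2 fun h => hik (hy h))
  refine (h1.fun_add (h2.const_mul (lam / 2))).congr_deriv ?_
  simp_rw [sub_div, sum_sub_distrib, ite_div, zero_div]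
  rw [sum_comm (f := fun i k => if k = j then
    1 / (Function.update x j t i - Function.update x j t k) else 0)]
  simp only [mul_ite, mul_one, mul_zero, sum_ite_irrel, sum_ite_eq', mem_univ, if_true,
    sum_const_zero, groundDrift]
  have : ∑ i, 1 / (Function.update x j t i - Function.update x j t j)
      = -∑ i, 1 / (Function.update x j t j - Function.update x j t i) := by
    rw [← sum_neg_distrib]
    refine sum_congr rfl fun i _ => ?_
    rw [← neg_sub, div_neg]
  rw [this]
  ring

lemma eventually_injective_update {x : Fin N → ℝ} (hx : Function.Injective x) (j : Fin N) :
    ∀ᶠ t in nhds (x j), Function.Injective (Function.update x j t) := by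
  have h : ∀ᶠ t in nhds (x j), ∀ k, k ≠ j → t ≠ x k := by
    rw [Filter.eventually_all]
    intro k
    by_cases hk : k = j
    · simp [hk]
    · filter_upwards [isOpen_ne.mem_nhds (show x j ≠ x k from fun h => hk (hx h).symm)] with t ht _
        using ht
  filter_upwards [h] with t ht
  intro a b hab
  by_cases ha : a = j
  · by_cases hb : b = j
    · rw [ha, hb]
    · subst ha
      rw [Function.update_self, Function.update_of_ne hb] at hab
      exact absurd hab (ht b hb)
  · by_cases hb : b = j
    · subst hb
      rw [Function.update_self, Function.update_of_ne ha] at hab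
      exact absurd hab.symm (ht a ha)
    · rw [Function.update_of_ne ha, Function.update_of_ne hb] at hab
      exact hx hab

/-- Stated on a neighbourhood, because the second derivative needs the first one near `x j`. -/
lemma hasDerivAt_groundState (lam : ℝ) (x : Fin N → ℝ) (hx : Function.Injective x)
    (j : Fin N) :
    ∀ᶠ t in nhds (x j), HasDerivAt (fun t => groundState lam (Function.update x j t))
      (groundState lam (Function.update x j t) * groundDrift lam j (Function.update x j t)) t := by
  filter_upwards [(eventually_injective_update hx j).eventually_nhds] with t ht
  have h1 := (hasDerivAt_logGroundState lam x j t ht.self_of_nhds).exp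
  rw [groundState_eq_exp lam ht.self_of_nhds]
  refine h1.congr_of_eventuallyEq ?_
  filter_upwards [ht] with s hs
  exact groundState_eq_exp lam hs

lemma hasDerivAt_groundDrift (lam : ℝ) (x : Fin N → ℝ) (hx : Function.Injective x) (j : Fin N) :
    HasDerivAt (fun t => groundDrift lam j (Function.update x j t))
      (-1 - lam * ∑ k, (1 / (x j - x k)) ^ 2) (x j) := by
  unfold groundDrift
  have h1 : HasDerivAt (fun t => ∑ k, 1 / (Function.update x j t j - Function.update x j t k))
      (∑ k, -(1 / (x j - x k)) ^ 2) (x j) := by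
    refine HasDerivAt.fun_sum fun k _ => ?_
    by_cases hk : k = j
    · subst hk; simpa using hasDerivAt_const (x k) (0 : ℝ)
    · have hne : x j - x k ≠ 0 := sub_ne_zero.2 fun h => hk (hx h).symm
      have := ((hasDerivAt_id (x j)).sub_const (x k)).inv hne
      simp only [Function.update_self, Function.update_of_ne hk, one_div]
      refine this.congr_deriv ?_
      simp; ring
  have h2 : HasDerivAt (fun t => -Function.update x j t j) (-1) (x j) := by
    simpa using (hasDerivAt_id' (x j)).fun_neg
  refine (h2.fun_add (h1.const_mul lam)).congr_deriv ?_
  rw [sum_neg_distrib]; ring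

lemma iteratedDeriv_two_groundState_mul (lam : ℝ) (x : Fin N → ℝ) (hx : Function.Injective x)
    (j : Fin N) (P : MvPolynomial (Fin N) ℝ) :
    iteratedDeriv 2 (fun t : ℝ => groundState lam (Function.update x j t)
        * MvPolynomial.eval (Function.update x j t) P) (x j)
      = groundState lam x * ((groundDrift lam j x ^ 2 - 1 - lam * ∑ k, (1 / (x j - x k)) ^ 2)
          * MvPolynomial.eval x P
        + 2 * groundDrift lam j x * MvPolynomial.eval x (MvPolynomial.pderiv j P)
        + MvPolynomial.eval x (MvPolynomial.pderiv j (MvPolynomial.pderiv j P))) := by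
  have hev : deriv (fun t : ℝ => groundState lam (Function.update x j t)
        * MvPolynomial.eval (Function.update x j t) P) =ᶠ[nhds (x j)]
      fun t => groundState lam (Function.update x j t)
        * (groundDrift lam j (Function.update x j t) * MvPolynomial.eval (Function.update x j t) P
          + MvPolynomial.eval (Function.update x j t) (MvPolynomial.pderiv j P)) := by
    filter_upwards [hasDerivAt_groundState lam x hx j] with t ht
    rw [(ht.fun_mul (hasDerivAt_eval_update x j P t)).deriv]
    ring
  rw [iteratedDeriv_succ, iteratedDeriv_one, hev.deriv_eq]
  have h1 := (hasDerivAt_groundState lam x hx j).self_of_nhds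
  have h2 := (hasDerivAt_groundDrift lam x hx j).fun_mul (hasDerivAt_eval_update x j P (x j))
  have h3 := h1.fun_mul (h2.fun_add (hasDerivAt_eval_update x j (MvPolynomial.pderiv j P) (x j)))
  rw [HasDerivAt.deriv h3]
  simp only [Function.update_eq_self]
  ring

/-- Three-body terms cancel by the cyclic identity. In the cross terms `x_j / (x_j - x_k)` and `x_k
/ (x_k - x_j)` add up to `1`. -/
lemma sum_groundDrift_sq (lam : ℝ) (x : Fin N → ℝ) (hx : Function.Injective x) :
    ∑ j, groundDrift lam j x ^ 2 = ∑ j, x j ^ 2 - lam * (N * (N - 1))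
      + lam ^ 2 * ∑ j, ∑ k, (1 / (x j - x k)) ^ 2 := by
  have hne : ∀ i j, i ≠ j → x i - x j ≠ 0 := fun i j h => sub_ne_zero.2 fun h' => h (hx h')
  have h1 := sum_sq_eq_of_cyclic (R := ℝ) (fun a ha => by linarith)
    (fun i j => 1 / (x i - x j)) (fun i j => by rw [← neg_sub, div_neg]) (fun i => by simp)
    (fun i j k hij hjk hki => by
      have := hne i j hij; have := hne j k hjk; have := hne k i hki
      field_simp; ring)
  have h2 : ∑ j, ∑ k, x j * (1 / (x j - x k)) = N * (N - 1) / 2 := by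
    have hs : ∑ j, ∑ k, x j * (1 / (x j - x k)) + ∑ j, ∑ k, x k * (1 / (x k - x j))
        = ∑ j : Fin N, ∑ k : Fin N, ((1 : ℝ) - if j = k then 1 else 0) := by
      simp_rw [← sum_add_distrib]
      refine sum_congr rfl fun j _ => sum_congr rfl fun k _ => ?_
      split_ifs with h
      · simp [h]
      · have := hne j k h; have := hne k j (Ne.symm h)
        field_simp; ring
    rw [sum_comm (f := fun j k => x k * (1 / (x k - x j)))] at hs
    simp [sum_sub_distrib] at hs ⊢
    linarith
  rw [← h1]
  have h4 : ∀ j, groundDrift lam j x ^ 2 = x j ^ 2 - 2 * lam * (∑ k, x j * (1 / (x j - x k)))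
      + lam ^ 2 * (∑ k, 1 / (x j - x k)) ^ 2 := by
    intro j; rw [groundDrift, ← mul_sum]; ring
  simp_rw [h4, sum_add_distrib, sum_sub_distrib, ← mul_sum] at h2 ⊢
  linear_combination -2 * lam * h2

/-- The squared drift and the derivative of the drift contribute `-lam ^ 2` and `lam` times the
double sum of `1 / (x_j - x_k) ^ 2`, which cancels the interaction; the squares `x_j ^ 2` cancel the
potential. -/
theorem hamiltonian_groundState_mul (lam : ℝ) (x : Fin N → ℝ) (hx : Function.Injective x)
    (P : MvPolynomial (Fin N) ℝ) :
    hamiltonian lam (fun y => groundState lam y * MvPolynomial.eval y P) x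
      = groundState lam x * (reducedHamiltonian lam x P
        + N * (1 + lam * (N - 1)) * MvPolynomial.eval x P) := by
  rw [hamiltonian]
  simp_rw [iteratedDeriv_two_groundState_mul lam x hx]
  have h1 := two_mul_sum_Ioi (fun i k => 1 / (x i - x k) ^ 2)
    (fun i j => by rw [← neg_sub, neg_sq]) (fun i => by simp)
  have h2 := sum_groundDrift_sq lam x hx
  simp_rw [one_div_pow] at h2
  rw [reducedHamiltonian]
  have h3 : ∑ r, ∑ s, MvPolynomial.eval x (MvPolynomial.pderiv r P) / (x r - x s)
      = ∑ r, MvPolynomial.eval x (MvPolynomial.pderiv r P) * ∑ s, 1 / (x r - x s) := by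
    simp_rw [mul_sum, mul_one_div]
  rw [h3]
  simp_rw [one_div_pow]
  have h5 : ∀ j, -(groundState lam x * ((groundDrift lam j x ^ 2 - 1
          - lam * ∑ k, 1 / (x j - x k) ^ 2) * MvPolynomial.eval x P
        + 2 * groundDrift lam j x * MvPolynomial.eval x (MvPolynomial.pderiv j P)
        + MvPolynomial.eval x (MvPolynomial.pderiv j (MvPolynomial.pderiv j P))))
      + x j ^ 2 * (groundState lam x * MvPolynomial.eval x P)
      = groundState lam x * ((x j ^ 2 - groundDrift lam j x ^ 2 + 1
          + lam * ∑ k, 1 / (x j - x k) ^ 2) * MvPolynomial.eval x P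
        + (-(MvPolynomial.eval x (MvPolynomial.pderiv j (MvPolynomial.pderiv j P)))
          + 2 * x j * MvPolynomial.eval x (MvPolynomial.pderiv j P))
        - 2 * lam * (MvPolynomial.eval x (MvPolynomial.pderiv j P) * ∑ s, 1 / (x j - x s))) := by
    intro j; rw [groundDrift]; ring
  simp_rw [h5]
  rw [← mul_sum, sum_sub_distrib, sum_add_distrib, ← sum_mul, ← mul_sum, sum_add_distrib,
    sum_add_distrib, sum_sub_distrib, h2, ← mul_sum]
  simp only [sum_const, card_univ, Fintype.card_fin, nsmul_eq_mul, mul_one]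
  linear_combination (lam * (lam - 1)) * groundState lam x * MvPolynomial.eval x P * h1

end

end Calogero

namespace Calogero

noncomputable section

open Finset

/-! ### Substitution into power series -/

section Subst

variable {σ A B : Type*} [CommRing A]

/-- Multivariate power series whose coefficients vanish at all exponents below `e`. -/
def vanishIdeal (A : Type*) [CommRing A] (e : σ →₀ ℕ) : Ideal (MvPowerSeries σ A) where
  carrier := {T | ∀ e' ≤ e, MvPowerSeries.coeff e' T = 0}
  add_mem' ha hb e' he := by rw [map_add, ha e' he, hb e' he, add_zero]
  zero_mem' _ _ := map_zero _
  smul_mem' c T hT e' he := by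
    classical
    rw [smul_eq_mul, MvPowerSeries.coeff_mul]
    refine sum_eq_zero fun p hp => ?_
    rw [hT p.2 (le_trans (by rw [← HasAntidiagonal.mem_antidiagonal.1 hp]; exact le_add_self) he),
      mul_zero]

/-- Hence a single coefficient may be computed modulo the ideal, where infinite series become finite
sums. -/
lemma coeff_eq_of_sub_mem {e : σ →₀ ℕ} {T U : MvPowerSeries σ A} (h : T - U ∈ vanishIdeal A e) :
    MvPowerSeries.coeff e T = MvPowerSeries.coeff e U := by
  have := h e le_rfl
  rwa [map_sub, sub_eq_zero] at this

lemma monomial_pow_mem_vanishIdeal [Fintype σ] {a e : σ →₀ ℕ} (ha : a ≠ 0) (c : A) {M : ℕ}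
    (hM : ∑ i, e i < M) : MvPowerSeries.monomial a c ^ M ∈ vanishIdeal A e := by
  classical
  intro e' he'
  rw [MvPowerSeries.monomial_pow, MvPowerSeries.coeff_monomial, if_neg]
  rintro rfl
  obtain ⟨i, hi⟩ := DFunLike.ne_iff.1 ha
  have h1 : M * a i ≤ e i := by simpa using he' i
  have h2 : e i ≤ ∑ i, e i := single_le_sum (f := fun i => e i) (fun _ _ => Nat.zero_le _)
    (mem_univ i)
  have h3 : 1 ≤ a i := Nat.one_le_iff_ne_zero.2 hi
  nlinarith

lemma hasSubst_monomial {a : σ →₀ ℕ} (ha : a ≠ 0) (c : A) :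
    PowerSeries.HasSubst (MvPowerSeries.monomial a c) := PowerSeries.HasSubst.monomial ha c

variable [Algebra ℝ A] [CommRing B] [Algebra ℝ B]

/-- Substitution into `φ = trunc + X ^ M * shift`. Modulo `vanishIdeal` the remainder disappears for
large `M`. -/
lemma subst_add_pow_mul (φ : PowerSeries ℝ) {t : MvPowerSeries σ A} (ht : PowerSeries.HasSubst t)
    (M : ℕ) : ∃ U : MvPowerSeries σ A,
      φ.subst t = (∑ k ∈ range M, PowerSeries.coeff k φ • t ^ k) + t ^ M * U := by
  refine ⟨(PowerSeries.mk fun i => PowerSeries.coeff (i + M) φ).subst t, ?_⟩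
  conv_lhs => rw [PowerSeries.eq_X_pow_mul_shift_add_trunc M φ]
  rw [PowerSeries.subst_add ht, PowerSeries.subst_mul ht, PowerSeries.subst_pow ht,
    PowerSeries.subst_X ht, add_comm, PowerSeries.subst_coe ht]
  congr 1
  rw [PowerSeries.trunc_apply, map_sum]
  simp [Polynomial.aeval_monomial, Algebra.smul_def, Nat.Ico_zero_eq_range]

lemma map_subst_algHom (h : A →ₐ[ℝ] B) (φ : PowerSeries ℝ) {t : MvPowerSeries σ A}
    (ht : PowerSeries.HasSubst t) :
    MvPowerSeries.map (h : A →+* B) (φ.subst t)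
      = φ.subst (MvPowerSeries.map (h : A →+* B) t) := by
  have ht' : PowerSeries.HasSubst (MvPowerSeries.map (h : A →+* B) t) := by
    have := ht.map (h : A →+* B)
    rwa [← MvPowerSeries.constantCoeff_map] at this
  ext e
  rw [MvPowerSeries.coeff_map, PowerSeries.coeff_subst ht, PowerSeries.coeff_subst ht',
    AlgHom.coe_toRingHom]
  have := (h : A →+ B).map_finsum (PowerSeries.coeff_subst_finite ht φ e)
  simp only [AddMonoidHom.coe_coe] at this
  rw [this]
  refine finsum_congr fun d => ?_
  rw [map_smul, ← map_pow, MvPowerSeries.coeff_map]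
  rfl

/-- The chain rule for an arbitrary derivation. -/
lemma derivation_subst (D : Derivation ℝ (MvPowerSeries σ A) (MvPowerSeries σ A))
    (φ : PowerSeries ℝ) {t : MvPowerSeries σ A} (ht : MvPowerSeries.constantCoeff t = 0) :
    D (φ.subst t) = (PowerSeries.derivative ℝ φ).subst t * D t := by
  have hs : PowerSeries.HasSubst t := PowerSeries.HasSubst.of_constantCoeff_zero ht
  -- No continuity of `D` is available. Writing `φ = X ψ + const` and applying the Leibniz rule
  -- shows that the defect for `φ` is `t` times the defect for `ψ`. It is therefore divisible by
  -- every power of `t` and vanishes.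
  have key : ∀ (M : ℕ) (φ : PowerSeries ℝ),
      t ^ M ∣ D (φ.subst t) - (PowerSeries.derivative ℝ φ).subst t * D t := by
    intro M
    induction M with
    | zero => simp
    | succ M ih =>
      intro φ
      obtain ⟨U, hU⟩ := ih (PowerSeries.mk fun p => PowerSeries.coeff (p + 1) φ)
      refine ⟨U, ?_⟩
      conv_lhs => rw [PowerSeries.eq_X_mul_shift_add_const φ]
      set ψ := PowerSeries.mk fun p => PowerSeries.coeff (p + 1) φ
      have hC : (PowerSeries.C (PowerSeries.constantCoeff φ)).subst t
          = algebraMap ℝ (MvPowerSeries σ A) (PowerSeries.constantCoeff φ) := by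
        rw [← PowerSeries.coe_substAlgHom hs]
        exact (PowerSeries.substAlgHom hs).commutes _
      rw [map_add, PowerSeries.subst_add hs, PowerSeries.derivative_C, add_zero,
        PowerSeries.subst_mul hs, PowerSeries.subst_X hs, Derivation.leibniz,
        PowerSeries.derivative_X, PowerSeries.subst_add hs, smul_eq_mul, smul_eq_mul, mul_one,
        PowerSeries.subst_mul hs, PowerSeries.subst_X hs, map_add, hC, Derivation.map_algebraMap,
        Derivation.leibniz, smul_eq_mul, smul_eq_mul, pow_succ']
      linear_combination t * hU
  rw [← sub_eq_zero, ← MvPowerSeries.order_eq_top_iff, ENat.eq_top_iff_forall_ge]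
  intro M
  obtain ⟨U, hU⟩ := key M φ
  rw [hU]
  refine le_trans ?_ MvPowerSeries.le_order_mul
  exact le_add_right (MvPowerSeries.le_order_pow_of_constantCoeff_eq_zero M ht)

end Subst

/-! ### Derivations on power series -/

section Derivation

variable {σ A : Type*} [CommRing A] [Algebra ℝ A]

/-- The derivation multiplying the coefficient at the exponent `e` by `w e`. -/
def scaleDerivation (A : Type*) [CommRing A] [Algebra ℝ A] (w : (σ →₀ ℕ) →+ ℝ) :
    Derivation ℝ (MvPowerSeries σ A) (MvPowerSeries σ A) :=
  Derivation.mk'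
    { toFun := fun f => fun e => w e • MvPowerSeries.coeff e f
      map_add' := fun f g => by
        ext e
        exact (congrArg (w e • ·) (map_add (MvPowerSeries.coeff e) f g)).trans (smul_add _ _ _)
      map_smul' := fun c f => by
        ext e
        change w e • (c • MvPowerSeries.coeff e f) = c • (w e • MvPowerSeries.coeff e f)
        rw [smul_comm] }
    (fun f g => by
      classical
      ext e
      change w e • MvPowerSeries.coeff e (f * g) = MvPowerSeries.coeff e
        (f * (show MvPowerSeries σ A from fun e => w e • MvPowerSeries.coeff e g)
          + g * (show MvPowerSeries σ A from fun e => w e • MvPowerSeries.coeff e f))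
      rw [mul_comm g, map_add, MvPowerSeries.coeff_mul, MvPowerSeries.coeff_mul,
        MvPowerSeries.coeff_mul, smul_sum, ← sum_add_distrib]
      refine sum_congr rfl fun p hp => ?_
      change _ = MvPowerSeries.coeff p.1 f * (w p.2 • MvPowerSeries.coeff p.2 g)
        + (w p.1 • MvPowerSeries.coeff p.1 f) * MvPowerSeries.coeff p.2 g
      rw [← HasAntidiagonal.mem_antidiagonal.1 hp, map_add, add_smul, mul_smul_comm, smul_mul_assoc,
        add_comm])

lemma coeff_scaleDerivation (w : (σ →₀ ℕ) →+ ℝ) (e : σ →₀ ℕ) (f : MvPowerSeries σ A) :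
    MvPowerSeries.coeff e (scaleDerivation A w f) = w e • MvPowerSeries.coeff e f := rfl

lemma scaleDerivation_monomial (w : (σ →₀ ℕ) →+ ℝ) (e : σ →₀ ℕ) (c : A) :
    scaleDerivation A w (MvPowerSeries.monomial e c) = w e • MvPowerSeries.monomial e c := by
  classical
  ext e'
  change w e' • MvPowerSeries.coeff e' (MvPowerSeries.monomial e c)
    = w e • MvPowerSeries.coeff e' (MvPowerSeries.monomial e c)
  rw [MvPowerSeries.coeff_monomial]
  split_ifs with h
  · rw [h]
  · simp

/-- A derivation of the coefficient ring, applied coefficientwise. -/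
def coeffDerivation (σ : Type*) (D : Derivation ℝ A A) :
    Derivation ℝ (MvPowerSeries σ A) (MvPowerSeries σ A) :=
  Derivation.mk'
    { toFun := fun f => fun e => D (MvPowerSeries.coeff e f)
      map_add' := fun f g => by
        ext e
        exact (congrArg D (map_add (MvPowerSeries.coeff e) f g)).trans (map_add _ _ _)
      map_smul' := fun c f => by
        ext e
        change D (c • MvPowerSeries.coeff e f) = c • D (MvPowerSeries.coeff e f)
        rw [D.map_smul] }
    (fun f g => by
      classical
      ext e
      change D (MvPowerSeries.coeff e (f * g)) = MvPowerSeries.coeff e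
        (f * (show MvPowerSeries σ A from fun e => D (MvPowerSeries.coeff e g))
          + g * (show MvPowerSeries σ A from fun e => D (MvPowerSeries.coeff e f)))
      rw [mul_comm g, map_add, MvPowerSeries.coeff_mul, MvPowerSeries.coeff_mul,
        MvPowerSeries.coeff_mul, map_sum, ← sum_add_distrib]
      refine sum_congr rfl fun p hp => ?_
      change _ = MvPowerSeries.coeff p.1 f * D (MvPowerSeries.coeff p.2 g)
        + D (MvPowerSeries.coeff p.1 f) * MvPowerSeries.coeff p.2 g
      rw [Derivation.leibniz, smul_eq_mul, smul_eq_mul]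
      ring)

lemma coeff_coeffDerivation (D : Derivation ℝ A A) (e : σ →₀ ℕ) (f : MvPowerSeries σ A) :
    MvPowerSeries.coeff e (coeffDerivation σ D f) = D (MvPowerSeries.coeff e f) := rfl

lemma coeffDerivation_monomial (D : Derivation ℝ A A) (e : σ →₀ ℕ) (c : A) :
    coeffDerivation σ D (MvPowerSeries.monomial e c) = MvPowerSeries.monomial e (D c) := by
  classical
  ext e'
  rw [coeff_coeffDerivation, MvPowerSeries.coeff_monomial, MvPowerSeries.coeff_monomial]
  split_ifs <;> simp

end Derivation

/-! ### Laurent monomials -/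

section Laurent

variable {N : ℕ} {A B : Type*} [CommRing A] [CommRing B]

/-- All tail sums are non-negative, i.e. `y ^ (-m)` is a monomial in `1 / y₁` and `yᵢ / yᵢ₊₁`. -/
def IsCone (m : Fin N → ℤ) : Prop := ∀ l, 0 ≤ tail m l

lemma IsCone.add {m n : Fin N → ℤ} (hm : IsCone m) (hn : IsCone n) : IsCone (m + n) := fun l => by
  rw [tail_add]; exact add_nonneg (hm l) (hn l)

lemma isCone_zero : IsCone (0 : Fin N → ℤ) := fun l => by simp [tail]

lemma IsCone.nsmul {m : Fin N → ℤ} (hm : IsCone m) (k : ℕ) : IsCone (k • m) := by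
  induction k with
  | zero => simpa using isCone_zero
  | succ k ih => rw [succ_nsmul]; exact ih.add hm

lemma IsCone.sum {ι : Type*} (s : Finset ι) {f : ι → Fin N → ℤ} (h : ∀ i ∈ s, IsCone (f i)) :
    IsCone (∑ i ∈ s, f i) := by
  classical
  induction s using Finset.induction_on with
  | empty => simpa using isCone_zero
  | insert a s ha ih =>
    rw [sum_insert ha]
    exact (h a (mem_insert_self _ _)).add (ih fun i hi => h i (mem_insert_of_mem hi))

lemma isCone_single (i : Fin N) {a : ℤ} (ha : 0 ≤ a) : IsCone (Pi.single i a) := fun l => by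
  rw [tail_single]; split_ifs <;> simp [ha]

lemma isCone_pair {i j : Fin N} (h : i ≤ j) :
    IsCone (Pi.single j 1 - Pi.single i 1 : Fin N → ℤ) := fun l => by
  have : (i : ℕ) ≤ j := h
  rw [tail_sub, tail_single, tail_single]
  split_ifs <;> omega

/-- The exponent of `y ^ (-m)` in the variables `1 / y₁` and `yᵢ / yᵢ₊₁`. -/
def expo (m : Fin N → ℤ) : Fin N →₀ ℕ :=
  Finsupp.equivFunOnFinite.symm fun l => (tail m l).toNat

lemma expo_apply (m : Fin N → ℤ) (l : Fin N) : expo m l = (tail m l).toNat := rfl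

lemma expo_add {m n : Fin N → ℤ} (hm : IsCone m) (hn : IsCone n) :
    expo (m + n) = expo m + expo n := by
  ext l
  rw [Finsupp.add_apply, expo_apply, expo_apply, expo_apply, tail_add]
  exact Int.toNat_add (hm l) (hn l)

lemma eq_of_tail_eq {m n : Fin N → ℤ} (h : ∀ l, tail m l = tail n l) : m = n := by
  ext i
  rw [← tail_sub_tail_succ m, h, h, tail_sub_tail_succ]

lemma expo_injOn {m n : Fin N → ℤ} (hm : IsCone m) (hn : IsCone n) (h : expo m = expo n) :
    m = n := by
  refine eq_of_tail_eq fun l => ?_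
  by_cases hl : l < N
  · have := DFunLike.congr_fun h ⟨l, hl⟩
    rw [expo_apply, expo_apply] at this
    have := hm l; have := hn l
    simp only at *
    omega
  · rw [tail_self _ _ (by omega), tail_self _ _ (by omega)]

lemma expo_zero : expo (0 : Fin N → ℤ) = 0 := by
  ext l; simp [expo_apply, tail]

lemma sum_expo {m : Fin N → ℤ} (hm : IsCone m) : ((∑ l, expo m l : ℕ) : ℤ) = height m := by
  rw [← sum_tail, ← Fin.sum_univ_eq_sum_range (fun l => tail m l)]
  push_cast
  exact sum_congr rfl fun l _ => by rw [expo_apply, Int.toNat_of_nonneg (hm l)]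

/-- The monomial `y ^ (-m)`. -/
def mon (A : Type*) [CommRing A] (m : Fin N → ℤ) : MvPowerSeries (Fin N) A :=
  MvPowerSeries.monomial (expo m) 1

lemma mon_mul {m n : Fin N → ℤ} (hm : IsCone m) (hn : IsCone n) :
    mon A m * mon A n = mon A (m + n) := by
  rw [mon, mon, mon, MvPowerSeries.monomial_mul_monomial, expo_add hm hn, one_mul]

lemma mon_zero : mon A (0 : Fin N → ℤ) = 1 := by
  rw [mon, expo_zero, MvPowerSeries.monomial_zero_one]

lemma mon_pow {m : Fin N → ℤ} (hm : IsCone m) (k : ℕ) : mon A m ^ k = mon A (k • m) := by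
  induction k with
  | zero => simp [mon_zero]
  | succ k ih => rw [pow_succ, ih, mon_mul (hm.nsmul k) hm, succ_nsmul]

lemma mon_prod {ι : Type*} (s : Finset ι) {f : ι → Fin N → ℤ} (h : ∀ i ∈ s, IsCone (f i)) :
    ∏ i ∈ s, mon A (f i) = mon A (∑ i ∈ s, f i) := by
  classical
  induction s using Finset.induction_on with
  | empty => simp [mon_zero]
  | insert a s ha ih =>
    rw [sum_insert ha, prod_insert ha, ih fun i hi => h i (mem_insert_of_mem hi),
      mon_mul (h a (mem_insert_self _ _)) (IsCone.sum s fun i hi => h i (mem_insert_of_mem hi))]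

lemma expo_ne_zero {m : Fin N → ℤ} (hm : IsCone m) (h : m ≠ 0) : expo m ≠ 0 := fun h0 =>
  h (expo_injOn hm isCone_zero (h0.trans expo_zero.symm))

lemma constantCoeff_mon {m : Fin N → ℤ} (hm : IsCone m) (h : m ≠ 0) :
    MvPowerSeries.constantCoeff (mon A m) = 0 := by
  classical
  rw [← MvPowerSeries.coeff_zero_eq_constantCoeff_apply, mon, MvPowerSeries.coeff_monomial, if_neg]
  exact (expo_ne_zero hm h).symm

lemma map_mon (h : A →+* B) (m : Fin N → ℤ) : MvPowerSeries.map h (mon A m) = mon B m := by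
  rw [mon, MvPowerSeries.map_monomial, map_one, mon]

/-! ### Extraction of the coefficient of `y ^ (-m)`. -/

open Classical in
/-- The coefficient of `y ^ (-m)`. -/
def laurentCoeff (A : Type*) [CommRing A] (m : Fin N → ℤ) : MvPowerSeries (Fin N) A →ₗ[A] A :=
  if IsCone m then MvPowerSeries.coeff (expo m) else 0

lemma laurentCoeff_of_isCone {m : Fin N → ℤ} (hm : IsCone m) (T : MvPowerSeries (Fin N) A) :
    laurentCoeff A m T = MvPowerSeries.coeff (expo m) T := by
  rw [laurentCoeff, if_pos hm]

lemma laurentCoeff_of_not_isCone {m : Fin N → ℤ} (hm : ¬ IsCone m) (T : MvPowerSeries (Fin N) A) :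
    laurentCoeff A m T = 0 := by
  rw [laurentCoeff, if_neg hm, LinearMap.zero_apply]

/-- No condition on `m` is needed: if `m - b` leaves the cone, both sides vanish. Index shifts are
therefore unconditional later on. -/
lemma laurentCoeff_mon_mul (m : Fin N → ℤ) {b : Fin N → ℤ} (hb : IsCone b)
    (T : MvPowerSeries (Fin N) A) :
    laurentCoeff A m (mon A b * T) = laurentCoeff A (m - b) T := by
  by_cases h : IsCone (m - b)
  · have hm : IsCone m := by simpa using h.add hb
    have he : expo m = expo b + expo (m - b) := by rw [← expo_add hb h, add_sub_cancel]
    rw [laurentCoeff_of_isCone hm, laurentCoeff_of_isCone h, he, mon,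
      MvPowerSeries.coeff_add_monomial_mul, one_mul]
  · rw [laurentCoeff_of_not_isCone h]
    by_cases hm : IsCone m
    · classical
      rw [laurentCoeff_of_isCone hm, mon, MvPowerSeries.coeff_monomial_mul, if_neg]
      intro hle
      refine h fun l => ?_
      by_cases hl : l < N
      · have := hle ⟨l, hl⟩
        rw [expo_apply, expo_apply] at this
        have := hm l; have := hb l
        simp only at *
        rw [tail_sub]
        omega
      · rw [tail_self _ _ (by omega)]
    · exact laurentCoeff_of_not_isCone hm _

lemma laurentCoeff_mon (m : Fin N → ℤ) {b : Fin N → ℤ} (hb : IsCone b) [Decidable (b = m)] :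
    laurentCoeff A m (mon A b) = if b = m then 1 else 0 := by
  classical
  by_cases hm : IsCone m
  · rw [laurentCoeff_of_isCone hm, mon, MvPowerSeries.coeff_monomial]
    refine if_congr ⟨fun h => expo_injOn hb hm h.symm, fun h => by rw [h]⟩ rfl rfl
  · rw [laurentCoeff_of_not_isCone hm, if_neg]
    rintro rfl; exact hm hb

lemma laurentCoeff_eq_of_sub_mem {m : Fin N → ℤ} {T U : MvPowerSeries (Fin N) A}
    (h : T - U ∈ vanishIdeal A (expo m)) : laurentCoeff A m T = laurentCoeff A m U := by
  by_cases hm : IsCone m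
  · rw [laurentCoeff_of_isCone hm, laurentCoeff_of_isCone hm, coeff_eq_of_sub_mem h]
  · rw [laurentCoeff_of_not_isCone hm, laurentCoeff_of_not_isCone hm]

lemma map_laurentCoeff (h : A →+* B) (m : Fin N → ℤ) (T : MvPowerSeries (Fin N) A) :
    h (laurentCoeff A m T) = laurentCoeff B m (MvPowerSeries.map h T) := by
  by_cases hm : IsCone m
  · rw [laurentCoeff_of_isCone hm, laurentCoeff_of_isCone hm, MvPowerSeries.coeff_map]
  · rw [laurentCoeff_of_not_isCone hm, laurentCoeff_of_not_isCone hm, map_zero]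

variable [Algebra ℝ A]

lemma laurentCoeff_coeffDerivation (D : Derivation ℝ A A) (m : Fin N → ℤ)
    (T : MvPowerSeries (Fin N) A) :
    laurentCoeff A m (coeffDerivation (Fin N) D T) = D (laurentCoeff A m T) := by
  by_cases hm : IsCone m
  · rw [laurentCoeff_of_isCone hm, laurentCoeff_of_isCone hm, coeff_coeffDerivation]
  · rw [laurentCoeff_of_not_isCone hm, laurentCoeff_of_not_isCone hm, map_zero]

/-- The exponent of `yᵢ` in the monomial with exponent `e`. -/
def eulerWeight (i : Fin N) : (Fin N →₀ ℕ) →+ ℝ where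
  toFun e := (if h : (i : ℕ) + 1 < N then (e ⟨i + 1, h⟩ : ℝ) else 0) - e i
  map_zero' := by simp
  map_add' e e' := by
    split_ifs
    · simp; ring
    · simp; ring

/-- The entry `m i` is the difference of the tail sums at `i` and `i + 1`; for the last index the
latter is zero, which is the `else` branch. -/
lemma eulerWeight_expo (i : Fin N) {m : Fin N → ℤ} (hm : IsCone m) :
    eulerWeight i (expo m) = -(m i : ℝ) := by
  have hc : ∀ l : ℕ, (((tail m l).toNat : ℕ) : ℝ) = tail m l := fun l => by
    have := Int.toNat_of_nonneg (hm l)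
    exact_mod_cast congrArg (Int.cast (R := ℝ)) this
  change (if h : (i : ℕ) + 1 < N then (expo m ⟨i + 1, h⟩ : ℝ) else 0) - expo m i = _
  have h1 : (if h : (i : ℕ) + 1 < N then (expo m ⟨i + 1, h⟩ : ℝ) else 0) = tail m (i + 1) := by
    split_ifs with h
    · exact hc _
    · rw [tail_self _ _ (by omega), Int.cast_zero]
  rw [h1, expo_apply, hc, ← tail_sub_tail_succ m i]
  push_cast; ring

/-- The derivation `yᵢ ∂/∂yᵢ`. -/
def euler (A : Type*) [CommRing A] [Algebra ℝ A] (i : Fin N) :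
    Derivation ℝ (MvPowerSeries (Fin N) A) (MvPowerSeries (Fin N) A) :=
  scaleDerivation A (eulerWeight i)

lemma euler_mon (i : Fin N) {m : Fin N → ℤ} (hm : IsCone m) :
    euler A i (mon A m) = (-(m i : ℝ)) • mon A m := by
  rw [euler, mon, scaleDerivation_monomial, eulerWeight_expo i hm]

lemma laurentCoeff_euler (i : Fin N) (m : Fin N → ℤ) (T : MvPowerSeries (Fin N) A) :
    laurentCoeff A m (euler A i T) = (-(m i : ℝ)) • laurentCoeff A m T := by
  by_cases hm : IsCone m
  · rw [laurentCoeff_of_isCone hm, laurentCoeff_of_isCone hm, euler, coeff_scaleDerivation,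
      eulerWeight_expo i hm]
  · rw [laurentCoeff_of_not_isCone hm, laurentCoeff_of_not_isCone hm, smul_zero]

end Laurent

end

end Calogero

namespace Calogero

noncomputable section

open Finset

variable {N : ℕ}

/-! ### Coefficients of products of substituted series -/

lemma IsCone.one_le_height {b : Fin N → ℤ} (hb : IsCone b) (h0 : b ≠ 0) : 1 ≤ height b := by
  rw [← sum_tail]
  by_contra! h
  have h1 : ∑ l ∈ range N, tail b l = 0 :=
    le_antisymm (by omega) (sum_nonneg fun l _ => hb l)
  rw [sum_eq_zero_iff_of_nonneg fun l _ => hb l] at h1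
  refine h0 (eq_of_tail_eq fun l => ?_)
  rw [show tail (0 : Fin N → ℤ) l = 0 by simp [tail]]
  by_cases hl : l < N
  · exact h1 l (mem_range.2 hl)
  · exact tail_self _ _ (by omega)

lemma height_nsmul (k : ℕ) (b : Fin N → ℤ) : height (k • b) = k * height b := by
  simp only [height, mul_sum, Pi.smul_apply, nsmul_eq_mul]
  exact sum_congr rfl fun i _ => by ring

section Product

variable {ι : Type*} [Fintype ι] {b : ι → Fin N → ℤ}

/-- A non-zero vector of the cone has height at least `1`, so the height of `m` bounds every
multiplicity. -/
lemma le_of_sum_nsmul_eq (hb : ∀ i, IsCone (b i)) (h0 : ∀ i, b i ≠ 0) {m : Fin N → ℤ}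
    {k : ι → ℕ} (hk : ∑ i, k i • b i = m) (i : ι) : k i ≤ (height m).toNat := by
  have h1 := congrArg height hk
  simp only [height_sum, height_nsmul] at h1
  have h2 : ∀ i, (k i : ℤ) ≤ k i * height (b i) := fun i =>
    le_mul_of_one_le_right (by positivity) ((hb i).one_le_height (h0 i))
  have h3 : (k i : ℤ) * height (b i) ≤ height m := by
    rw [← h1]
    exact single_le_sum (f := fun i => (k i : ℤ) * height (b i))
      (fun i _ => le_trans (by positivity) (h2 i)) (mem_univ i)
  have := h2 i
  omega

lemma finite_setOf_sum_nsmul_eq (hb : ∀ i, IsCone (b i)) (h0 : ∀ i, b i ≠ 0) (m : Fin N → ℤ) :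
    {k : ι → ℕ | ∑ i, k i • b i = m}.Finite := by
  classical
  refine (Fintype.piFinset fun _ : ι => range ((height m).toNat + 1)).finite_toSet.subset
    fun k hk => ?_
  rw [mem_coe, Fintype.mem_piFinset]
  exact fun i => mem_range.2 (Nat.lt_succ_of_le (le_of_sum_nsmul_eq hb h0 hk i))

variable {A : Type*} [CommRing A]

lemma monomial_expo_pow {b : Fin N → ℤ} (hb : IsCone b) (c : A) (k : ℕ) :
    MvPowerSeries.monomial (expo b) c ^ k = c ^ k • mon A (k • b) := by
  have : MvPowerSeries.monomial (expo b) c = c • mon A b := by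
    rw [mon, ← map_smul, smul_eq_mul, mul_one]
  rw [this, smul_pow, mon_pow hb]

variable [Algebra ℝ A]

/-- Each factor is truncated at order `M`, beyond the total degree of the coefficient in question,
and the finite product is multiplied out. -/
lemma laurentCoeff_mul_prod_subst (hb : ∀ i, IsCone (b i)) (h0 : ∀ i, b i ≠ 0)
    (φ : ι → PowerSeries ℝ) (c : ι → A) (m : Fin N → ℤ) (T : MvPowerSeries (Fin N) A) {M : ℕ}
    (hM : ∑ l, expo m l < M) [DecidableEq ι] :
    laurentCoeff A m (T * ∏ i, (φ i).subst (MvPowerSeries.monomial (expo (b i)) (c i)))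
      = ∑ k ∈ Fintype.piFinset fun _ : ι => range M,
        (∏ i, (PowerSeries.coeff (k i) (φ i) • c i ^ k i))
          * laurentCoeff A (m - ∑ i, k i • b i) T := by
  have hmem : T * ∏ i, (φ i).subst (MvPowerSeries.monomial (expo (b i)) (c i))
      - T * ∏ i, ∑ k ∈ range M,
        PowerSeries.coeff k (φ i) • MvPowerSeries.monomial (expo (b i)) (c i) ^ k
      ∈ vanishIdeal A (expo m) := by
    rw [← Ideal.Quotient.eq, map_mul, map_mul, map_prod, map_prod]
    refine congrArg _ (prod_congr rfl fun i _ => ?_)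
    obtain ⟨U, hU⟩ := subst_add_pow_mul (φ i)
      (hasSubst_monomial (expo_ne_zero (hb i) (h0 i)) (c i)) M
    rw [Ideal.Quotient.eq, hU, add_sub_cancel_left]
    exact Ideal.mul_mem_right _ _ (monomial_pow_mem_vanishIdeal (expo_ne_zero (hb i) (h0 i)) _ hM)
  have hprod : ∀ k : ι → ℕ, ∏ i, PowerSeries.coeff (k i) (φ i)
        • MvPowerSeries.monomial (expo (b i)) (c i) ^ k i
      = (∏ i, (PowerSeries.coeff (k i) (φ i) • c i ^ k i)) • mon A (∑ i, k i • b i) := by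
    intro k
    rw [← mon_prod univ fun i _ => (hb i).nsmul (k i), ← Finset.prod_smul]
    refine prod_congr rfl fun i _ => ?_
    rw [monomial_expo_pow (hb i), smul_assoc]
  rw [laurentCoeff_eq_of_sub_mem hmem, Finset.prod_univ_sum, mul_sum, map_sum]
  refine sum_congr rfl fun k _ => ?_
  rw [hprod, mul_smul_comm, map_smul, mul_comm T,
    laurentCoeff_mon_mul _ (IsCone.sum _ fun i _ => (hb i).nsmul _), smul_eq_mul]

lemma laurentCoeff_prod_subst (hb : ∀ i, IsCone (b i)) (h0 : ∀ i, b i ≠ 0) (φ : ι → PowerSeries ℝ)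
    (c : ι → A) (m : Fin N → ℤ) :
    laurentCoeff A m (∏ i, (φ i).subst (MvPowerSeries.monomial (expo (b i)) (c i)))
      = ∑ᶠ k ∈ {k : ι → ℕ | ∑ i, k i • b i = m},
        ∏ i, (PowerSeries.coeff (k i) (φ i) • c i ^ k i) := by
  classical
  -- Large enough for the truncation and for the box to contain all solutions `k`.
  set M := ∑ l, expo m l + (height m).toNat + 1
  have h := laurentCoeff_mul_prod_subst hb h0 φ c m 1 (M := M) (by omega)
  have hsub : {k : ι → ℕ | ∑ i, k i • b i = m}
      = ((Fintype.piFinset fun _ : ι => range M).filter fun k => ∑ i, k i • b i = m :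
        Finset (ι → ℕ)) := by
    ext k
    simp only [Set.mem_ofPred_eq, coe_filter, Fintype.mem_piFinset, mem_range]
    refine ⟨fun h => ⟨fun i => ?_, h⟩, fun h => h.2⟩
    have := le_of_sum_nsmul_eq hb h0 h i
    omega
  rw [one_mul] at h
  rw [h, hsub, finsum_mem_coe_finset, sum_filter]
  refine sum_congr rfl fun k _ => ?_
  have hc : IsCone (∑ i, k i • b i) := IsCone.sum _ fun i _ => (hb i).nsmul _
  rw [← laurentCoeff_mon_mul m hc, mul_one, laurentCoeff_mon m hc, mul_ite, mul_one, mul_zero]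

end Product

/-! ### The generating series -/

/-- The binomial series `(1 - z) ^ c`. -/
def binomSeries (c : ℝ) : PowerSeries ℝ := PowerSeries.mk fun k => (-1) ^ k * Ring.choose c k

/-- The series `∑ₛ c_s(a) zˢ`, so that `p_a(y) = y ^ a * hermiteSeries a (y ^ (-2))`. -/
def hermiteSeries (a : ℝ) : PowerSeries ℝ := PowerSeries.mk fun s => hermiteCoeff s a

/-- The exponents of `yⱼ / yₖ = y ^ (-ratio p)`. -/
def ratio (p : Pairs N) : Fin N → ℤ := Pi.single p.1.2 1 - Pi.single p.1.1 1

lemma isCone_ratio (p : Pairs N) : IsCone (ratio p) := isCone_pair p.2.le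

lemma ratio_ne_zero (p : Pairs N) : ratio p ≠ 0 := fun h => by
  have := congrFun h p.1.2
  simp [ratio, p.2.ne'] at this

lemma single_ne_zero' (i : Fin N) {a : ℤ} (ha : a ≠ 0) : (Pi.single i a : Fin N → ℤ) ≠ 0 := by
  simpa using ha

section Series

variable (A : Type*) [CommRing A] [Algebra ℝ A]

/-- The series `∏_{j<k} (1 - yⱼ/yₖ) ^ lam`. -/
def vandermondeSeries (N : ℕ) (lam : ℝ) : MvPowerSeries (Fin N) A :=
  ∏ p : Pairs N, (binomSeries lam).subst (mon A (ratio p))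

/-- The series `∏_{r,i} (1 - x_r/y_i) ^ (-lam)`. -/
def kernelSeries {A : Type*} [CommRing A] [Algebra ℝ A] (lam : ℝ) (x : Fin N → A) :
    MvPowerSeries (Fin N) A :=
  ∏ q : Fin N × Fin N,
    (binomSeries (-lam)).subst (MvPowerSeries.monomial (expo (Pi.single q.2 1)) (x q.1))

/-- The series `∏ᵢ yᵢ ^ (-aᵢ) p_{aᵢ}(yᵢ)` at `aᵢ = m̃ᵢ - 1`. -/
def hermiteProd (lam : ℝ) (m : Fin N → ℤ) : MvPowerSeries (Fin N) A :=
  ∏ i, (hermiteSeries (tilde lam m i - 1)).subst (mon A (Pi.single i 2))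

end Series

/-- The terms of the Laurent series as families of exponents. -/
def LaurentTerm.equiv : (Fin N ⊕ Pairs N ⊕ Fin N × Fin N → ℕ) ≃ LaurentTerm N where
  toFun k := ⟨fun i => k (.inl i), fun p => k (.inr (.inl p)), fun r i => k (.inr (.inr (r, i)))⟩
  invFun c := Sum.elim c.herm (Sum.elim c.kap fun q => c.nu q.1 q.2)
  left_inv k := by ext (i | p | q) <;> rfl
  right_inv c := rfl

lemma LaurentTerm.equiv_herm (k : Fin N ⊕ Pairs N ⊕ Fin N × Fin N → ℕ) (i : Fin N) :
    (LaurentTerm.equiv k).herm i = k (.inl i) := rfl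

lemma LaurentTerm.equiv_kap (k : Fin N ⊕ Pairs N ⊕ Fin N × Fin N → ℕ) (p : Pairs N) :
    (LaurentTerm.equiv k).kap p = k (.inr (.inl p)) := rfl

lemma LaurentTerm.equiv_nu (k : Fin N ⊕ Pairs N ⊕ Fin N × Fin N → ℕ) (r i : Fin N) :
    (LaurentTerm.equiv k).nu r i = k (.inr (.inr (r, i))) := rfl

/-- The exponent vectors of the factors of the Laurent series. -/
def termVector : Fin N ⊕ Pairs N ⊕ Fin N × Fin N → Fin N → ℤ :=
  Sum.elim (fun i => Pi.single i 2) (Sum.elim ratio fun q => Pi.single q.2 1)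

lemma isCone_termVector (s : Fin N ⊕ Pairs N ⊕ Fin N × Fin N) : IsCone (termVector s) := by
  rcases s with i | p | q
  · exact isCone_single i (by norm_num)
  · exact isCone_ratio p
  · exact isCone_single q.2 (by norm_num)

lemma termVector_ne_zero (s : Fin N ⊕ Pairs N ⊕ Fin N × Fin N) : termVector s ≠ 0 := by
  rcases s with i | p | q
  · exact single_ne_zero' i (by norm_num)
  · exact ratio_ne_zero p
  · exact single_ne_zero' q.2 (by norm_num)

/-- The shift of `m` by `lam (N + 1 - j)` cancels the prefactor `y_j ^ (lam (j - N - 1))`, and the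
two `-1` cancel; an equation between integers remains. -/
lemma mem_residueTerms_iff (lam : ℝ) (m : Fin N → ℤ) (k : Fin N ⊕ Pairs N ⊕ Fin N × Fin N → ℕ) :
    LaurentTerm.equiv k ∈ residueTerms lam m ↔ ∑ s, k s • termVector s = m := by
  rw [residueTerms, Set.mem_ofPred_eq, funext_iff]
  refine forall_congr' fun i => ?_
  rw [← Int.cast_inj (α := ℝ)]
  simp only [LaurentTerm.exponent, LaurentTerm.equiv_herm, LaurentTerm.equiv_kap,
    LaurentTerm.equiv_nu, tilde, termVector,
    Finset.sum_apply, Fintype.sum_sum_type, Sum.elim_inl, Sum.elim_inr, Pi.smul_apply, ratio,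
    Fintype.sum_prod_type, Pi.sub_apply]
  push_cast
  simp only [Pi.single_apply, nsmul_eq_mul]
  push_cast
  have h1 : ∑ x, (k (.inl x) : ℝ) * (if i = x then 2 else 0) = 2 * k (.inl i) := by
    simp [mul_comm]
  have h2 : ∑ x : Fin N, ∑ y : Fin N, (k (.inr (.inr (x, y))) : ℝ) * (if i = y then 1 else 0)
      = ∑ x, (k (.inr (.inr (x, i))) : ℝ) := by simp
  have h3 : ∑ p : Pairs N, (k (.inr (.inl p)) : ℝ)
        * ((if i = p.1.1 then 1 else 0) - if i = p.1.2 then 1 else 0)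
      = -∑ p : Pairs N, (k (.inr (.inl p)) : ℝ)
        * ((if i = p.1.2 then 1 else 0) - if i = p.1.1 then 1 else 0) := by
    rw [← sum_neg_distrib]; exact sum_congr rfl fun p _ => by ring
  rw [h1, h2, h3]
  constructor <;> intro h <;> linarith

lemma finite_residueTerms (lam : ℝ) (m : Fin N → ℤ) : (residueTerms lam m).Finite := by
  have h := finite_setOf_sum_nsmul_eq (isCone_termVector (N := N)) termVector_ne_zero m
  refine (h.image LaurentTerm.equiv).subset fun c hc => ?_
  refine ⟨LaurentTerm.equiv.symm c, ?_, Equiv.apply_symm_apply _ _⟩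
  rw [Set.mem_ofPred_eq, ← mem_residueTerms_iff lam, Equiv.apply_symm_apply]
  exact hc

/-- `f^{(H)}_m` as a coefficient of the product of the generating series. -/
lemma fH_eq_laurentCoeff (lam : ℝ) (m : Fin N → ℤ) :
    fH lam m = laurentCoeff (MvPolynomial (Fin N) ℝ) m
      (hermiteProd _ lam m * (vandermondeSeries _ N lam * kernelSeries lam MvPolynomial.X)) := by
  set φ : Fin N ⊕ Pairs N ⊕ Fin N × Fin N → PowerSeries ℝ :=
    Sum.elim (fun i => hermiteSeries (tilde lam m i - 1))
      (Sum.elim (fun _ => binomSeries lam) fun _ => binomSeries (-lam)) with hφ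
  set c : Fin N ⊕ Pairs N ⊕ Fin N × Fin N → MvPolynomial (Fin N) ℝ :=
    Sum.elim (fun _ => 1) (Sum.elim (fun _ => 1) fun q => MvPolynomial.X q.1) with hc
  have h1 : hermiteProd _ lam m
        * (vandermondeSeries _ N lam * kernelSeries lam MvPolynomial.X)
      = ∏ s, (φ s).subst (MvPowerSeries.monomial (expo (termVector s)) (c s)) := by
    rw [Fintype.prod_sum_type, Fintype.prod_sum_type]
    rfl
  rw [h1, laurentCoeff_prod_subst isCone_termVector termVector_ne_zero, fH]
  symm
  refine finsum_mem_eq_of_bijOn LaurentTerm.equiv ⟨?_, LaurentTerm.equiv.injective.injOn, ?_⟩ ?_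
  · intro k hk
    exact (mem_residueTerms_iff lam m k).2 hk
  · intro c hc
    refine ⟨LaurentTerm.equiv.symm c, ?_, Equiv.apply_symm_apply _ _⟩
    rw [Set.mem_ofPred_eq, ← mem_residueTerms_iff lam, Equiv.apply_symm_apply]
    exact hc
  · intro k _
    rw [Fintype.prod_sum_type, Fintype.prod_sum_type, LaurentTerm.coeff]
    simp only [hφ, hc, Sum.elim_inl, Sum.elim_inr, one_pow, LaurentTerm.equiv_herm,
      LaurentTerm.equiv_kap, LaurentTerm.equiv_nu, map_prod, hermiteSeries, binomSeries,
      PowerSeries.coeff_mk, MvPolynomial.smul_eq_C_mul,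
      mul_one, Fintype.prod_prod_type, mul_assoc]

/-! ### Logarithmic derivatives -/

lemma ringChoose_succ_mul (c : ℝ) (k : ℕ) :
    Ring.choose c (k + 1) * (k + 1) = (c - k) * Ring.choose c k := by
  have h1 := Ring.descPochhammer_eq_factorial_smul_choose c k
  have h2 := Ring.descPochhammer_eq_factorial_smul_choose c (k + 1)
  rw [descPochhammer_succ_right, Polynomial.smeval_mul, h1] at h2
  simp only [Polynomial.smeval_sub, Polynomial.smeval_X, Polynomial.smeval_natCast, pow_one,
    pow_zero, nsmul_eq_mul, mul_one, Nat.factorial_succ, Nat.cast_mul, Nat.cast_add,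
    Nat.cast_one] at h2
  have h3 : (k.factorial : ℝ) ≠ 0 := by positivity
  apply mul_left_cancel₀ h3
  linear_combination -h2

lemma derivative_binomSeries (c : ℝ) :
    PowerSeries.derivative ℝ (binomSeries c) = (-c) • (PowerSeries.mk 1 * binomSeries c) := by
  have h1 : (1 - PowerSeries.X) * PowerSeries.derivative ℝ (binomSeries c)
      = (-c) • binomSeries c := by
    ext k
    rw [sub_mul, one_mul, map_sub, PowerSeries.coeff_smul]
    cases k with
    | zero =>
      have := ringChoose_succ_mul c 0
      simp [PowerSeries.coeff_derivative, binomSeries] at this ⊢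
    | succ k =>
      rw [PowerSeries.coeff_succ_X_mul]
      have := ringChoose_succ_mul c (k + 1)
      simp only [PowerSeries.coeff_derivative, binomSeries, PowerSeries.coeff_mk, smul_eq_mul,
        pow_succ] at this ⊢
      push_cast at this ⊢
      linear_combination (-1 : ℝ) ^ k * this
  have h2 : (PowerSeries.mk 1 : PowerSeries ℝ) * (1 - PowerSeries.X) = 1 :=
    PowerSeries.mk_one_mul_one_sub_eq_one ℝ
  calc PowerSeries.derivative ℝ (binomSeries c)
      = PowerSeries.mk 1 * ((1 - PowerSeries.X) * PowerSeries.derivative ℝ (binomSeries c)) := by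
        rw [← mul_assoc, h2, one_mul]
    _ = _ := by rw [h1, mul_smul_comm]

/-- Logarithmic derivatives add, in a form that requires no division. -/
lemma derivation_prod_of_eq_mul {ι k R : Type*} [CommRing k] [CommRing R] [Algebra k R]
    (D : Derivation k R R)
    (s : Finset ι) (f g : ι → R) (h : ∀ i ∈ s, D (f i) = f i * g i) :
    D (∏ i ∈ s, f i) = (∏ i ∈ s, f i) * ∑ i ∈ s, g i := by
  classical
  induction s using Finset.induction_on with
  | empty => simp
  | insert a s ha ih =>
    rw [prod_insert ha, sum_insert ha, Derivation.leibniz, smul_eq_mul, smul_eq_mul,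
      ih fun i hi => h i (mem_insert_of_mem hi), h a (mem_insert_self _ _)]
    ring

section Geometric

variable {σ A : Type*} [CommRing A] [Algebra ℝ A]

/-- The geometric series `(1 - t)⁻¹`. -/
def geom (t : MvPowerSeries σ A) : MvPowerSeries σ A := (PowerSeries.mk 1 : PowerSeries ℝ).subst t

lemma one_sub_mul_geom {t : MvPowerSeries σ A} (ht : MvPowerSeries.constantCoeff t = 0) :
    (1 - t) * geom t = 1 := by
  have hs : PowerSeries.HasSubst t := PowerSeries.HasSubst.of_constantCoeff_zero ht
  have h := congrArg (PowerSeries.substAlgHom (R := ℝ) hs)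
    (PowerSeries.mk_one_mul_one_sub_eq_one ℝ)
  rw [map_mul, map_sub, map_one, PowerSeries.substAlgHom_X, PowerSeries.coe_substAlgHom] at h
  rw [mul_comm]; exact h

lemma derivation_geom (D : Derivation ℝ (MvPowerSeries σ A) (MvPowerSeries σ A))
    {t : MvPowerSeries σ A} (ht : MvPowerSeries.constantCoeff t = 0) :
    D (geom t) = geom t ^ 2 * D t := by
  have h := one_sub_mul_geom ht
  have h2 := congrArg D h
  rw [Derivation.leibniz, map_sub, Derivation.map_one_eq_zero, smul_eq_mul, smul_eq_mul] at h2
  linear_combination geom t * h2 - D (geom t) * h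

lemma derivation_subst_binomSeries (D : Derivation ℝ (MvPowerSeries σ A) (MvPowerSeries σ A))
    (c : ℝ) {t : MvPowerSeries σ A} (ht : MvPowerSeries.constantCoeff t = 0) :
    D ((binomSeries c).subst t) = (binomSeries c).subst t * ((-c) • (geom t * D t)) := by
  have hs : PowerSeries.HasSubst t := PowerSeries.HasSubst.of_constantCoeff_zero ht
  rw [derivation_subst D _ ht, derivative_binomSeries, PowerSeries.subst_smul hs,
    PowerSeries.subst_mul hs, geom, smul_mul_assoc, mul_smul_comm]
  congr 1
  ring

end Geometric

/-! ### An algebraic identity -/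

/-- The kernel function identity: `a r i`, `d i k`, `c r s` stand for `1/(yᵢ - x_r)`,
`1/(yᵢ - yₖ)`, `1/(x_r - x_s)`. -/
lemma kernel_identity {R : Type*} [CommRing R] (h3 : ∀ z : R, 3 * z = 0 → z = 0)
    (L : R) (a c d : Fin N → Fin N → R)
    (hanti : ∀ i j, d i j = -d j i) (hdiag : ∀ i, d i i = 0)
    (hcyc : ∀ i j k, i ≠ j → j ≠ k → k ≠ i → d i j * d j k + d j k * d k i + d k i * d i j = 0)
    (hcanti : ∀ i j, c i j = -c j i) (hcdiag : ∀ i, c i i = 0)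
    (hac : ∀ r s i, r ≠ s → a r i * a s i = c r s * (a r i - a s i))
    (had : ∀ r i k, i ≠ k → a r i * a r k = d i k * (a r k - a r i)) :
    ∑ r, (L ^ 2 * (∑ i, a r i) ^ 2 + L * ∑ i, a r i ^ 2)
        + 2 * L ^ 2 * ∑ r, ∑ s, c r s * ∑ i, a r i
      = ∑ i, ((L * ∑ k, d i k - L * ∑ r, a r i) ^ 2
          + (L * ∑ r, a r i ^ 2 - L * ∑ k, d i k ^ 2)) - L * (L - 1) * ∑ i, ∑ k, d i k ^ 2 := by
  -- Partial fractions in the `y` variables remove the products `a r i * a r k` with `i ≠ k`.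
  have e1 : ∑ r, (∑ i, a r i) ^ 2
      = ∑ r, ∑ i, a r i ^ 2 - 2 * ∑ i, (∑ k, d i k) * ∑ r, a r i := by
    have h : ∀ r, (∑ i, a r i) ^ 2 = ∑ i, a r i ^ 2 - 2 * ∑ i, (∑ k, d i k) * a r i := by
      intro r
      have h1 : ∀ i k, a r i * a r k
          = (if i = k then a r i ^ 2 else 0) + (d i k * a r k - d i k * a r i) := by
        intro i k
        split_ifs with hik
        · subst hik; rw [hdiag]; ring
        · rw [had r i k hik]; ring
      rw [sq, sum_mul_sum]
      simp_rw [h1, sum_add_distrib, sum_sub_distrib]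
      rw [sum_comm (f := fun i k => d i k * a r k)]
      have h2 : ∑ k, ∑ i, d i k * a r k = -∑ k, ∑ i, d k i * a r k := by
        rw [← sum_neg_distrib]
        refine sum_congr rfl fun k _ => ?_
        rw [← sum_neg_distrib]
        exact sum_congr rfl fun i _ => by rw [hanti i k]; ring
      rw [h2]
      simp_rw [← sum_mul]
      simp
      ring
    simp_rw [h, sum_sub_distrib, ← mul_sum]
    rw [sum_comm (f := fun r i => (∑ k, d i k) * a r i)]
    simp_rw [mul_sum]
  -- Partial fractions in the `x` variables produce the first-order term of the reduced Hamiltonian.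
  have e2 : 2 * ∑ r, ∑ s, c r s * ∑ i, a r i = ∑ i, (∑ r, a r i) ^ 2 - ∑ r, ∑ i, a r i ^ 2 := by
    have h : ∀ i, (∑ r, a r i) ^ 2 = ∑ r, a r i ^ 2 + 2 * ∑ r, ∑ s, c r s * a r i := by
      intro i
      have h1 : ∀ r s, a r i * a s i
          = (if r = s then a r i ^ 2 else 0) + (c r s * a r i - c r s * a s i) := by
        intro r s
        split_ifs with hrs
        · subst hrs; rw [hcdiag]; ring
        · rw [hac r s i hrs]; ring
      rw [sq, sum_mul_sum]
      simp_rw [h1, sum_add_distrib, sum_sub_distrib]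
      rw [sum_comm (f := fun r s => c r s * a s i)]
      have h2 : ∑ s, ∑ r, c r s * a s i = -∑ s, ∑ r, c s r * a s i := by
        rw [← sum_neg_distrib]
        refine sum_congr rfl fun k _ => ?_
        rw [← sum_neg_distrib]
        exact sum_congr rfl fun i _ => by rw [hcanti i k]; ring
      rw [h2]
      simp
      ring
    simp_rw [h, sum_add_distrib, ← mul_sum]
    rw [sum_comm (f := fun i r => a r i ^ 2)]
    have h5 : ∑ i, ∑ r, ∑ s, c r s * a r i = ∑ r, ∑ s, c r s * ∑ i, a r i := by
      rw [sum_comm]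
      refine sum_congr rfl fun r _ => ?_
      rw [sum_comm]
      simp_rw [mul_sum]
    rw [h5]; ring
  have e3 := sum_sq_eq_of_cyclic h3 d hanti hdiag hcyc
  have e4 : ∀ i, (L * ∑ k, d i k - L * ∑ r, a r i) ^ 2
      + (L * ∑ r, a r i ^ 2 - L * ∑ k, d i k ^ 2)
      = L ^ 2 * (∑ k, d i k) ^ 2 - 2 * L ^ 2 * ((∑ k, d i k) * ∑ r, a r i)
        + L ^ 2 * (∑ r, a r i) ^ 2 + L * ∑ r, a r i ^ 2 - L * ∑ k, d i k ^ 2 := by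
    intro i; ring
  simp_rw [e4, sum_sub_distrib, sum_add_distrib, sum_sub_distrib, ← mul_sum]
  rw [e1, e3, sum_comm (f := fun i r => a r i ^ 2)]
  linear_combination L ^ 2 * e2

/-! ### The rational functions `1/(yᵢ - x_r)` and `1/(yᵢ - yₖ)` as series -/

section Elements

variable {A : Type*} [CommRing A]

/-- The series of `1 / yᵢ`. -/
def invVar (A : Type*) [CommRing A] (i : Fin N) : MvPowerSeries (Fin N) A := mon A (Pi.single i 1)

lemma isCone_single_one (i : Fin N) : IsCone (Pi.single i 1 : Fin N → ℤ) :=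
  isCone_single i (by norm_num)

lemma constantCoeff_monomial_single (i : Fin N) (c : A) :
    MvPowerSeries.constantCoeff (MvPowerSeries.monomial (expo (Pi.single i 1)) c) = 0 := by
  classical
  rw [← MvPowerSeries.coeff_zero_eq_constantCoeff_apply, MvPowerSeries.coeff_monomial, if_neg]
  exact (expo_ne_zero (isCone_single_one i) (single_ne_zero' i (by norm_num))).symm

lemma monomial_single_eq (i : Fin N) (c : A) :
    MvPowerSeries.monomial (expo (Pi.single i 1)) c = MvPowerSeries.C c * invVar A i := by
  rw [← MvPowerSeries.smul_eq_C_mul, invVar, mon, ← map_smul, smul_eq_mul, mul_one]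

lemma constantCoeff_ratio (p : Pairs N) : MvPowerSeries.constantCoeff (mon A (ratio p)) = 0 :=
  constantCoeff_mon (isCone_ratio p) (ratio_ne_zero p)

lemma invVar_mul_ratio (p : Pairs N) : invVar A p.1.1 * mon A (ratio p) = invVar A p.1.2 := by
  rw [invVar, mon_mul (isCone_single_one _) (isCone_ratio p), ratio, add_sub_cancel, invVar]

variable [Algebra ℝ A]

/-- The series of `1 / (yᵢ - x)`. -/
def invSub (x : A) (i : Fin N) : MvPowerSeries (Fin N) A :=
  invVar A i * geom (MvPowerSeries.monomial (expo (Pi.single i 1)) x)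

lemma invSub_mul (x : A) (i : Fin N) :
    invSub x i * (1 - MvPowerSeries.C x * invVar A i) = invVar A i := by
  have := one_sub_mul_geom (constantCoeff_monomial_single i x)
  rw [monomial_single_eq] at this
  rw [invSub, monomial_single_eq]
  linear_combination invVar A i * this

/-- The series of `1 / (yⱼ - yₖ)`, expanded in `|yⱼ| < |yₖ|` for `j < k`. -/
def invDiff (A : Type*) [CommRing A] [Algebra ℝ A] (j k : Fin N) : MvPowerSeries (Fin N) A :=
  if h : j < k then -(invVar A k * geom (mon A (ratio ⟨(j, k), h⟩)))
  else if h : k < j then invVar A j * geom (mon A (ratio ⟨(k, j), h⟩)) else 0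

lemma invDiff_of_lt {j k : Fin N} (h : j < k) :
    invDiff A j k = -(invVar A k * geom (mon A (ratio ⟨(j, k), h⟩))) := dif_pos h

lemma invDiff_of_gt {j k : Fin N} (h : k < j) :
    invDiff A j k = invVar A j * geom (mon A (ratio ⟨(k, j), h⟩)) := by
  rw [invDiff, dif_neg h.asymm, dif_pos h]

lemma invDiff_self (j : Fin N) : invDiff A j j = 0 := by
  rw [invDiff, dif_neg (lt_irrefl j), dif_neg (lt_irrefl j)]

lemma invDiff_antisymm (j k : Fin N) : invDiff A j k = -invDiff A k j := by
  rcases lt_trichotomy j k with h | rfl | h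
  · rw [invDiff_of_lt h, invDiff_of_gt h]
  · simp [invDiff_self]
  · rw [invDiff_of_lt h, invDiff_of_gt h, neg_neg]

/-- The ring contains `1 / y_i` but not `y_i`, so the defining relation of `1 / (y_j - y_k)` is
multiplied by `1 / (y_j y_k)`. -/
lemma invDiff_mul {j k : Fin N} (hjk : j ≠ k) :
    invDiff A j k * (invVar A k - invVar A j) = invVar A j * invVar A k := by
  have key : ∀ {j k : Fin N}, j < k →
      invDiff A j k * (invVar A k - invVar A j) = invVar A j * invVar A k := by
    intro j k h
    have h1 := one_sub_mul_geom (constantCoeff_ratio (A := A) ⟨(j, k), h⟩)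
    have h2 := invVar_mul_ratio (A := A) ⟨(j, k), h⟩
    rw [invDiff_of_lt h]
    simp only at h2
    linear_combination invVar A j * invVar A k * h1
      + invVar A k * geom (mon A (ratio ⟨(j, k), h⟩)) * h2
  rcases lt_or_gt_of_ne hjk with h | h
  · exact key h
  · rw [invDiff_antisymm]
    linear_combination key h

end Elements

/-- Over `ℝ` the power series form a domain, so these denominators can be cancelled; the partial
fraction and derivative identities below are checked this way. -/
lemma invVar_sub_ne_zero {j k : Fin N} (hjk : j ≠ k) : invVar ℝ k - invVar ℝ j ≠ 0 := by
  classical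
  intro h
  have h1 := congrArg (MvPowerSeries.coeff (expo (Pi.single k 1))) (sub_eq_zero.1 h)
  rw [invVar, mon, MvPowerSeries.coeff_monomial, if_pos rfl, invVar, mon,
    MvPowerSeries.coeff_monomial] at h1
  split_ifs at h1 with h2
  · have h3 := congrFun (expo_injOn (isCone_single_one k) (isCone_single_one j) h2) j
    simp [hjk] at h3
  · exact one_ne_zero h1

lemma one_sub_C_mul_invVar_ne_zero (x : ℝ) (i : Fin N) :
    (1 : MvPowerSeries (Fin N) ℝ) - MvPowerSeries.C x * invVar ℝ i ≠ 0 := fun h => by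
  have := congrArg MvPowerSeries.constantCoeff h
  rw [map_sub, map_one, ← monomial_single_eq, constantCoeff_monomial_single, map_zero,
    sub_zero] at this
  exact one_ne_zero this

lemma invSub_mul_invSub_left {x x' : ℝ} (h : x ≠ x') (i : Fin N) :
    invSub x i * invSub x' i
      = MvPowerSeries.C (1 / (x - x')) * (invSub x i - invSub x' i) := by
  have h1 := invSub_mul x i
  have h2 := invSub_mul x' i
  have h3 : (MvPowerSeries.C (1 / (x - x')) : MvPowerSeries (Fin N) ℝ)
      * (MvPowerSeries.C x - MvPowerSeries.C x') = 1 := by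
    rw [← map_sub, ← map_mul, one_div_mul_cancel (sub_ne_zero.2 h), map_one]
  apply mul_right_cancel₀ (one_sub_C_mul_invVar_ne_zero x i)
  apply mul_right_cancel₀ (one_sub_C_mul_invVar_ne_zero x' i)
  linear_combination (invSub x' i * (1 - MvPowerSeries.C x' * invVar ℝ i)
      - MvPowerSeries.C (1 / (x - x')) * (1 - MvPowerSeries.C x' * invVar ℝ i)) * h1
    + (invVar ℝ i + MvPowerSeries.C (1 / (x - x')) * (1 - MvPowerSeries.C x * invVar ℝ i)) * h2
    - invVar ℝ i ^ 2 * h3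

lemma invSub_mul_invSub_right (x : ℝ) {i k : Fin N} (h : i ≠ k) :
    invSub x i * invSub x k = invDiff ℝ i k * (invSub x k - invSub x i) := by
  have h1 := invSub_mul x i
  have h2 := invSub_mul x k
  have h3 := invDiff_mul (A := ℝ) h
  apply mul_right_cancel₀ (one_sub_C_mul_invVar_ne_zero x i)
  apply mul_right_cancel₀ (one_sub_C_mul_invVar_ne_zero x k)
  linear_combination (invSub x k * (1 - MvPowerSeries.C x * invVar ℝ k)
      + invDiff ℝ i k * (1 - MvPowerSeries.C x * invVar ℝ k)) * h1
    + (invVar ℝ i - invDiff ℝ i k * (1 - MvPowerSeries.C x * invVar ℝ i)) * h2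
    - h3

lemma invDiff_cyclic {i j k : Fin N} (hij : i ≠ j) (hjk : j ≠ k) (hki : k ≠ i) :
    invDiff ℝ i j * invDiff ℝ j k + invDiff ℝ j k * invDiff ℝ k i
      + invDiff ℝ k i * invDiff ℝ i j = 0 := by
  have h1 := invDiff_mul (A := ℝ) hij
  have h2 := invDiff_mul (A := ℝ) hjk
  have h3 := invDiff_mul (A := ℝ) hki
  apply mul_right_cancel₀ (invVar_sub_ne_zero hij)
  apply mul_right_cancel₀ (invVar_sub_ne_zero hjk)
  apply mul_right_cancel₀ (invVar_sub_ne_zero hki)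
  set a := invDiff ℝ i j
  set b := invDiff ℝ j k
  set c := invDiff ℝ k i
  set u := invVar ℝ i
  set v := invVar ℝ j
  set w := invVar ℝ k
  linear_combination (b * (w - v) * (u - w) + c * (u - w) * (w - v)) * h1
    + (u * v * (u - w) + c * (u - w) * (v - u)) * h2 + (u * v * (w - v) + v * w * (v - u)) * h3

/-! ### Derivatives with respect to the `y` variables -/

lemma sum_pairs {R : Type*} [AddCommMonoid R] (F : Pairs N → R) :
    ∑ p, F p = ∑ j, ∑ k, if h : j < k then F ⟨(j, k), h⟩ else 0 := by
  rw [← Fintype.sum_prod_type' (f := fun j k => if h : j < k then F ⟨(j, k), h⟩ else 0)]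
  refine Fintype.sum_of_injective Subtype.val Subtype.val_injective _ _ ?_ ?_
  · rintro ⟨j, k⟩ h
    exact dif_neg fun hjk => h ⟨⟨(j, k), hjk⟩, rfl⟩
  · rintro ⟨⟨j, k⟩, h⟩
    simp [show j < k from h]

lemma euler_invVar (i k : Fin N) :
    euler ℝ i (invVar ℝ k) = if i = k then -invVar ℝ k else 0 := by
  rw [invVar, euler_mon _ (isCone_single_one k), Pi.single_apply]
  split_ifs <;> simp

lemma euler_C (i : Fin N) (c : ℝ) : euler ℝ i (MvPowerSeries.C c) = 0 :=
  (euler ℝ i).map_algebraMap c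

lemma invVar_mul_euler_invSub (x : ℝ) (i : Fin N) :
    invVar ℝ i * euler ℝ i (invSub x i) = -invSub x i ^ 2 := by
  have h1 := invSub_mul x i
  have h2 := congrArg (euler ℝ i) h1
  rw [Derivation.leibniz, map_sub, Derivation.leibniz, Derivation.map_one_eq_zero, euler_C,
    euler_invVar, if_pos rfl] at h2
  simp only [smul_eq_mul] at h2
  apply mul_right_cancel₀ (one_sub_C_mul_invVar_ne_zero x i)
  linear_combination invVar ℝ i * h2 + (invSub x i + invVar ℝ i) * h1

lemma invVar_mul_euler_invDiff (i k : Fin N) :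
    invVar ℝ i * euler ℝ i (invDiff ℝ i k) = -invDiff ℝ i k ^ 2 := by
  by_cases hik : i = k
  · subst hik; simp [invDiff_self]
  have h1 := invDiff_mul (A := ℝ) hik
  have h2 := congrArg (euler ℝ i) h1
  rw [Derivation.leibniz, map_sub, Derivation.leibniz, euler_invVar, euler_invVar, if_pos rfl,
    if_neg hik] at h2
  simp only [smul_eq_mul] at h2
  apply mul_right_cancel₀ (invVar_sub_ne_zero hik)
  linear_combination invVar ℝ i * h2 + (invDiff ℝ i k + invVar ℝ i) * h1

lemma euler_kernelSeries (lam : ℝ) (x : Fin N → ℝ) (i : Fin N) :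
    euler ℝ i (kernelSeries lam x) = kernelSeries lam x
      * (-(MvPowerSeries.C lam * ∑ r, MvPowerSeries.C (x r) * invSub (x r) i)) := by
  rw [kernelSeries, derivation_prod_of_eq_mul (euler ℝ i) _ _ _ fun q _ =>
    derivation_subst_binomSeries (euler ℝ i) _ (constantCoeff_monomial_single q.2 (x q.1)),
    Fintype.sum_prod_type]
  congr 1
  rw [mul_sum, ← sum_neg_distrib]
  refine sum_congr rfl fun r _ => ?_
  rw [sum_eq_single i]
  · rw [monomial_single_eq, Derivation.leibniz, euler_C, euler_invVar, if_pos rfl, invSub,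
      MvPowerSeries.smul_eq_C_mul, monomial_single_eq, neg_neg]
    simp only [smul_eq_mul]
    ring
  · intro k _ hk
    rw [monomial_single_eq, Derivation.leibniz, euler_C, euler_invVar, if_neg (Ne.symm hk)]
    simp
  · simp

lemma euler_vandermondeSeries (lam : ℝ) (i : Fin N) :
    euler ℝ i (vandermondeSeries ℝ N lam) = vandermondeSeries ℝ N lam
      * (MvPowerSeries.C lam * ∑ p : Pairs N, MvPowerSeries.C (ratio p i : ℝ)
        * (geom (mon ℝ (ratio p)) * mon ℝ (ratio p))) := by
  rw [vandermondeSeries, derivation_prod_of_eq_mul (euler ℝ i) _ _ _ fun p _ =>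
    derivation_subst_binomSeries (euler ℝ i) _ (constantCoeff_ratio p)]
  congr 1
  rw [mul_sum]
  refine sum_congr rfl fun p _ => ?_
  rw [euler_mon i (isCone_ratio p), MvPowerSeries.smul_eq_C_mul, MvPowerSeries.smul_eq_C_mul,
    map_neg, map_neg]
  ring

/-- For `k < i` the term is `t / (1 - t) = 1 / (1 - t) - 1` with `t = y_k / y_i`; the subtracted
ones are counted by the zero-based index `i`. For `k > i` no correction occurs. -/
lemma invVar_mul_sum_ratio (i : Fin N) :
    invVar ℝ i * ∑ p : Pairs N, MvPowerSeries.C (ratio p i : ℝ)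
        * (geom (mon ℝ (ratio p)) * mon ℝ (ratio p))
      = ∑ k, invDiff ℝ i k - MvPowerSeries.C ((i : ℕ) : ℝ) * invVar ℝ i := by
  set E : Fin N → Fin N → MvPowerSeries (Fin N) ℝ := fun j k =>
    if h : j < k then geom (mon ℝ (ratio ⟨(j, k), h⟩)) * mon ℝ (ratio ⟨(j, k), h⟩) else 0 with hE
  have h1 : ∑ p : Pairs N, MvPowerSeries.C (ratio p i : ℝ)
        * (geom (mon ℝ (ratio p)) * mon ℝ (ratio p))
      = ∑ k, (E k i - E i k) := by
    rw [sum_pairs]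
    have : ∀ j k, (if h : j < k then MvPowerSeries.C (ratio ⟨(j, k), h⟩ i : ℝ)
          * (geom (mon ℝ (ratio ⟨(j, k), h⟩)) * mon ℝ (ratio ⟨(j, k), h⟩)) else 0)
        = (if i = k then E j k else 0) - if i = j then E j k else 0 := by
      intro j k
      by_cases h : j < k
      · simp only [hE, dif_pos h, ratio, Pi.sub_apply, Pi.single_apply]
        split_ifs <;> simp
      · simp [hE, h]
    simp_rw [this, sum_sub_distrib]
    rw [sum_comm (f := fun j k => if i = j then E j k else 0)]
    simp
  have h2 : ∀ k, invVar ℝ i * (E k i - E i k)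
      = invDiff ℝ i k - if k < i then invVar ℝ i else 0 := by
    intro k
    rcases lt_trichotomy i k with h | rfl | h
    · have e1 := one_sub_mul_geom (constantCoeff_ratio (A := ℝ) ⟨(i, k), h⟩)
      have e2 := invVar_mul_ratio (A := ℝ) ⟨(i, k), h⟩
      simp only [hE, dif_pos h, dif_neg h.asymm, if_neg h.asymm, invDiff_of_lt h]
      linear_combination -geom (mon ℝ (ratio ⟨(i, k), h⟩)) * e2
    · simp [hE, invDiff_self]
    · have e1 := one_sub_mul_geom (constantCoeff_ratio (A := ℝ) ⟨(k, i), h⟩)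
      simp only [hE, dif_pos h, dif_neg h.asymm, if_pos h, invDiff_of_gt h]
      linear_combination -invVar ℝ i * e1
  rw [h1, mul_sum]
  simp_rw [h2, sum_sub_distrib]
  congr 1
  rw [← sum_filter, sum_const, show (univ.filter fun k => k < i) = Iio i by ext; simp, Fin.card_Iio,
    nsmul_eq_mul, map_natCast]

/-- The series is homogeneous of degree zero in `y`. -/
lemma sum_euler_vandermondeSeries (lam : ℝ) :
    ∑ i, euler ℝ i (vandermondeSeries ℝ N lam) = 0 := by
  simp_rw [euler_vandermondeSeries, ← mul_sum]
  rw [sum_comm]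
  simp_rw [← sum_mul, ← map_sum]
  have : ∀ p : Pairs N, ∑ i, (ratio p i : ℝ) = 0 := fun p => by
    simp [ratio, sum_sub_distrib, Pi.single_apply]
  simp [this]

/-- The logarithmic derivative of `∏_{j<k} (yₖ - yⱼ)^lam ∏_{r,i} (yᵢ - x_r)^(-lam)` in `yᵢ`. -/
def logDerivative (lam : ℝ) (x : Fin N → ℝ) (i : Fin N) : MvPowerSeries (Fin N) ℝ :=
  MvPowerSeries.C lam * ∑ k, invDiff ℝ i k - MvPowerSeries.C lam * ∑ r, invSub (x r) i

/-- Replacing `1 - y_k / y_i` (for `k < i`) by `y_i - y_k` and `1 - x_r / y_i` by `y_i - x_r`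
multiplies the series by a power of `y_i`, with exponent `lam * i - lam * N`. This is the subtracted
constant. -/
lemma invVar_mul_euler_source (lam : ℝ) (x : Fin N → ℝ) (i : Fin N) :
    invVar ℝ i * (euler ℝ i (vandermondeSeries ℝ N lam * kernelSeries lam x)
        - MvPowerSeries.C (lam * (N - (i : ℕ)))
          * (vandermondeSeries ℝ N lam * kernelSeries lam x))
      = vandermondeSeries ℝ N lam * kernelSeries lam x * logDerivative lam x i := by
  have h1 := invVar_mul_sum_ratio i
  have h2 : invVar ℝ i * ∑ r, MvPowerSeries.C (x r) * invSub (x r) i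
      = ∑ r, invSub (x r) i - MvPowerSeries.C (N : ℝ) * invVar ℝ i := by
    have : ∀ r, invVar ℝ i * (MvPowerSeries.C (x r) * invSub (x r) i)
        = invSub (x r) i - invVar ℝ i := fun r => by
      linear_combination -invSub_mul (x r) i
    rw [mul_sum]
    simp_rw [this, sum_sub_distrib]
    simp
  rw [Derivation.leibniz, euler_kernelSeries, euler_vandermondeSeries, logDerivative, map_mul,
    map_sub]
  simp only [smul_eq_mul]
  linear_combination vandermondeSeries ℝ N lam * kernelSeries lam x * MvPowerSeries.C lam
    * (h1 - h2)

lemma invVar_mul_euler_logDerivative (lam : ℝ) (x : Fin N → ℝ) (i : Fin N) :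
    invVar ℝ i * euler ℝ i (logDerivative lam x i)
      = MvPowerSeries.C lam * ∑ r, invSub (x r) i ^ 2
        - MvPowerSeries.C lam * ∑ k, invDiff ℝ i k ^ 2 := by
  rw [logDerivative, map_sub, Derivation.leibniz, Derivation.leibniz, euler_C, map_sum, map_sum]
  simp only [smul_eq_mul, mul_zero, add_zero]
  have h1 : invVar ℝ i * ∑ k, euler ℝ i (invDiff ℝ i k) = -∑ k, invDiff ℝ i k ^ 2 := by
    rw [mul_sum, ← sum_neg_distrib]
    exact sum_congr rfl fun k _ => invVar_mul_euler_invDiff i k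
  have h2 : invVar ℝ i * ∑ r, euler ℝ i (invSub (x r) i) = -∑ r, invSub (x r) i ^ 2 := by
    rw [mul_sum, ← sum_neg_distrib]
    exact sum_congr rfl fun r _ => invVar_mul_euler_invSub (x r) i
  linear_combination MvPowerSeries.C lam * (h1 - h2)

/-- The source is invariant under common scaling of `x` and `y`, so the Euler operator in `y` is
minus the one in `x`. -/
lemma sum_euler_source (lam : ℝ) (x : Fin N → ℝ) :
    ∑ i, euler ℝ i (vandermondeSeries ℝ N lam * kernelSeries lam x)
      = -(vandermondeSeries ℝ N lam * kernelSeries lam x * (MvPowerSeries.C lam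
        * ∑ r, MvPowerSeries.C (x r) * ∑ i, invSub (x r) i)) := by
  simp_rw [Derivation.leibniz, smul_eq_mul, sum_add_distrib, ← mul_sum,
    sum_euler_vandermondeSeries, euler_kernelSeries, ← mul_sum, sum_neg_distrib, ← mul_sum]
  rw [sum_comm]
  simp_rw [← mul_sum]
  ring

/-! ### The differential equation of the generalized Hermite series -/

lemma hermiteCoeff_succ (s : ℕ) (a : ℝ) :
    4 * ((s : ℝ) + 1) * hermiteCoeff (s + 1) a
      = -((a - 2 * s) * (a - 2 * s - 1)) * hermiteCoeff s a := by
  have h := poch_mul (a - 2 * ((s + 1 : ℕ) : ℝ) + 1) 2 (2 * s)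
  rw [show a - 2 * ((s + 1 : ℕ) : ℝ) + 1 + ((2 : ℕ) : ℝ) = a - 2 * s + 1 by push_cast; ring,
    show 2 + 2 * s = 2 * (s + 1) by ring] at h
  have h2 : poch (a - 2 * ((s + 1 : ℕ) : ℝ) + 1) 2 = (a - 2 * s) * (a - 2 * s - 1) := by
    simp only [poch, ascPochhammer_succ_eval, ascPochhammer_zero, Polynomial.eval_one]
    push_cast; ring
  rw [hermiteCoeff, hermiteCoeff, ← h, h2, Nat.factorial_succ, pow_succ, pow_succ]
  push_cast
  field_simp

/-- The operator `-2 z d/dz`. -/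
def negTwoEuler (h : PowerSeries ℝ) : PowerSeries ℝ :=
  (-2 : ℝ) • (PowerSeries.X * PowerSeries.derivative ℝ h)

lemma coeff_negTwoEuler (h : PowerSeries ℝ) (k : ℕ) :
    PowerSeries.coeff k (negTwoEuler h) = -2 * k * PowerSeries.coeff k h := by
  rw [negTwoEuler, PowerSeries.coeff_smul, smul_eq_mul]
  cases k with
  | zero => simp
  | succ k =>
    rw [PowerSeries.coeff_succ_X_mul, PowerSeries.coeff_derivative]
    push_cast; ring

/-- Hermite's equation `p'' - 2 y p' + 2 a p = 0` for `p = y ^ a h(y ^ (-2))`, with `z = y ^ (-2)`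
and `y d/dy = -2 z d/dz`. -/
lemma hermiteSeries_ode (a : ℝ) :
    PowerSeries.X * (negTwoEuler (negTwoEuler (hermiteSeries a))
        + (2 * a - 1) • negTwoEuler (hermiteSeries a) + (a * (a - 1)) • hermiteSeries a)
      = (2 : ℝ) • negTwoEuler (hermiteSeries a) := by
  ext k
  cases k with
  | zero => simp [coeff_negTwoEuler]
  | succ k =>
    rw [PowerSeries.coeff_succ_X_mul]
    simp only [map_add, PowerSeries.coeff_smul, coeff_negTwoEuler, smul_eq_mul, hermiteSeries,
      PowerSeries.coeff_mk]
    have := hermiteCoeff_succ k a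
    push_cast
    linear_combination this

lemma constantCoeff_mon_two (i : Fin N) :
    MvPowerSeries.constantCoeff (mon ℝ (Pi.single i 2 : Fin N → ℤ)) = 0 :=
  constantCoeff_mon (isCone_single i (by norm_num)) (single_ne_zero' i (by norm_num))

lemma euler_subst_self (i : Fin N) (h : PowerSeries ℝ) :
    euler ℝ i (h.subst (mon ℝ (Pi.single i 2)))
      = (negTwoEuler h).subst (mon ℝ (Pi.single i 2)) := by
  have hs : PowerSeries.HasSubst (mon ℝ (Pi.single i 2 : Fin N → ℤ)) :=
    PowerSeries.HasSubst.of_constantCoeff_zero (constantCoeff_mon_two i)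
  rw [derivation_subst _ _ (constantCoeff_mon_two i), negTwoEuler, PowerSeries.subst_smul hs,
    PowerSeries.subst_mul hs, PowerSeries.subst_X hs, euler_mon i (isCone_single i (by norm_num))]
  simp only [Pi.single_eq_same, MvPowerSeries.smul_eq_C_mul]
  push_cast
  ring

lemma euler_subst_of_ne {i k : Fin N} (hik : k ≠ i) (h : PowerSeries ℝ) :
    euler ℝ i (h.subst (mon ℝ (Pi.single k 2))) = 0 := by
  rw [derivation_subst _ _ (constantCoeff_mon_two k), euler_mon i (isCone_single k (by norm_num))]
  simp [hik.symm]

lemma hermiteProd_ode (lam : ℝ) (m : Fin N → ℤ) (i : Fin N) :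
    invVar ℝ i ^ 2 * (euler ℝ i (euler ℝ i (hermiteProd ℝ lam m))
        + MvPowerSeries.C (2 * (tilde lam m i - 1) - 1) * euler ℝ i (hermiteProd ℝ lam m)
        + MvPowerSeries.C ((tilde lam m i - 1) * (tilde lam m i - 1 - 1)) * hermiteProd ℝ lam m)
      = 2 * euler ℝ i (hermiteProd ℝ lam m) := by
  set a := tilde lam m i - 1 with ha
  have hs : PowerSeries.HasSubst (mon ℝ (Pi.single i 2 : Fin N → ℤ)) :=
    PowerSeries.HasSubst.of_constantCoeff_zero (constantCoeff_mon_two i)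
  set rest := ∏ k ∈ univ.erase i, (hermiteSeries (tilde lam m k - 1)).subst
    (mon ℝ (Pi.single k 2 : Fin N → ℤ)) with hrest
  have hQ : hermiteProd ℝ lam m = (hermiteSeries a).subst (mon ℝ (Pi.single i 2)) * rest :=
    (mul_prod_erase univ (fun k => (hermiteSeries (tilde lam m k - 1)).subst
      (mon ℝ (Pi.single k 2 : Fin N → ℤ))) (mem_univ i)).symm
  have hr : euler ℝ i rest = 0 := by
    rw [hrest, derivation_prod_of_eq_mul (g := fun _ => 0)]
    · simp
    · intro k hk
      rw [euler_subst_of_ne (ne_of_mem_erase hk), mul_zero]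
  have hode := congrArg (PowerSeries.subst (mon ℝ (Pi.single i 2 : Fin N → ℤ)))
    (hermiteSeries_ode a)
  rw [PowerSeries.subst_mul hs, PowerSeries.subst_X hs, PowerSeries.subst_add hs,
    PowerSeries.subst_add hs, PowerSeries.subst_smul hs, PowerSeries.subst_smul hs,
    PowerSeries.subst_smul hs, MvPowerSeries.smul_eq_C_mul, MvPowerSeries.smul_eq_C_mul,
    MvPowerSeries.smul_eq_C_mul] at hode
  have hsq : invVar ℝ i ^ 2 = mon ℝ (Pi.single i 2) := by
    rw [invVar, mon_pow (isCone_single_one i), ← Pi.single_smul]; rfl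
  have e1 : euler ℝ i (hermiteProd ℝ lam m)
      = (negTwoEuler (hermiteSeries a)).subst (mon ℝ (Pi.single i 2)) * rest := by
    rw [hQ, Derivation.leibniz, hr, euler_subst_self]
    simp [mul_comm]
  have e2 : euler ℝ i (euler ℝ i (hermiteProd ℝ lam m))
      = (negTwoEuler (negTwoEuler (hermiteSeries a))).subst (mon ℝ (Pi.single i 2)) * rest := by
    rw [e1, Derivation.leibniz, hr, euler_subst_self]
    simp [mul_comm]
  rw [e2, e1, hQ, hsq]
  have h2 : (MvPowerSeries.C (2 : ℝ) : MvPowerSeries (Fin N) ℝ) = 2 := map_ofNat _ 2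
  rw [h2] at hode
  linear_combination rest * hode

/-! ### Derivatives with respect to the particle positions -/

section CoeffDerivation

variable {A : Type*} [CommRing A] [Algebra ℝ A] (D : Derivation ℝ A A)

lemma coeffDerivation_mon (m : Fin N → ℤ) : coeffDerivation (Fin N) D (mon A m) = 0 := by
  rw [mon, coeffDerivation_monomial, D.map_one_eq_zero, map_zero]

lemma coeffDerivation_subst_mon (φ : PowerSeries ℝ) {m : Fin N → ℤ} (hm : IsCone m) (h : m ≠ 0) :
    coeffDerivation (Fin N) D (φ.subst (mon A m)) = 0 := by
  rw [derivation_subst _ _ (constantCoeff_mon hm h), coeffDerivation_mon, mul_zero]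

lemma derivation_prod_eq_zero {ι R : Type*} [CommRing R] [Algebra ℝ R] (D : Derivation ℝ R R)
    (s : Finset ι) (f : ι → R) (h : ∀ i ∈ s, D (f i) = 0) : D (∏ i ∈ s, f i) = 0 := by
  rw [derivation_prod_of_eq_mul D s f (fun _ => 0) fun i hi => by rw [h i hi, mul_zero]]
  simp

lemma coeffDerivation_hermiteProd (lam : ℝ) (m : Fin N → ℤ) :
    coeffDerivation (Fin N) D (hermiteProd A lam m) = 0 :=
  derivation_prod_eq_zero _ _ _ fun i _ => coeffDerivation_subst_mon D _
    (isCone_single i (by norm_num)) (single_ne_zero' i (by norm_num))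

lemma coeffDerivation_vandermondeSeries (lam : ℝ) :
    coeffDerivation (Fin N) D (vandermondeSeries A N lam) = 0 :=
  derivation_prod_eq_zero _ _ _ fun p _ => coeffDerivation_subst_mon D _
    (isCone_ratio p) (ratio_ne_zero p)

lemma coeffDerivation_invSub (x : A) (i : Fin N) :
    coeffDerivation (Fin N) D (invSub x i) = MvPowerSeries.C (D x) * invSub x i ^ 2 := by
  rw [invSub, Derivation.leibniz, derivation_geom _ (constantCoeff_monomial_single i x), invVar,
    coeffDerivation_mon, coeffDerivation_monomial, monomial_single_eq i (D x), smul_zero, add_zero,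
    smul_eq_mul, invVar]
  ring

lemma real_smul_eq_C_mul {σ : Type*} (c : ℝ) (T : MvPowerSeries σ A) :
    c • T = MvPowerSeries.C (algebraMap ℝ A c) * T := by
  ext e
  rw [MvPowerSeries.coeff_C_mul, ← Algebra.smul_def]
  rfl

lemma coeffDerivation_C_algebraMap (c : ℝ) :
    coeffDerivation (Fin N) D (MvPowerSeries.C (algebraMap ℝ A c)) = 0 := by
  have := coeffDerivation_monomial (σ := Fin N) D 0 (algebraMap ℝ A c)
  rwa [D.map_algebraMap, map_zero] at this

lemma coeffDerivation_kernelSeries (lam : ℝ) (x : Fin N → A) :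
    coeffDerivation (Fin N) D (kernelSeries lam x)
      = kernelSeries lam x * (MvPowerSeries.C (algebraMap ℝ A lam)
        * ∑ r, MvPowerSeries.C (D (x r)) * ∑ i, invSub (x r) i) := by
  rw [kernelSeries, derivation_prod_of_eq_mul _ _ _ _ fun q _ =>
    derivation_subst_binomSeries _ _ (constantCoeff_monomial_single q.2 (x q.1))]
  congr 1
  simp_rw [neg_neg, ← smul_sum]
  rw [real_smul_eq_C_mul]
  congr 1
  rw [Fintype.sum_prod_type]
  refine sum_congr rfl fun r _ => ?_
  rw [mul_sum]
  refine sum_congr rfl fun i _ => ?_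
  rw [coeffDerivation_monomial, monomial_single_eq i (D (x r)), invSub]
  ring

end CoeffDerivation

/-! ### Specialization of the coefficients -/

section Map

variable {A B : Type*} [CommRing A] [CommRing B] [Algebra ℝ A] [Algebra ℝ B] (h : A →ₐ[ℝ] B)

lemma map_subst_mon (φ : PowerSeries ℝ) {m : Fin N → ℤ} (hm : IsCone m) (h0 : m ≠ 0) :
    MvPowerSeries.map (h : A →+* B) (φ.subst (mon A m)) = φ.subst (mon B m) := by
  rw [map_subst_algHom h φ (PowerSeries.HasSubst.of_constantCoeff_zero (constantCoeff_mon hm h0)),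
    map_mon]

lemma map_hermiteProd (lam : ℝ) (m : Fin N → ℤ) :
    MvPowerSeries.map (h : A →+* B) (hermiteProd A lam m) = hermiteProd B lam m := by
  rw [hermiteProd, map_prod]
  exact prod_congr rfl fun i _ => map_subst_mon h _
    (isCone_single i (by norm_num)) (single_ne_zero' i (by norm_num))

lemma map_vandermondeSeries (lam : ℝ) :
    MvPowerSeries.map (h : A →+* B) (vandermondeSeries A N lam) = vandermondeSeries B N lam := by
  rw [vandermondeSeries, map_prod]
  exact prod_congr rfl fun p _ => map_subst_mon h _ (isCone_ratio p) (ratio_ne_zero p)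

lemma map_subst_monomial_single (φ : PowerSeries ℝ) (i : Fin N) (c : A) :
    MvPowerSeries.map (h : A →+* B)
        (φ.subst (MvPowerSeries.monomial (expo (Pi.single i 1)) c))
      = φ.subst (MvPowerSeries.monomial (expo (Pi.single i 1)) (h c)) := by
  rw [map_subst_algHom h φ (PowerSeries.HasSubst.of_constantCoeff_zero
    (constantCoeff_monomial_single i c)), MvPowerSeries.map_monomial]
  rfl

lemma map_kernelSeries (lam : ℝ) (x : Fin N → A) :
    MvPowerSeries.map (h : A →+* B) (kernelSeries lam x) = kernelSeries lam fun r => h (x r) := by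
  rw [kernelSeries, map_prod]
  exact prod_congr rfl fun q _ => map_subst_monomial_single h _ q.2 (x q.1)

lemma map_invSub (x : A) (i : Fin N) :
    MvPowerSeries.map (h : A →+* B) (invSub x i) = invSub (h x) i := by
  rw [invSub, map_mul, invVar, map_mon, geom, map_subst_monomial_single]
  rfl

end Map

lemma coeffDerivation_pderiv_kernelSeries (lam : ℝ) (r : Fin N) :
    coeffDerivation (Fin N) (MvPolynomial.pderiv r) (kernelSeries lam MvPolynomial.X)
      = kernelSeries lam MvPolynomial.X
        * (MvPowerSeries.C (MvPolynomial.C lam) * ∑ i, invSub (MvPolynomial.X r) i) := by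
  rw [coeffDerivation_kernelSeries, sum_eq_single r, MvPolynomial.algebraMap_eq]
  · rw [MvPolynomial.pderiv_X_self, map_one, one_mul]
  · intro s _ hs
    rw [MvPolynomial.pderiv_X_of_ne hs, map_zero, zero_mul]
  · simp

lemma pderiv_fH (lam : ℝ) (m : Fin N → ℤ) (r : Fin N) :
    MvPolynomial.pderiv r (fH lam m) = laurentCoeff (MvPolynomial (Fin N) ℝ) m
      (hermiteProd _ lam m * (vandermondeSeries _ N lam * (kernelSeries lam MvPolynomial.X
        * (MvPowerSeries.C (MvPolynomial.C lam) * ∑ i, invSub (MvPolynomial.X r) i)))) := by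
  rw [fH_eq_laurentCoeff, ← laurentCoeff_coeffDerivation, Derivation.leibniz, Derivation.leibniz,
    coeffDerivation_hermiteProd, coeffDerivation_vandermondeSeries, smul_zero, smul_zero, add_zero,
    add_zero, coeffDerivation_pderiv_kernelSeries]
  rfl

lemma pderiv_pderiv_fH (lam : ℝ) (m : Fin N → ℤ) (r : Fin N) :
    MvPolynomial.pderiv r (MvPolynomial.pderiv r (fH lam m))
      = laurentCoeff (MvPolynomial (Fin N) ℝ) m
      (hermiteProd _ lam m * (vandermondeSeries _ N lam * (kernelSeries lam MvPolynomial.X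
        * ((MvPowerSeries.C (MvPolynomial.C lam) * ∑ i, invSub (MvPolynomial.X r) i) ^ 2
          + MvPowerSeries.C (MvPolynomial.C lam) * ∑ i, invSub (MvPolynomial.X r) i ^ 2)))) := by
  rw [pderiv_fH, ← laurentCoeff_coeffDerivation, Derivation.leibniz, Derivation.leibniz,
    Derivation.leibniz, Derivation.leibniz,
    coeffDerivation_hermiteProd, coeffDerivation_vandermondeSeries, smul_zero, smul_zero, add_zero,
    add_zero, coeffDerivation_pderiv_kernelSeries, map_sum]
  have h1 : coeffDerivation (Fin N) (MvPolynomial.pderiv r)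
      (MvPowerSeries.C (MvPolynomial.C lam : MvPolynomial (Fin N) ℝ)) = 0 :=
    coeffDerivation_C_algebraMap _ lam
  rw [h1]
  simp_rw [coeffDerivation_invSub, MvPolynomial.pderiv_X_self, map_one, one_mul, smul_eq_mul]
  refine congrArg _ (congrArg _ (congrArg _ ?_))
  generalize kernelSeries lam (MvPolynomial.X (R := ℝ) (σ := Fin N)) = K
  generalize MvPowerSeries.C (MvPolynomial.C lam : MvPolynomial (Fin N) ℝ) = L
  ring

/-- The evaluation at `x` as a homomorphism of algebras. -/
abbrev evalHom (x : Fin N → ℝ) : MvPolynomial (Fin N) ℝ →ₐ[ℝ] ℝ := MvPolynomial.aeval x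

lemma eval_laurentCoeff (x : Fin N → ℝ) (m : Fin N → ℤ)
    (T : MvPowerSeries (Fin N) (MvPolynomial (Fin N) ℝ)) :
    MvPolynomial.eval x (laurentCoeff _ m T) = laurentCoeff ℝ m
      (MvPowerSeries.map (evalHom x : MvPolynomial (Fin N) ℝ →+* ℝ) T) := by
  rw [← map_laurentCoeff]
  rfl

lemma map_C_C (x : Fin N → ℝ) (c : ℝ) :
    MvPowerSeries.map (evalHom x : MvPolynomial (Fin N) ℝ →+* ℝ)
      (MvPowerSeries.C (MvPolynomial.C c) : MvPowerSeries (Fin N) _) = MvPowerSeries.C c := by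
  rw [MvPowerSeries.map_C]
  simp

lemma eval_fH (lam : ℝ) (x : Fin N → ℝ) (m : Fin N → ℤ) :
    MvPolynomial.eval x (fH lam m) = laurentCoeff ℝ m
      (hermiteProd ℝ lam m * (vandermondeSeries ℝ N lam * kernelSeries lam x)) := by
  rw [fH_eq_laurentCoeff, eval_laurentCoeff]
  simp_rw [map_mul (MvPowerSeries.map _), map_hermiteProd, map_vandermondeSeries, map_kernelSeries]
  simp

lemma eval_pderiv_fH (lam : ℝ) (x : Fin N → ℝ) (m : Fin N → ℤ) (r : Fin N) :
    MvPolynomial.eval x (MvPolynomial.pderiv r (fH lam m)) = laurentCoeff ℝ m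
      (hermiteProd ℝ lam m * (vandermondeSeries ℝ N lam * kernelSeries lam x)
        * (MvPowerSeries.C lam * ∑ i, invSub (x r) i)) := by
  rw [pderiv_fH, eval_laurentCoeff]
  simp_rw [map_mul, map_hermiteProd, map_vandermondeSeries, map_kernelSeries, map_C_C, map_sum,
    map_invSub, mul_assoc]
  simp

lemma eval_pderiv_pderiv_fH (lam : ℝ) (x : Fin N → ℝ) (m : Fin N → ℤ) (r : Fin N) :
    MvPolynomial.eval x (MvPolynomial.pderiv r (MvPolynomial.pderiv r (fH lam m)))
      = laurentCoeff ℝ m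
      (hermiteProd ℝ lam m * (vandermondeSeries ℝ N lam * kernelSeries lam x)
        * ((MvPowerSeries.C lam * ∑ i, invSub (x r) i) ^ 2
          + MvPowerSeries.C lam * ∑ i, invSub (x r) i ^ 2)) := by
  rw [pderiv_pderiv_fH, eval_laurentCoeff]
  simp_rw [map_mul, map_hermiteProd, map_vandermondeSeries, map_kernelSeries, map_add, map_pow,
    map_mul, map_C_C, map_sum, map_pow, map_invSub, mul_assoc]
  simp

/-! ### Integration by parts -/

/-- Integration by parts: on the coefficient of `y ^ (-m)` the operator `yᵢ ∂/∂yᵢ` acts as `-mᵢ`. -/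
lemma laurentCoeff_mul_euler (i : Fin N) (m : Fin N → ℤ) (W T : MvPowerSeries (Fin N) ℝ) :
    laurentCoeff ℝ m (W * euler ℝ i T)
      = -(m i : ℝ) * laurentCoeff ℝ m (W * T) - laurentCoeff ℝ m (euler ℝ i W * T) := by
  have h := laurentCoeff_euler i m (W * T)
  rw [Derivation.leibniz, map_add, smul_eq_mul, smul_eq_mul, smul_eq_mul, mul_comm T] at h
  linarith

lemma laurentCoeff_C_mul (m : Fin N → ℤ) (c : ℝ) (T : MvPowerSeries (Fin N) ℝ) :
    laurentCoeff ℝ m (MvPowerSeries.C c * T) = c * laurentCoeff ℝ m T := by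
  rw [← MvPowerSeries.smul_eq_C_mul, map_smul, smul_eq_mul]

lemma laurentCoeff_invVar_sq_mul_euler (i : Fin N) (m : Fin N → ℤ)
    (R T : MvPowerSeries (Fin N) ℝ) :
    laurentCoeff ℝ m (invVar ℝ i ^ 2 * R * euler ℝ i T)
      = laurentCoeff ℝ m (invVar ℝ i ^ 2
        * (MvPowerSeries.C (2 - (m i : ℝ)) * R - euler ℝ i R) * T) := by
  have h : euler ℝ i (invVar ℝ i ^ 2 * R)
      = invVar ℝ i ^ 2 * (euler ℝ i R - MvPowerSeries.C 2 * R) := by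
    rw [Derivation.leibniz, Derivation.leibniz_pow, euler_invVar, if_pos rfl]
    simp only [smul_eq_mul, map_ofNat, nsmul_eq_mul]
    push_cast
    ring
  rw [laurentCoeff_mul_euler, h, ← laurentCoeff_C_mul, ← map_sub]
  congr 1
  rw [map_neg, map_sub]
  ring

/-- The formal Sturm–Liouville identity `F(Q · ∂²S) = 2 F(θQ · S)`. -/
lemma laurentCoeff_mul_logDerivative (lam : ℝ) (x : Fin N → ℝ) (m : Fin N → ℤ) (i : Fin N) :
    laurentCoeff ℝ m (hermiteProd ℝ lam m * (vandermondeSeries ℝ N lam * kernelSeries lam x)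
        * (logDerivative lam x i ^ 2 + invVar ℝ i * euler ℝ i (logDerivative lam x i)))
      = -2 * (m i : ℝ) * laurentCoeff ℝ m
          (hermiteProd ℝ lam m * (vandermondeSeries ℝ N lam * kernelSeries lam x))
        - 2 * laurentCoeff ℝ m (hermiteProd ℝ lam m
          * euler ℝ i (vandermondeSeries ℝ N lam * kernelSeries lam x)) := by
  set Q := hermiteProd ℝ lam m with hQ
  set S := vandermondeSeries ℝ N lam * kernelSeries lam x with hS
  set l := logDerivative lam x i with hl
  set c := lam * (N - (i : ℕ)) with hc
  set Y := invVar ℝ i with hY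
  have e1 : Y * (euler ℝ i S - MvPowerSeries.C c * S) = S * l := invVar_mul_euler_source lam x i
  have e2 := congrArg (fun T => Y * euler ℝ i T) e1
  simp only [Derivation.leibniz, map_sub, euler_C, smul_eq_mul, mul_zero, add_zero] at e2
  rw [hY, euler_invVar, if_pos rfl, ← hY] at e2
  -- With `θ = yᵢ ∂/∂yᵢ`, both sides are `y ^ c ∂² (y ^ (-c) S)`, i.e. `Y² (θ - c) (θ - c - 1) S`.
  have e3 : S * (l ^ 2 + Y * euler ℝ i l) = Y ^ 2 * (euler ℝ i (euler ℝ i S)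
      - MvPowerSeries.C (2 * c + 1) * euler ℝ i S + MvPowerSeries.C (c * (c + 1)) * S) := by
    simp only [map_add, map_mul, map_one, map_ofNat]
    linear_combination -e2 + (MvPowerSeries.C c * Y - l) * e1
  clear_value S l
  -- Against `Y²` the adjoint of `θ` is `2 - mᵢ - θ`. With `a = mᵢ + c - 1` the adjoint of the
  -- operator in `e3` is exactly the left-hand side of `hermiteProd_ode`.
  have ht : tilde lam m i - 1 = m i + c - 1 := by rw [tilde, hc]; ring
  have h4 := hermiteProd_ode lam m i
  rw [← hQ, ← hY, ht] at h4
  have e5 : laurentCoeff ℝ m (Q * S * (l ^ 2 + Y * euler ℝ i l))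
      = laurentCoeff ℝ m (2 * euler ℝ i Q * S) := by
    rw [mul_assoc, e3, ← h4]
    have a1 := laurentCoeff_invVar_sq_mul_euler i m Q (euler ℝ i S)
    have a2 := laurentCoeff_invVar_sq_mul_euler i m
      (MvPowerSeries.C (2 - (m i : ℝ)) * Q - euler ℝ i Q) S
    have a3 := laurentCoeff_invVar_sq_mul_euler i m (MvPowerSeries.C (2 * c + 1) * Q) S
    rw [← hY] at a1 a2 a3
    have : Q * (Y ^ 2 * (euler ℝ i (euler ℝ i S)
      - MvPowerSeries.C (2 * c + 1) * euler ℝ i S + MvPowerSeries.C (c * (c + 1)) * S))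
      = Y ^ 2 * Q * euler ℝ i (euler ℝ i S)
        - Y ^ 2 * (MvPowerSeries.C (2 * c + 1) * Q) * euler ℝ i S
        + Y ^ 2 * Q * (MvPowerSeries.C (c * (c + 1)) * S) := by ring
    have b1 : ∀ (d : ℝ) (R : MvPowerSeries (Fin N) ℝ), euler ℝ i (MvPowerSeries.C d * R)
        = MvPowerSeries.C d * euler ℝ i R := fun d R => by
      rw [Derivation.leibniz, euler_C, smul_zero, add_zero, smul_eq_mul]
    rw [this, map_add, map_sub, a1, a2, a3, ← map_sub, ← map_add,
      map_sub (euler ℝ i), b1, b1]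
    congr 1
    simp only [map_sub, map_add, map_mul, map_one, map_ofNat]
    ring
  rw [e5, mul_assoc,
    show (2 : MvPowerSeries (Fin N) ℝ) = MvPowerSeries.C 2 from (map_ofNat _ 2).symm,
    laurentCoeff_C_mul, laurentCoeff_mul_euler]
  ring

/-! ### The reduced Hamiltonian on `fH` -/

lemma sum_logDerivative_sq (lam : ℝ) (x : Fin N → ℝ) (hx : Function.Injective x) :
    ∑ r, ((MvPowerSeries.C lam * ∑ i, invSub (x r) i) ^ 2
        + MvPowerSeries.C lam * ∑ i, invSub (x r) i ^ 2)
      + 2 * MvPowerSeries.C lam * ∑ r, ∑ s, MvPowerSeries.C (1 / (x r - x s))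
        * (MvPowerSeries.C lam * ∑ i, invSub (x r) i)
      = ∑ i, (logDerivative lam x i ^ 2 + invVar ℝ i * euler ℝ i (logDerivative lam x i))
        - MvPowerSeries.C (lam * (lam - 1)) * ∑ i, ∑ k, invDiff ℝ i k ^ 2 := by
  have hcanti : ∀ i j, (MvPowerSeries.C (1 / (x i - x j)) : MvPowerSeries (Fin N) ℝ)
      = -MvPowerSeries.C (1 / (x j - x i)) := fun i j => by
    rw [← neg_sub (x j), one_div_neg_eq_neg_one_div]
    exact map_neg MvPowerSeries.C _
  have hcdiag : ∀ i, (MvPowerSeries.C (1 / (x i - x i)) : MvPowerSeries (Fin N) ℝ) = 0 :=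
    fun i => by rw [sub_self, div_zero, map_zero MvPowerSeries.C]
  have hcyc : ∀ i j k : Fin N, i ≠ j → j ≠ k → k ≠ i → invDiff ℝ i j * invDiff ℝ j k
      + invDiff ℝ j k * invDiff ℝ k i + invDiff ℝ k i * invDiff ℝ i j = 0 :=
    fun i j k h1 h2 h3 => invDiff_cyclic h1 h2 h3
  have hac : ∀ r s i : Fin N, r ≠ s → invSub (x r) i * invSub (x s) i
      = MvPowerSeries.C (1 / (x r - x s)) * (invSub (x r) i - invSub (x s) i) :=
    fun r s i hrs => invSub_mul_invSub_left (hx.ne hrs) i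
  have had : ∀ r i k : Fin N, i ≠ k → invSub (x r) i * invSub (x r) k
      = invDiff ℝ i k * (invSub (x r) k - invSub (x r) i) :=
    fun r i k hik => invSub_mul_invSub_right (x r) hik
  have h3 : ∀ z : MvPowerSeries (Fin N) ℝ, 3 * z = 0 → z = 0 := fun z hz =>
    (mul_eq_zero.1 hz).resolve_left fun h => by
      rw [show (3 : MvPowerSeries (Fin N) ℝ) = MvPowerSeries.C 3 from (map_ofNat _ 3).symm,
        map_eq_zero_iff _ MvPowerSeries.C_injective] at h
      norm_num at h
  have hid := kernel_identity h3 (MvPowerSeries.C lam) (fun r i => invSub (x r) i)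
    (fun r s => MvPowerSeries.C (1 / (x r - x s))) (invDiff ℝ) invDiff_antisymm invDiff_self
    hcyc hcanti hcdiag hac had
  simp_rw [invVar_mul_euler_logDerivative]
  simp only [logDerivative]
  rw [map_mul, map_sub, map_one, ← hid]
  simp_rw [mul_pow]
  congr 1
  simp_rw [mul_left_comm _ (MvPowerSeries.C lam), ← mul_sum]
  ring

/-- Summed over `i`, scaling invariance converts the first-order term in `y` into `2 ∑ x_r ∂_r`,
which cancels the harmonic term of the reduced Hamiltonian. -/
lemma sum_laurentCoeff_mul_logDerivative (lam : ℝ) (x : Fin N → ℝ) (m : Fin N → ℤ) :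
    laurentCoeff ℝ m (hermiteProd ℝ lam m * (vandermondeSeries ℝ N lam * kernelSeries lam x)
        * ∑ i, (logDerivative lam x i ^ 2 + invVar ℝ i * euler ℝ i (logDerivative lam x i)))
      = -2 * (∑ i, (m i : ℝ)) * laurentCoeff ℝ m
          (hermiteProd ℝ lam m * (vandermondeSeries ℝ N lam * kernelSeries lam x))
        + 2 * laurentCoeff ℝ m
          (hermiteProd ℝ lam m * (vandermondeSeries ℝ N lam * kernelSeries lam x)
            * ∑ r, MvPowerSeries.C (x r) * (MvPowerSeries.C lam * ∑ i, invSub (x r) i)) := by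
  rw [mul_sum, map_sum]
  simp_rw [laurentCoeff_mul_logDerivative]
  rw [sum_sub_distrib, ← sum_mul, ← mul_sum, ← mul_sum, ← map_sum, ← mul_sum, sum_euler_source]
  rw [sub_eq_add_neg, ← mul_neg, ← map_neg]
  congr 3
  simp_rw [mul_left_comm _ (MvPowerSeries.C lam), ← mul_sum]
  ring

lemma reducedHamiltonian_fH_eq (lam : ℝ) (x : Fin N → ℝ) (hx : Function.Injective x)
    (m : Fin N → ℤ) :
    reducedHamiltonian lam x (fH lam m)
      = 2 * (∑ i, (m i : ℝ)) * MvPolynomial.eval x (fH lam m)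
        + lam * (lam - 1) * laurentCoeff ℝ m (hermiteProd ℝ lam m
          * (vandermondeSeries ℝ N lam * kernelSeries lam x) * ∑ i, ∑ k, invDiff ℝ i k ^ 2) := by
  have h1 := sum_logDerivative_sq lam x hx
  have h2 := sum_laurentCoeff_mul_logDerivative lam x m
  rw [reducedHamiltonian]
  simp_rw [eval_pderiv_pderiv_fH, eval_pderiv_fH, eval_fH]
  obtain ⟨Φ, hΦ⟩ : ∃ Φ : MvPowerSeries (Fin N) ℝ →ₗ[ℝ] ℝ, ∀ T, laurentCoeff ℝ m
      (hermiteProd ℝ lam m * (vandermondeSeries ℝ N lam * kernelSeries lam x) * T) = Φ T :=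
    ⟨laurentCoeff ℝ m ∘ₗ LinearMap.mulLeft ℝ _, fun T => rfl⟩
  have h3 := congrArg Φ h1
  have hC : ∀ c T, Φ (MvPowerSeries.C c * T) = c * Φ T := fun c T => by
    rw [← MvPowerSeries.smul_eq_C_mul, map_smul, smul_eq_mul]
  rw [show (2 : MvPowerSeries (Fin N) ℝ) = MvPowerSeries.C 2 from (map_ofNat _ 2).symm,
    ← map_mul] at h3
  simp_rw [hΦ] at h2 ⊢
  rw [map_add, map_sub, hC, hC, h2, map_sum, map_sum] at h3
  simp_rw [map_sum, hC] at h3 ⊢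
  rw [sum_add_distrib, sum_neg_distrib]
  simp_rw [mul_assoc, ← mul_sum, div_eq_inv_mul]
  simp_rw [one_div] at h3
  linarith

/-! ### Expanding `1/(yⱼ - yₖ)²` and the Hermite series -/

lemma sum_invDiff_sq : ∑ i : Fin N, ∑ k, invDiff ℝ i k ^ 2
    = 2 * ∑ p : Pairs N, (invVar ℝ p.1.2 * geom (mon ℝ (ratio p))) ^ 2 := by
  have h : ∀ i k : Fin N, invDiff ℝ i k ^ 2
      = (if h : i < k then (invVar ℝ k * geom (mon ℝ (ratio ⟨(i, k), h⟩))) ^ 2 else 0)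
        + if h : k < i then (invVar ℝ i * geom (mon ℝ (ratio ⟨(k, i), h⟩))) ^ 2 else 0 := by
    intro i k
    rcases lt_trichotomy i k with h | rfl | h
    · rw [dif_pos h, dif_neg h.asymm, invDiff_of_lt h, neg_sq, add_zero]
    · simp [invDiff_self]
    · rw [dif_pos h, dif_neg h.asymm, invDiff_of_gt h, zero_add]
  simp_rw [h, sum_add_distrib]
  rw [sum_comm (f := fun i k => if h : k < i then
    (invVar ℝ i * geom (mon ℝ (ratio ⟨(k, i), h⟩))) ^ 2
    else 0), sum_pairs, two_mul]

lemma hermiteSeries_eq_sum_bCoeff (a : ℝ) (n : ℤ) (M : ℕ) : ∃ R : PowerSeries ℝ,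
    hermiteSeries a = ∑ t ∈ range M, bCoeff t n a
      • (PowerSeries.X ^ t * hermiteSeries (a + n - 2 * t)) + PowerSeries.X ^ M * R := by
  suffices h : PowerSeries.X ^ M ∣ hermiteSeries a - ∑ t ∈ range M, bCoeff t n a
      • (PowerSeries.X ^ t * hermiteSeries (a + n - 2 * t)) by
    obtain ⟨R, hR⟩ := h
    exact ⟨R, by rw [← hR]; ring⟩
  rw [PowerSeries.X_pow_dvd_iff]
  intro s hs
  rw [map_sub, map_sum, sub_eq_zero, hermiteSeries, PowerSeries.coeff_mk,
    ← sum_bCoeff_mul_hermiteCoeff s n a, Nat.sum_antidiagonal_eq_sum_range_succ_mk]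
  rw [← sum_subset (range_subset_range.2 hs)]
  · refine sum_congr rfl fun t ht => ?_
    rw [PowerSeries.coeff_smul, PowerSeries.coeff_X_pow_mul',
      if_pos (by simpa [Nat.lt_succ_iff] using ht),
      hermiteSeries, PowerSeries.coeff_mk, smul_eq_mul]
  · intro t _ ht
    rw [PowerSeries.coeff_smul, PowerSeries.coeff_X_pow_mul', if_neg (by simpa using ht), smul_zero]

section Quotient

variable {e : Fin N →₀ ℕ} {M : ℕ}

lemma mk_mon_pow_eq_zero {b : Fin N → ℤ} (hb : IsCone b) (h0 : b ≠ 0) (hM : ∑ i, e i < M) :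
    Ideal.Quotient.mk (vanishIdeal ℝ e) (mon ℝ b ^ M) = 0 :=
  Ideal.Quotient.eq_zero_iff_mem.2 (monomial_pow_mem_vanishIdeal (expo_ne_zero hb h0) 1 hM)

/-- The expansion of `1 / (y_j - y_k) ^ 2`; the summation index `v` is `ν - 1`. -/
lemma mk_invVar_mul_geom_sq (p : Pairs N) (hM : ∑ i, e i < M) :
    Ideal.Quotient.mk (vanishIdeal ℝ e) ((invVar ℝ p.1.2 * geom (mon ℝ (ratio p))) ^ 2)
      = Ideal.Quotient.mk (vanishIdeal ℝ e) (∑ v ∈ range M,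
        ((v : ℝ) + 1) • (invVar ℝ p.1.2 ^ 2 * mon ℝ (ratio p) ^ v)) := by
  have hs : PowerSeries.HasSubst (mon ℝ (ratio p)) :=
    PowerSeries.HasSubst.of_constantCoeff_zero (constantCoeff_ratio p)
  have h1 : geom (mon ℝ (ratio p)) ^ 2
      = (PowerSeries.mk fun k => ((k : ℝ) + 1)).subst (mon ℝ (ratio p)) := by
    rw [geom, ← PowerSeries.subst_pow hs, PowerSeries.mk_one_pow_eq_mk_choose_add]
    congr 1
    ext k
    simp [add_comm]
  obtain ⟨U, hU⟩ := subst_add_pow_mul (PowerSeries.mk fun k => ((k : ℝ) + 1)) hs M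
  rw [mul_pow, h1, hU, mul_add, map_add, mul_left_comm, map_mul _ (mon ℝ (ratio p) ^ M),
    mk_mon_pow_eq_zero (isCone_ratio p) (ratio_ne_zero p) hM, zero_mul, add_zero, mul_sum]
  simp_rw [PowerSeries.coeff_mk, mul_smul_comm]

lemma mk_subst_hermiteSeries (i : Fin N) (a : ℝ) (n : ℤ) (hM : ∑ i, e i < M) :
    Ideal.Quotient.mk (vanishIdeal ℝ e) ((hermiteSeries a).subst (mon ℝ (Pi.single i 2)))
      = Ideal.Quotient.mk (vanishIdeal ℝ e) (∑ t ∈ range M, bCoeff t n a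
        • (mon ℝ (Pi.single i 2) ^ t
          * (hermiteSeries (a + n - 2 * t)).subst (mon ℝ (Pi.single i 2)))) := by
  have hs : PowerSeries.HasSubst (mon ℝ (Pi.single i 2 : Fin N → ℤ)) :=
    PowerSeries.HasSubst.of_constantCoeff_zero (constantCoeff_mon_two i)
  obtain ⟨R, hR⟩ := hermiteSeries_eq_sum_bCoeff a n M
  have h1 := congrArg (PowerSeries.substAlgHom hs) hR
  simp only [map_add, map_sum, map_smul, map_mul, map_pow, PowerSeries.coe_substAlgHom,
    PowerSeries.subst_X hs] at h1
  rw [h1, map_add, map_mul _ (_ ^ M), mk_mon_pow_eq_zero (isCone_single i (by norm_num))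
    (single_ne_zero' i (by norm_num)) hM, zero_mul, add_zero]

end Quotient

lemma hermiteProd_eq_mul (lam : ℝ) (m : Fin N → ℤ) (p : Pairs N) :
    hermiteProd ℝ lam m
      = (hermiteSeries (tilde lam m p.1.1 - 1)).subst (mon ℝ (Pi.single p.1.1 2))
        * (hermiteSeries (tilde lam m p.1.2 - 1)).subst (mon ℝ (Pi.single p.1.2 2))
        * ∏ i ∈ (univ.erase p.1.1).erase p.1.2,
          (hermiteSeries (tilde lam m i - 1)).subst (mon ℝ (Pi.single i 2)) := by
  rw [hermiteProd, ← mul_prod_erase univ _ (mem_univ p.1.1), mul_assoc,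
    ← mul_prod_erase (univ.erase p.1.1) _ (mem_erase.2 ⟨p.2.ne', mem_univ p.1.2⟩)]

lemma Step.shift_eq (c : Step N) : c.shift = c.nu • ratio c.pair
    + Pi.single c.pair.1.1 (1 + 2 * (c.t : ℤ)) + Pi.single c.pair.1.2 (1 + 2 * (c.u : ℤ)) := by
  ext i
  simp only [Step.shift, ratio, Pi.add_apply, Pi.smul_apply, Pi.sub_apply, Pi.single_apply]
  split_ifs <;> simp <;> ring

lemma isCone_shift (c : Step N) : IsCone c.shift := by
  rw [c.shift_eq]
  exact (((isCone_ratio _).nsmul _).add (isCone_single _ (by positivity))).add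
    (isCone_single _ (by positivity))

lemma mon_shift (p : Pairs N) (t u v : ℕ) :
    mon ℝ (Step.shift ⟨p, t, u, v + 1⟩) = invVar ℝ p.1.2 ^ 2 * mon ℝ (ratio p) ^ v
      * mon ℝ (Pi.single p.1.1 2) ^ t * mon ℝ (Pi.single p.1.2 2) ^ u := by
  have h2 : ∀ i : Fin N, IsCone (Pi.single i 2 : Fin N → ℤ) := fun i =>
    isCone_single i (by norm_num)
  have c1 := (isCone_single_one p.1.2).nsmul 2
  have c2 := (isCone_ratio p).nsmul v
  have c3 := (h2 p.1.1).nsmul t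
  have c4 := (h2 p.1.2).nsmul u
  rw [invVar, mon_pow (isCone_single_one _), mon_pow (isCone_ratio p), mon_pow (h2 _),
    mon_pow (h2 _), mon_mul c1 c2, mon_mul (c1.add c2) c3, mon_mul ((c1.add c2).add c3) c4]
  congr 1
  ext i
  simp only [Step.shift, ratio, Pi.add_apply, Pi.smul_apply, Pi.sub_apply, Pi.single_apply]
  split_ifs <;> simp <;> ring

lemma tilde_sub (lam : ℝ) (m E : Fin N → ℤ) (i : Fin N) :
    tilde lam (m - E) i = tilde lam m i - E i := by
  rw [tilde, tilde, Pi.sub_apply]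
  push_cast
  ring

lemma Step.shift_fst (c : Step N) : c.shift c.pair.1.1 = 1 + 2 * (c.t : ℤ) - c.nu := by
  simp [Step.shift, c.pair.2.ne]

lemma Step.shift_snd (c : Step N) : c.shift c.pair.1.2 = 1 + 2 * (c.u : ℤ) + c.nu := by
  simp [Step.shift, c.pair.2.ne']

lemma Step.shift_of_ne (c : Step N) {i : Fin N} (h1 : i ≠ c.pair.1.1) (h2 : i ≠ c.pair.1.2) :
    c.shift i = 0 := by
  simp [Step.shift, h1, h2]

/-- At `m - 𝐄` the arguments of both `b` coefficients become the Hermite parameters `m̃ - 1` of the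
undisplaced label. -/
lemma weight_sub_shift (lam : ℝ) (m : Fin N → ℤ) (c : Step N) :
    c.weight lam (m - c.shift) = 2 * lam * (lam - 1) * c.nu
      * bCoeff c.t ((c.nu : ℤ) - 1) (tilde lam m c.pair.1.1 - 1)
      * bCoeff c.u (-1 - (c.nu : ℤ)) (tilde lam m c.pair.1.2 - 1) := by
  rw [Step.weight, tilde_sub, tilde_sub, c.shift_fst, c.shift_snd]
  push_cast
  congr 2 <;> ring_nf

/-- The prefactor is `y_j ^ v y_k ^ (-2 - v)`. Only the factors `j` and `k` are re-expanded, and the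
new parameters are those of the label `m - 𝐄`. -/
lemma mk_hermiteProd_mul {e : Fin N →₀ ℕ} {M : ℕ} (lam : ℝ) (m : Fin N → ℤ) (p : Pairs N) (v : ℕ)
    (hM : ∑ i, e i < M) :
    Ideal.Quotient.mk (vanishIdeal ℝ e)
        ((invVar ℝ p.1.2 ^ 2 * mon ℝ (ratio p) ^ v) * hermiteProd ℝ lam m)
      = Ideal.Quotient.mk (vanishIdeal ℝ e) (∑ t ∈ range M, ∑ u ∈ range M,
        (bCoeff t v (tilde lam m p.1.1 - 1) * bCoeff u (-2 - v) (tilde lam m p.1.2 - 1))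
          • (mon ℝ (Step.shift ⟨p, t, u, v + 1⟩)
            * hermiteProd ℝ lam (m - Step.shift ⟨p, t, u, v + 1⟩))) := by
  have hmul : ∀ a b c d : MvPowerSeries (Fin N) ℝ,
      Ideal.Quotient.mk (vanishIdeal ℝ e) (a * (b * c * d))
      = Ideal.Quotient.mk _ a * (Ideal.Quotient.mk _ b * Ideal.Quotient.mk _ c
        * Ideal.Quotient.mk _ d) := fun a b c d => by
    rw [map_mul, map_mul, map_mul]
  rw [hermiteProd_eq_mul lam m p, hmul, mk_subst_hermiteSeries p.1.1 _ v hM,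
    mk_subst_hermiteSeries p.1.2 _ (-2 - v) hM, ← hmul, sum_mul_sum, sum_mul, mul_sum]
  congr 1
  refine sum_congr rfl fun t _ => ?_
  rw [sum_mul, mul_sum]
  refine sum_congr rfl fun u _ => ?_
  set c : Step N := ⟨p, t, u, v + 1⟩ with hc
  have e1 : tilde lam (m - c.shift) p.1.1 - 1 = tilde lam m p.1.1 - 1 + (v : ℤ) - 2 * t := by
    rw [tilde_sub, c.shift_fst, hc]
    push_cast
    ring
  have e2 : tilde lam (m - c.shift) p.1.2 - 1
      = tilde lam m p.1.2 - 1 + (-2 - v : ℤ) - 2 * u := by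
    rw [tilde_sub, c.shift_snd, hc]
    push_cast
    ring
  have e3 : ∏ i ∈ (univ.erase p.1.1).erase p.1.2,
      (hermiteSeries (tilde lam (m - c.shift) i - 1)).subst (mon ℝ (Pi.single i 2 : Fin N → ℤ))
      = ∏ i ∈ (univ.erase p.1.1).erase p.1.2,
      (hermiteSeries (tilde lam m i - 1)).subst (mon ℝ (Pi.single i 2 : Fin N → ℤ)) := by
    refine prod_congr rfl fun i hi => ?_
    simp only [mem_erase, mem_univ, and_true] at hi
    rw [tilde_sub, c.shift_of_ne hi.2 hi.1, Int.cast_zero, sub_zero]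
  rw [hermiteProd_eq_mul lam (m - c.shift) p, e1, e2, e3, mon_shift, smul_mul_smul_comm,
    smul_mul_assoc, mul_smul_comm]
  congr 1
  ring

lemma fH_of_not_isCone (lam : ℝ) {m : Fin N → ℤ} (hm : ¬ IsCone m) : fH lam m = 0 := by
  rw [fH_eq_laurentCoeff, laurentCoeff_of_not_isCone hm]

lemma laurentCoeff_mul_sum_invDiff_sq {M : ℕ} (lam : ℝ) (x : Fin N → ℝ) (m : Fin N → ℤ)
    (hM : ∑ i, expo m i < M) :
    lam * (lam - 1) * laurentCoeff ℝ m (hermiteProd ℝ lam m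
        * (vandermondeSeries ℝ N lam * kernelSeries lam x) * ∑ i, ∑ k, invDiff ℝ i k ^ 2)
      = ∑ p : Pairs N, ∑ v ∈ range M, ∑ t ∈ range M, ∑ u ∈ range M,
        Step.weight lam (m - Step.shift ⟨p, t, u, v + 1⟩) ⟨p, t, u, v + 1⟩
          * MvPolynomial.eval x (fH lam (m - Step.shift ⟨p, t, u, v + 1⟩)) := by
  set Q := hermiteProd ℝ lam m with hQ
  set S := vandermondeSeries ℝ N lam * kernelSeries lam x with hS
  have key : Ideal.Quotient.mk (vanishIdeal ℝ (expo m)) (Q * S * ∑ i, ∑ k, invDiff ℝ i k ^ 2)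
      = Ideal.Quotient.mk (vanishIdeal ℝ (expo m)) (∑ p : Pairs N, ∑ v ∈ range M, ∑ t ∈ range M,
        ∑ u ∈ range M, (2 * ((v : ℝ) + 1) * (bCoeff t v (tilde lam m p.1.1 - 1)
            * bCoeff u (-2 - v) (tilde lam m p.1.2 - 1)))
          • (mon ℝ (Step.shift ⟨p, t, u, v + 1⟩)
            * (hermiteProd ℝ lam (m - Step.shift ⟨p, t, u, v + 1⟩) * S))) := by
    have h1 : ∀ p : Pairs N, Ideal.Quotient.mk (vanishIdeal ℝ (expo m))
        (2 * (Q * S) * (invVar ℝ p.1.2 * geom (mon ℝ (ratio p))) ^ 2)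
      = Ideal.Quotient.mk (vanishIdeal ℝ (expo m)) (∑ v ∈ range M, ∑ t ∈ range M,
        ∑ u ∈ range M, (2 * ((v : ℝ) + 1) * (bCoeff t v (tilde lam m p.1.1 - 1)
            * bCoeff u (-2 - v) (tilde lam m p.1.2 - 1)))
          • (mon ℝ (Step.shift ⟨p, t, u, v + 1⟩)
            * (hermiteProd ℝ lam (m - Step.shift ⟨p, t, u, v + 1⟩) * S))) := by
      intro p
      rw [map_mul, mk_invVar_mul_geom_sq p hM, ← map_mul, mul_sum, map_sum, map_sum]
      refine sum_congr rfl fun v _ => ?_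
      have h2 : 2 * (Q * S) * (((v : ℝ) + 1) • (invVar ℝ p.1.2 ^ 2 * mon ℝ (ratio p) ^ v))
          = (MvPowerSeries.C (2 * ((v : ℝ) + 1)) * S)
            * ((invVar ℝ p.1.2 ^ 2 * mon ℝ (ratio p) ^ v) * Q) := by
        rw [MvPowerSeries.smul_eq_C_mul, map_mul, map_ofNat]
        ring
      rw [h2, map_mul, hQ, mk_hermiteProd_mul lam m p v hM, ← map_mul, mul_sum]
      congr 1
      refine sum_congr rfl fun t _ => ?_
      rw [mul_sum]
      refine sum_congr rfl fun u _ => ?_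
      simp_rw [MvPowerSeries.smul_eq_C_mul, map_mul]
      ring
    rw [sum_invDiff_sq, map_sum, ← mul_assoc, mul_comm (Q * S), mul_sum, map_sum]
    exact sum_congr rfl fun p _ => h1 p
  rw [laurentCoeff_eq_of_sub_mem (Ideal.Quotient.eq.1 key)]
  simp_rw [map_sum, mul_sum]
  refine sum_congr rfl fun p _ => sum_congr rfl fun v _ => sum_congr rfl fun t _ =>
    sum_congr rfl fun u _ => ?_
  rw [map_smul, laurentCoeff_mon_mul _ (isCone_shift _), ← eval_fH, weight_sub_shift, smul_eq_mul]
  push_cast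
  rw [show ((v : ℤ) + 1 - 1) = v by ring, show (-1 - ((v : ℤ) + 1)) = -2 - v by ring]
  ring

lemma reducedHamiltonian_fH (lam : ℝ) (x : Fin N → ℝ) (hx : Function.Injective x)
    (m : Fin N → ℤ) :
    reducedHamiltonian lam x (fH lam m)
      = 2 * (∑ i, (m i : ℝ)) * MvPolynomial.eval x (fH lam m)
        + ∑ᶠ c : Step N, c.weight lam (m - c.shift)
          * MvPolynomial.eval x (fH lam (m - c.shift)) := by
  rw [reducedHamiltonian_fH_eq lam x hx]
  set M := ∑ i, expo m i + (height m).toNat + 1 with hM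
  rw [laurentCoeff_mul_sum_invDiff_sq (M := M) lam x m (by omega)]
  congr 1
  let φ : Pairs N × ℕ × ℕ × ℕ ≃ Step N :=
    { toFun := fun q => ⟨q.1, q.2.2.1, q.2.2.2, q.2.1⟩
      invFun := fun c => (c.pair, c.nu, c.t, c.u)
      left_inv := fun _ => rfl
      right_inv := fun _ => rfl }
  -- The range of `ν` is one longer than that of `v = ν - 1`; the additional term `ν = 0` has weight
  -- zero. Outside the box `m - 𝐄` would have negative height, so `fH` vanishes there.
  rw [← finsum_comp_equiv φ, finsum_eq_sum_of_support_subset (s :=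
    univ ×ˢ (range (M + 1) ×ˢ (range M ×ˢ range M)))]
  · rw [sum_product]
    refine sum_congr rfl fun p _ => ?_
    symm
    rw [sum_product, sum_range_succ', sum_eq_zero (s := range M ×ˢ range M), add_zero]
    · refine sum_congr rfl fun v _ => ?_
      rw [sum_product]
      rfl
    · intro q _
      simp [φ, Step.weight]
  · intro q hq
    have h1 : fH lam (m - (φ q).shift) ≠ 0 := fun h0 => by
      apply hq
      simp [h0]
    have h2 : IsCone (m - (φ q).shift) := by
      by_contra h
      exact h1 (fH_of_not_isCone lam h)
    have h3 : 0 ≤ height (m - (φ q).shift) := by rw [← sum_expo h2]; positivity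
    have h4 := (φ q).height_shift
    have h5 : height m = height (m - (φ q).shift) + height (φ q).shift := by
      rw [← height_add, sub_add_cancel]
    have e1 : (φ q).t = q.2.2.1 := rfl
    have e2 : (φ q).u = q.2.2.2 := rfl
    have e3 : (φ q).nu = q.2.1 := rfl
    simp only [coe_product, coe_univ, Set.mem_prod, Set.mem_univ, coe_range, Set.mem_Iio, true_and]
    omega

/-! ### The eigenfunctions -/

lemma finite_setOf_isCone_height_le (H : ℤ) : {m : Fin N → ℤ | IsCone m ∧ height m ≤ H}.Finite :=
  finite_setOf_tail_nonneg H

lemma isCone_of_fH_ne_zero {lam : ℝ} {m : Fin N → ℤ} (h : fH lam m ≠ 0) : IsCone m := by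
  by_contra hm
  exact h (fH_of_not_isCone lam hm)

lemma IsCone.height_nonneg {m : Fin N → ℤ} (h : IsCone m) : 0 ≤ height m := by
  rw [← sum_expo h]
  positivity

lemma finite_support_beta_smul_fH (lam : ℝ) (n : Fin N → ℤ) :
    (Function.support fun m : Fin N → ℤ => beta lam n m • fH lam m).Finite :=
  (finite_setOf_isCone_height_le (height n)).subset fun _ hm =>
    ⟨isCone_of_fH_ne_zero (right_ne_zero_of_smul hm),
      height_le_of_beta_ne_zero (left_ne_zero_of_smul hm)⟩

/-- `reducedHamiltonian` as a linear map. -/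
def reducedHamiltonianHom (lam : ℝ) (x : Fin N → ℝ) : MvPolynomial (Fin N) ℝ →ₗ[ℝ] ℝ where
  toFun := reducedHamiltonian lam x
  map_add' P Q := by
    simp only [reducedHamiltonian, map_add, add_div, sum_add_distrib, mul_add, neg_add]
    ring
  map_smul' c P := by
    simp only [reducedHamiltonian, Derivation.map_smul, MvPolynomial.smul_eval, RingHom.id_apply,
      smul_eq_mul, sum_add_distrib, sum_neg_distrib, mul_left_comm _ c, mul_div_assoc, ← mul_sum]
    ring

/-- Translating the label by the shift turns the triangular action into its transpose, which is the
right-hand side of `beta_recursion`. The joint support is finite by the height bound, so the sums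
may be exchanged. -/
lemma finsum_beta_mul_weight (lam : ℝ) (n : Fin N → ℤ) (x : Fin N → ℝ) :
    ∑ᶠ m : Fin N → ℤ, beta lam n m * ∑ᶠ c : Step N, c.weight lam (m - c.shift)
        * MvPolynomial.eval x (fH lam (m - c.shift))
      = ∑ᶠ m : Fin N → ℤ, 2 * ((∑ i, (n i : ℝ)) - ∑ i, (m i : ℝ)) * beta lam n m
        * MvPolynomial.eval x (fH lam m) := by
  set G : (Fin N → ℤ) × Step N → ℝ := fun q =>
    q.2.weight lam q.1 * beta lam n (q.1 + q.2.shift) * MvPolynomial.eval x (fH lam q.1) with hG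
  have hfin : (Function.support G).Finite := by
    refine ((finite_setOf_isCone_height_le (height n)).prod
      (finite_setOf_step (height n).toNat)).subset ?_
    rintro ⟨m, c⟩ h
    have h1 : IsCone m := isCone_of_fH_ne_zero (lam := lam) fun h0 => h (by simp [hG, h0])
    have h2 : height (m + c.shift) ≤ height n :=
      height_le_of_beta_ne_zero (lam := lam) fun h0 => h (by simp [hG, h0])
    have h3 := c.height_shift
    have h4 := h1.height_nonneg
    rw [height_add] at h2
    exact ⟨⟨h1, show height m ≤ _ by omega⟩, show c.t ≤ _ by omega, show c.u ≤ _ by omega,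
      show c.nu ≤ _ by omega⟩
  let φ : (Fin N → ℤ) × Step N ≃ (Fin N → ℤ) × Step N :=
    { toFun := fun q => (q.1 - q.2.shift, q.2)
      invFun := fun q => (q.1 + q.2.shift, q.2)
      left_inv := fun q => by simp
      right_inv := fun q => by simp }
  have h1 : ∑ᶠ q, G (φ q) = ∑ᶠ q, G q := finsum_comp_equiv φ
  rw [finsum_curry _ hfin, finsum_curry (fun q => G (φ q))
    (hfin.preimage φ.injective.injOn)] at h1
  convert h1 using 3 with m m
  · rw [mul_finsum]
    refine finsum_congr fun c => ?_
    simp only [hG, φ, Equiv.coe_fn_mk, sub_add_cancel]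
    ring
  · rw [beta_recursion, finsum_mul]

lemma eval_eigenPoly (lam : ℝ) (n : Fin N → ℤ) (x : Fin N → ℝ) :
    MvPolynomial.eval x (eigenPoly lam n)
      = ∑ᶠ m : Fin N → ℤ, beta lam n m * MvPolynomial.eval x (fH lam m) := by
  rw [eigenPoly]
  exact ((MvPolynomial.eval x).toAddMonoidHom.map_finsum
    (finite_support_beta_smul_fH lam n)).trans
    (finsum_congr fun m => MvPolynomial.smul_eval x _ _)

/-- The diagonal part `2 |m|` and the recursion part `2 (|n| - |m|)` add up to `2 |n|` for every
label. -/
lemma reducedHamiltonian_eigenPoly (lam : ℝ) (n : Fin N → ℤ) (x : Fin N → ℝ)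
    (hx : Function.Injective x) :
    reducedHamiltonian lam x (eigenPoly lam n)
      = 2 * (∑ i, (n i : ℝ)) * MvPolynomial.eval x (eigenPoly lam n) := by
  have hS := finite_support_beta_smul_fH lam n
  have hsub : ∀ g : (Fin N → ℤ) → ℝ, (∀ m, fH lam m = 0 → g m = 0) →
      (Function.support fun m => beta lam n m * g m).Finite := fun g hg =>
    hS.subset fun m hm => smul_ne_zero (left_ne_zero_of_mul hm)
      fun h0 => right_ne_zero_of_mul hm (hg m h0)
  have h1 : reducedHamiltonian lam x (eigenPoly lam n)
      = ∑ᶠ m, beta lam n m * reducedHamiltonian lam x (fH lam m) := by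
    rw [eigenPoly]
    refine ((reducedHamiltonianHom lam x).toAddMonoidHom.map_finsum hS).trans ?_
    exact finsum_congr fun m => (reducedHamiltonianHom lam x).map_smul _ _
  have hH : ∀ m, fH lam m = 0 → reducedHamiltonian lam x (fH lam m) = 0 := fun m h0 => by
    rw [h0]
    exact (reducedHamiltonianHom lam x).map_zero
  have h2 : ∀ m, beta lam n m * reducedHamiltonian lam x (fH lam m)
      = beta lam n m * (2 * (∑ i, (m i : ℝ)) * MvPolynomial.eval x (fH lam m))
        + beta lam n m * ∑ᶠ c : Step N, c.weight lam (m - c.shift)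
          * MvPolynomial.eval x (fH lam (m - c.shift)) := fun m => by
    rw [reducedHamiltonian_fH lam x hx, mul_add]
  have f1 := hsub (fun m => 2 * (∑ i, (m i : ℝ)) * MvPolynomial.eval x (fH lam m))
    fun m h0 => by simp [h0]
  rw [h1, finsum_congr h2, finsum_add_distrib f1, finsum_beta_mul_weight, ← finsum_add_distrib f1,
    eval_eigenPoly, mul_finsum]
  · exact finsum_congr fun m => by ring
  · refine hS.subset fun m hm => smul_ne_zero (fun h0 => hm (by simp [h0]))
      fun h0 => hm (by simp [h0])
  · refine hsub _ fun m h0 => ?_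
    have := reducedHamiltonian_fH lam x hx m
    rw [hH m h0, h0, map_zero, mul_zero, zero_add] at this
    exact this.symm

/-! ### Symmetry: only the kernel involves `x`, and permuting `x` permutes its factors. -/

lemma rename_fH (lam : ℝ) (σ : Equiv.Perm (Fin N)) (m : Fin N → ℤ) :
    MvPolynomial.rename σ (fH lam m) = fH lam m := by
  have h : kernelSeries lam (fun r => MvPolynomial.rename (R := ℝ) σ (MvPolynomial.X r))
      = kernelSeries lam MvPolynomial.X := by
    simp_rw [kernelSeries, MvPolynomial.rename_X]
    exact Fintype.prod_equiv (σ.prodCongr (Equiv.refl _)) _ _ fun q => rfl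
  have h1 := map_laurentCoeff
    ((MvPolynomial.rename σ : MvPolynomial (Fin N) ℝ →ₐ[ℝ] MvPolynomial (Fin N) ℝ) :
      MvPolynomial (Fin N) ℝ →+* MvPolynomial (Fin N) ℝ) m
    (hermiteProd _ lam m * (vandermondeSeries _ N lam * kernelSeries lam MvPolynomial.X))
  rw [map_mul (MvPowerSeries.map _), map_mul (MvPowerSeries.map _), map_hermiteProd,
    map_vandermondeSeries, map_kernelSeries, h, ← fH_eq_laurentCoeff] at h1
  exact h1

lemma isSymmetric_eigenPoly (lam : ℝ) (n : Fin N → ℤ) : (eigenPoly lam n).IsSymmetric := by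
  intro σ
  rw [eigenPoly]
  refine ((MvPolynomial.rename (R := ℝ) σ).toLinearMap.toAddMonoidHom.map_finsum
    (finite_support_beta_smul_fH lam n)).trans (finsum_congr fun m => ?_)
  exact ((MvPolynomial.rename (R := ℝ) σ).toLinearMap.map_smul _ _).trans
    (congrArg _ (rename_fH lam σ m))

lemma isReducedEigenfunction_eigenPoly (lam : ℝ) (n : Fin N → ℤ) :
    IsReducedEigenfunction lam (energy lam n) (eigenPoly lam n) where
  symmetric := isSymmetric_eigenPoly lam n
  schroedinger x hx := by
    rw [hamiltonian_groundState_mul lam x hx, reducedHamiltonian_eigenPoly lam n x hx, energy]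
    ring

/-! ### Homogeneous components of `fH` -/

lemma fH_eq_sum (lam : ℝ) (m : Fin N → ℤ) {M : ℕ} (hM : ∑ l, expo m l < M) :
    fH lam m = ∑ k ∈ Fintype.piFinset fun _ : Fin N × Fin N => range M,
      (∏ q, (PowerSeries.coeff (k q) (binomSeries (-lam)) • MvPolynomial.X q.1 ^ k q))
        * MvPolynomial.C (laurentCoeff ℝ (m - ∑ q, k q • Pi.single q.2 1)
          (hermiteProd ℝ lam m * vandermondeSeries ℝ N lam)) := by
  rw [fH_eq_laurentCoeff, ← mul_assoc, kernelSeries]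
  refine (laurentCoeff_mul_prod_subst (b := fun q : Fin N × Fin N => Pi.single q.2 1)
    (fun q => isCone_single_one q.2) (fun q => single_ne_zero' q.2 (by norm_num))
    (fun _ => binomSeries (-lam)) (fun q => MvPolynomial.X q.1) _ _ hM).trans ?_
  refine sum_congr rfl fun k _ => congrArg _ ?_
  have h := map_laurentCoeff
    (Algebra.ofId ℝ (MvPolynomial (Fin N) ℝ) : ℝ →+* MvPolynomial (Fin N) ℝ)
    (m - ∑ q : Fin N × Fin N, k q • Pi.single q.2 1)
    (hermiteProd ℝ lam m * vandermondeSeries ℝ N lam)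
  rw [map_mul (MvPowerSeries.map _), map_hermiteProd, map_vandermondeSeries] at h
  exact h.symm

lemma isHomogeneous_kernelTerm (lam : ℝ) (k : Fin N × Fin N → ℕ) (c : ℝ) :
    ((∏ q, (PowerSeries.coeff (k q) (binomSeries (-lam)) • MvPolynomial.X q.1 ^ k q))
      * MvPolynomial.C c : MvPolynomial (Fin N) ℝ).IsHomogeneous (∑ q, k q) := by
  refine (MvPolynomial.IsHomogeneous.prod _ _ k fun q _ => ?_).mul
    (MvPolynomial.isHomogeneous_C _ c)
  rw [MvPolynomial.smul_eq_C_mul]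
  exact MvPolynomial.IsHomogeneous.C_mul (MvPolynomial.isHomogeneous_X_pow _ _) _

lemma homogeneousComponent_fH (lam : ℝ) (m : Fin N → ℤ) (d : ℕ) :
    MvPolynomial.homogeneousComponent d (fH lam m)
      = ∑ k ∈ finsuppAntidiag (univ : Finset (Fin N × Fin N)) d,
        (∏ q, (PowerSeries.coeff (k q) (binomSeries (-lam)) • MvPolynomial.X q.1 ^ k q))
          * MvPolynomial.C (laurentCoeff ℝ (m - ∑ q, k q • Pi.single q.2 1)
            (hermiteProd ℝ lam m * vandermondeSeries ℝ N lam)) := by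
  rw [fH_eq_sum lam m (M := ∑ l, expo m l + d + 1) (by omega), map_sum]
  simp_rw [MvPolynomial.homogeneousComponent_of_mem (isHomogeneous_kernelTerm lam _ _)]
  rw [← sum_filter]
  refine sum_nbij' (fun k => Finsupp.equivFunOnFinite.symm k) (fun k => ⇑k) ?_ ?_ ?_ ?_ ?_
  · intro k hk
    rw [mem_finsuppAntidiag]
    exact ⟨(mem_filter.1 hk).2.symm, subset_univ _⟩
  · intro k hk
    have h := (mem_finsuppAntidiag.1 hk).1
    refine mem_filter.2 ⟨Fintype.mem_piFinset.2 fun q => mem_range.2 ?_, h.symm⟩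
    have : k q ≤ d := h ▸ single_le_sum (f := k) (fun _ _ => Nat.zero_le _) (mem_univ q)
    omega
  · intro k _
    rfl
  · intro k _
    ext q
    rfl
  · intro k _
    rfl

/-- A term of degree `d` in `x` uses up `d` inverse variables; the remaining exponent has total `|m|
- d < 0` and is outside the cone. -/
lemma homogeneousComponent_fH_of_lt (lam : ℝ) {m : Fin N → ℤ} {d : ℕ} (h : ∑ i, m i < d) :
    MvPolynomial.homogeneousComponent d (fH lam m) = 0 := by
  rw [homogeneousComponent_fH]
  refine sum_eq_zero fun k hk => ?_
  rw [laurentCoeff_of_not_isCone, map_zero, mul_zero]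
  intro hc
  have h0 := hc 0
  have h1 := (mem_finsuppAntidiag.1 hk).1
  have h2 : ∑ i, ∑ q : Fin N × Fin N, (k q • Pi.single q.2 1 : Fin N → ℤ) i = d := by
    rw [sum_comm, ← h1]
    push_cast
    refine sum_congr rfl fun q _ => ?_
    simp [← mul_sum]
  rw [tail_zero_right] at h0
  simp only [Pi.sub_apply, Finset.sum_apply, sum_sub_distrib, h2] at h0
  omega

/-- All other labels with `β ≠ 0` have strictly smaller total. -/
lemma homogeneousComponent_eigenPoly (lam : ℝ) (n : Fin N → ℤ) {d : ℕ} (h : ∑ i, n i = d) :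
    MvPolynomial.homogeneousComponent d (eigenPoly lam n)
      = MvPolynomial.homogeneousComponent d (fH lam n) := by
  rw [eigenPoly]
  refine ((MvPolynomial.homogeneousComponent (R := ℝ) (σ := Fin N) d).toAddMonoidHom.map_finsum
    (finite_support_beta_smul_fH lam n)).trans ?_
  rw [finsum_eq_single _ n]
  · rw [beta_self, one_smul]
    rfl
  · intro m hm
    refine ((MvPolynomial.homogeneousComponent (R := ℝ) (σ := Fin N) d).map_smul _ _).trans ?_
    by_cases hb : beta lam n m = 0
    · rw [hb, zero_smul]
    · rw [homogeneousComponent_fH_of_lt lam (h ▸ (sum_lt_or_eq_of_beta_ne_zero hb).resolve_left hm),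
        smul_zero]

/-! ### The degree components of the kernel -/

open scoped TensorProduct

/-- The ring of polynomials in two sets of variables. -/
abbrev TwoSets (N : ℕ) : Type := MvPolynomial (Fin N) ℝ ⊗[ℝ] MvPolynomial (Fin N) ℝ

/-- The series `∏_{r,i} (1 - x_r y_i T) ^ (-lam)`. -/
def gradedKernel (N : ℕ) (lam : ℝ) : PowerSeries (TwoSets N) :=
  ∏ q : Fin N × Fin N, PowerSeries.mk fun k => PowerSeries.coeff k (binomSeries (-lam))
    • (MvPolynomial.X q.1 ⊗ₜ[ℝ] MvPolynomial.X q.2 : TwoSets N) ^ k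

lemma derivative_mk_binomSeries {R : Type*} [CommRing R] [Algebra ℝ R] (lam : ℝ) (u : R) :
    PowerSeries.derivative R
        (PowerSeries.mk fun k => PowerSeries.coeff k (binomSeries (-lam)) • u ^ k)
      = (PowerSeries.mk fun k => PowerSeries.coeff k (binomSeries (-lam)) • u ^ k)
        * PowerSeries.mk fun k => lam • u ^ (k + 1) := by
  ext d
  have h := congrArg (PowerSeries.coeff d) (derivative_binomSeries (-lam))
  rw [PowerSeries.coeff_derivative, PowerSeries.coeff_smul, mul_comm (PowerSeries.mk 1),
    PowerSeries.coeff_mul, neg_neg, smul_eq_mul] at h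
  simp only [PowerSeries.coeff_mk, Pi.one_apply, mul_one] at h
  rw [PowerSeries.coeff_derivative, PowerSeries.coeff_mul, PowerSeries.coeff_mk]
  have h1 : ∀ p ∈ antidiagonal d, PowerSeries.coeff p.1
        (PowerSeries.mk fun k => PowerSeries.coeff k (binomSeries (-lam)) • u ^ k)
      * PowerSeries.coeff p.2 (PowerSeries.mk fun k => lam • u ^ (k + 1))
      = (lam * PowerSeries.coeff p.1 (binomSeries (-lam))) • u ^ (d + 1) := by
    intro p hp
    rw [PowerSeries.coeff_mk, PowerSeries.coeff_mk, smul_mul_smul_comm, ← pow_add, mul_comm lam,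
      ← HasAntidiagonal.mem_antidiagonal.1 hp, add_assoc]
  rw [sum_congr rfl h1, ← sum_smul, ← mul_sum, ← h, mul_smul, Algebra.smul_def ((d : ℝ) + 1)]
  simp [mul_comm]

lemma coeff_gradedKernel_zero (lam : ℝ) : PowerSeries.coeff 0 (gradedKernel N lam) = 1 := by
  rw [PowerSeries.coeff_zero_eq_constantCoeff_apply, gradedKernel, map_prod]
  refine prod_eq_one fun q _ => ?_
  rw [← PowerSeries.coeff_zero_eq_constantCoeff_apply, PowerSeries.coeff_mk]
  simp [binomSeries]

/-- The logarithmic derivative in `T` has coefficients `lam ∑ (x_r y_i) ^ (k + 1)`, and this double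
sum factors into a power sum in `x` times one in `y`. -/
lemma coeff_gradedKernel_succ (lam : ℝ) (d : ℕ) :
    ((d : ℝ) + 1) • PowerSeries.coeff (d + 1) (gradedKernel N lam)
      = lam • ∑ p ∈ antidiagonal d, (MvPolynomial.psum (Fin N) ℝ (p.2 + 1)
          ⊗ₜ[ℝ] MvPolynomial.psum (Fin N) ℝ (p.2 + 1) : TwoSets N)
        * PowerSeries.coeff p.1 (gradedKernel N lam) := by
  have h := congrArg (PowerSeries.coeff d) (derivation_prod_of_eq_mul
    (PowerSeries.derivative (TwoSets N)) univ _ _ fun (q : Fin N × Fin N) _ =>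
      derivative_mk_binomSeries lam
        (MvPolynomial.X q.1 ⊗ₜ[ℝ] MvPolynomial.X q.2 : TwoSets N))
  rw [← gradedKernel, PowerSeries.coeff_derivative, PowerSeries.coeff_mul] at h
  rw [add_smul, one_smul, Nat.cast_smul_eq_nsmul, nsmul_eq_mul, ← add_one_mul,
    mul_comm, h, smul_sum]
  refine sum_congr rfl fun p _ => ?_
  rw [map_sum, mul_comm, ← smul_mul_assoc]
  congr 1
  simp_rw [PowerSeries.coeff_mk, ← smul_sum, Algebra.TensorProduct.tmul_pow]
  rw [Fintype.sum_prod_type, MvPolynomial.psum, TensorProduct.sum_tmul]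
  simp_rw [TensorProduct.tmul_sum]

/-- The functional `A ⊗ A`. -/
def pairing (A : MvPolynomial (Fin N) ℝ →ₗ[ℝ] ℝ) : TwoSets N →ₗ[ℝ] ℝ :=
  LinearMap.mul' ℝ ℝ ∘ₗ TensorProduct.map A A

lemma pairing_tmul (A : MvPolynomial (Fin N) ℝ →ₗ[ℝ] ℝ) (a b : MvPolynomial (Fin N) ℝ) :
    pairing A (a ⊗ₜ b) = A a * A b := by
  simp [pairing]

lemma pairing_tmul_mul (A : MvPolynomial (Fin N) ℝ →ₗ[ℝ] ℝ) (p : MvPolynomial (Fin N) ℝ)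
    (z : TwoSets N) :
    pairing A ((p ⊗ₜ p) * z) = pairing (A ∘ₗ LinearMap.mulLeft ℝ p) z := by
  induction z using TensorProduct.induction_on with
  | zero => simp
  | tmul a b =>
    rw [Algebra.TensorProduct.tmul_mul_tmul, pairing_tmul, pairing_tmul]
    rfl
  | add a b ha hb => rw [mul_add, map_add, map_add, ha, hb]

lemma pairing_gradedKernel_succ (lam : ℝ) (A : MvPolynomial (Fin N) ℝ →ₗ[ℝ] ℝ) (d : ℕ) :
    ((d : ℝ) + 1) * pairing A (PowerSeries.coeff (d + 1) (gradedKernel N lam))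
      = lam * ∑ p ∈ antidiagonal d,
        pairing (A ∘ₗ LinearMap.mulLeft ℝ (MvPolynomial.psum (Fin N) ℝ (p.2 + 1)))
          (PowerSeries.coeff p.1 (gradedKernel N lam)) := by
  have h := congrArg (pairing A) (coeff_gradedKernel_succ (N := N) lam d)
  simpa only [map_smul, map_sum, pairing_tmul_mul, smul_eq_mul] using h

lemma pairing_gradedKernel_zero (lam : ℝ) (A : MvPolynomial (Fin N) ℝ →ₗ[ℝ] ℝ) :
    pairing A (PowerSeries.coeff 0 (gradedKernel N lam)) = A 1 ^ 2 := by
  rw [coeff_gradedKernel_zero, Algebra.TensorProduct.one_def, pairing_tmul, sq]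

/-- By the recursion the value is a sum with positive coefficients of values in lower degree, for
the functionals `A (p_k · )`; degree zero gives a square. Hence the induction over all `A`. -/
lemma pairing_gradedKernel_nonneg {lam : ℝ} (hlam : 0 < lam) (d : ℕ)
    (A : MvPolynomial (Fin N) ℝ →ₗ[ℝ] ℝ) :
    0 ≤ pairing A (PowerSeries.coeff d (gradedKernel N lam)) := by
  induction d using Nat.strong_induction_on generalizing A with
  | _ d ih =>
    cases d with
    | zero => rw [pairing_gradedKernel_zero]; positivity
    | succ d =>
      have h := pairing_gradedKernel_succ lam A d
      have h1 : 0 ≤ lam * ∑ p ∈ antidiagonal d,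
          pairing (A ∘ₗ LinearMap.mulLeft ℝ (MvPolynomial.psum (Fin N) ℝ (p.2 + 1)))
            (PowerSeries.coeff p.1 (gradedKernel N lam)) :=
        mul_nonneg hlam.le (sum_nonneg fun p hp => ih _ (by
          have := HasAntidiagonal.mem_antidiagonal.1 hp
          omega) _)
      rw [← h] at h1
      exact nonneg_of_mul_nonneg_right h1 (by positivity)

/-- A vanishing sum of non-negative terms has vanishing terms; the one that splits off the first
power sum continues the induction. -/
lemma map_prod_psum_eq_zero {lam : ℝ} (hlam : 0 < lam) (s : List ℕ) (hs : ∀ k ∈ s, k ≠ 0)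
    (A : MvPolynomial (Fin N) ℝ →ₗ[ℝ] ℝ)
    (hA : pairing A (PowerSeries.coeff s.sum (gradedKernel N lam)) = 0) :
    A (s.map (MvPolynomial.psum (Fin N) ℝ)).prod = 0 := by
  induction s generalizing A with
  | nil =>
    rw [List.sum_nil, pairing_gradedKernel_zero] at hA
    simpa using hA
  | cons k s ih =>
    obtain ⟨j, rfl⟩ := Nat.exists_eq_succ_of_ne_zero (hs k List.mem_cons_self)
    rw [List.sum_cons, Nat.succ_add] at hA
    have h := pairing_gradedKernel_succ lam A (j + s.sum)
    rw [hA, mul_zero, eq_comm, mul_eq_zero, or_iff_right hlam.ne',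
      sum_eq_zero_iff_of_nonneg fun p _ => pairing_gradedKernel_nonneg hlam _ _] at h
    have h1 := h (s.sum, j) (HasAntidiagonal.mem_antidiagonal.2 (add_comm _ _))
    have h2 := ih (fun k hk => hs k (List.mem_cons_of_mem _ hk)) _ h1
    rw [List.map_cons, List.prod_cons]
    exact h2

/-! ### Power sums generate the symmetric polynomials -/

/-- Newton's identities, with division by `k`. -/
lemma esymm_mem_adjoin_psum (k : ℕ) : MvPolynomial.esymm (Fin N) ℝ k
    ∈ Algebra.adjoin ℝ (MvPolynomial.psum (Fin N) ℝ '' {k | k ≠ 0}) := by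
  set S := Algebra.adjoin ℝ (MvPolynomial.psum (Fin N) ℝ '' {k | k ≠ 0}) with hS
  induction k using Nat.strong_induction_on with
  | _ k ih =>
    by_cases hk : k = 0
    · rw [hk, MvPolynomial.esymm_zero]
      exact one_mem _
    · have h := MvPolynomial.mul_esymm_eq_sum (Fin N) ℝ k
      have h1 : (k : MvPolynomial (Fin N) ℝ) * MvPolynomial.esymm (Fin N) ℝ k ∈ S := by
        rw [h]
        have hneg : ∀ j : ℕ, (-1 : MvPolynomial (Fin N) ℝ) ^ j ∈ S := fun j =>
          pow_mem (neg_mem (one_mem _)) _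
        refine mul_mem (hneg _) (sum_mem fun p hp => ?_)
        rw [mem_filter, HasAntidiagonal.mem_antidiagonal] at hp
        exact mul_mem (mul_mem (hneg _) (ih _ hp.2))
          (Algebra.subset_adjoin ⟨p.2, by simp only [Set.mem_ofPred_eq]; omega, rfl⟩)
      have h2 : MvPolynomial.esymm (Fin N) ℝ k
          = (k : ℝ)⁻¹ • ((k : MvPolynomial (Fin N) ℝ) * MvPolynomial.esymm (Fin N) ℝ k) := by
        rw [← nsmul_eq_mul, ← Nat.cast_smul_eq_nsmul ℝ, smul_smul,
          inv_mul_cancel₀ (Nat.cast_ne_zero.2 hk), one_smul]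
      rw [h2]
      exact S.smul_mem h1 _

lemma mem_adjoin_psum_of_isSymmetric {h : MvPolynomial (Fin N) ℝ} (hh : h.IsSymmetric) :
    h ∈ Algebra.adjoin ℝ (MvPolynomial.psum (Fin N) ℝ '' {k | k ≠ 0}) := by
  obtain ⟨p, hp⟩ := MvPolynomial.esymmAlgHom_surjective (σ := Fin N) (n := N) ℝ (by simp)
    ⟨h, hh⟩
  have h1 := MvPolynomial.esymmAlgHom_apply (σ := Fin N) (R := ℝ) (n := N) p
  rw [hp] at h1
  rw [show h = _ from h1]
  clear hp h1
  induction p using MvPolynomial.induction_on with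
  | C a =>
    rw [MvPolynomial.aeval_C]
    exact Subalgebra.algebraMap_mem _ a
  | add p q hp hq =>
    rw [map_add]
    exact add_mem hp hq
  | mul_X p i hp =>
    rw [map_mul, MvPolynomial.aeval_X]
    exact mul_mem hp (esymm_mem_adjoin_psum _)

lemma exists_list_of_mem_closure_psum {h : MvPolynomial (Fin N) ℝ}
    (hh : h ∈ Submonoid.closure (MvPolynomial.psum (Fin N) ℝ '' {k | k ≠ 0})) :
    ∃ s : List ℕ, (∀ k ∈ s, k ≠ 0) ∧ h = (s.map (MvPolynomial.psum (Fin N) ℝ)).prod := by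
  induction hh using Submonoid.closure_induction with
  | mem x hx =>
    obtain ⟨k, hk, rfl⟩ := hx
    exact ⟨[k], by simpa using hk, by simp⟩
  | one => exact ⟨[], by simp, by simp⟩
  | mul x y _ _ hx hy =>
    obtain ⟨s, hs, rfl⟩ := hx
    obtain ⟨t, ht, rfl⟩ := hy
    refine ⟨s ++ t, fun k hk => ?_, by simp⟩
    exact (List.mem_append.1 hk).elim (hs k) (ht k)

lemma isHomogeneous_prod_psum (s : List ℕ) :
    (s.map (MvPolynomial.psum (Fin N) ℝ)).prod.IsHomogeneous s.sum := by
  induction s with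
  | nil => exact MvPolynomial.isHomogeneous_one _ _
  | cons k s ih =>
    rw [List.map_cons, List.prod_cons, List.sum_cons]
    exact (MvPolynomial.IsHomogeneous.sum _ _ _ fun i _ =>
      MvPolynomial.isHomogeneous_X_pow i k).mul ih

/-- A functional whose square annihilates a degree component of the kernel annihilates all symmetric
polynomials of this degree. -/
lemma map_eq_zero_of_isSymmetric {lam : ℝ} (hlam : 0 < lam) {d : ℕ}
    {A : MvPolynomial (Fin N) ℝ →ₗ[ℝ] ℝ}
    (hA : pairing A (PowerSeries.coeff d (gradedKernel N lam)) = 0)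
    {h : MvPolynomial (Fin N) ℝ} (hs : h.IsSymmetric) (hd : h.IsHomogeneous d) : A h = 0 := by
  have h1 := mem_adjoin_psum_of_isSymmetric hs
  rw [← Subalgebra.mem_toSubmodule, Algebra.adjoin_eq_span] at h1
  rw [← MvPolynomial.homogeneousComponent_eq_self hd]
  clear hs hd
  induction h1 using Submodule.span_induction with
  | mem x hx =>
    obtain ⟨s, hs, rfl⟩ := exists_list_of_mem_closure_psum hx
    rw [MvPolynomial.homogeneousComponent_of_mem (isHomogeneous_prod_psum s)]
    split_ifs with h
    · exact map_prod_psum_eq_zero hlam s hs A (h ▸ hA)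
    · exact map_zero A
  | zero => rw [map_zero, map_zero]
  | add x y _ _ hx hy => rw [map_add, map_add, hx, hy, add_zero]
  | smul c x _ hx => rw [map_smul, map_smul, hx, smul_zero]

/-! ### Non-vanishing -/

/-- The functional sending `X ^ k` to the coefficient of `y ^ (k - n)` in the product of the Hermite
and Vandermonde series. -/
def coeffFunctional (lam : ℝ) (n : Fin N → ℤ) : MvPolynomial (Fin N) ℝ →ₗ[ℝ] ℝ :=
  laurentCoeff ℝ n ∘ₗ LinearMap.mulLeft ℝ (hermiteProd ℝ lam n * vandermondeSeries ℝ N lam)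
    ∘ₗ (MvPolynomial.aeval (invVar ℝ)).toLinearMap

lemma coeffFunctional_prod (lam : ℝ) (n : Fin N → ℤ) {ι : Type*} [Fintype ι] (b : ι → Fin N)
    (k : ι → ℕ) :
    coeffFunctional lam n (∏ q, MvPolynomial.X (b q) ^ k q)
      = laurentCoeff ℝ (n - ∑ q, k q • Pi.single (b q) 1)
        (hermiteProd ℝ lam n * vandermondeSeries ℝ N lam) := by
  have h : MvPolynomial.aeval (invVar ℝ) (∏ q, MvPolynomial.X (R := ℝ) (b q) ^ k q)
      = mon ℝ (∑ q, k q • Pi.single (b q) 1) := by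
    rw [map_prod, ← mon_prod univ fun q _ => (isCone_single_one (b q)).nsmul (k q)]
    refine prod_congr rfl fun q _ => ?_
    rw [map_pow, MvPolynomial.aeval_X, invVar, mon_pow (isCone_single_one _)]
  rw [← laurentCoeff_mon_mul n (IsCone.sum _ fun q _ => (isCone_single_one (b q)).nsmul (k q)), ← h,
    mul_comm]
  rfl

lemma prod_tmul {ι : Type*} (s : Finset ι) (a b : ι → MvPolynomial (Fin N) ℝ) :
    ∏ q ∈ s, (a q ⊗ₜ[ℝ] b q : TwoSets N) = (∏ q ∈ s, a q) ⊗ₜ[ℝ] ∏ q ∈ s, b q := by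
  classical
  induction s using Finset.induction_on with
  | empty => simp [Algebra.TensorProduct.one_def]
  | insert q s hq ih =>
    rw [prod_insert hq, prod_insert hq, prod_insert hq, ih, Algebra.TensorProduct.tmul_mul_tmul]

/-- The degree component of `fH` is the graded kernel with the functional applied in the second set
of variables; applying it in the first set as well gives the pairing. -/
lemma pairing_coeffFunctional (lam : ℝ) (n : Fin N → ℤ) (d : ℕ) :
    pairing (coeffFunctional lam n) (PowerSeries.coeff d (gradedKernel N lam))
      = coeffFunctional lam n (MvPolynomial.homogeneousComponent d (fH lam n)) := by
  rw [gradedKernel, PowerSeries.coeff_prod, homogeneousComponent_fH, map_sum, map_sum]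
  refine sum_congr rfl fun k _ => ?_
  have h : ∏ q : Fin N × Fin N, PowerSeries.coeff (k q) (PowerSeries.mk fun k =>
        PowerSeries.coeff k (binomSeries (-lam))
          • (MvPolynomial.X q.1 ⊗ₜ[ℝ] MvPolynomial.X q.2 : TwoSets N) ^ k)
      = (∏ q, (PowerSeries.coeff (k q) (binomSeries (-lam)) • MvPolynomial.X q.1 ^ k q))
        ⊗ₜ[ℝ] ∏ q : Fin N × Fin N, MvPolynomial.X q.2 ^ k q := by
    simp_rw [PowerSeries.coeff_mk, Algebra.TensorProduct.tmul_pow, TensorProduct.smul_tmul']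
    exact prod_tmul _ _ _
  rw [h, pairing_tmul, coeffFunctional_prod, mul_comm _ (MvPolynomial.C _),
    ← MvPolynomial.smul_eq_C_mul, map_smul, smul_eq_mul, mul_comm]

lemma constantCoeff_subst_eq {σ : Type*} (φ : PowerSeries ℝ) {t : MvPowerSeries σ ℝ}
    (ht : MvPowerSeries.constantCoeff t = 0) :
    MvPowerSeries.constantCoeff (φ.subst t) = PowerSeries.coeff 0 φ := by
  obtain ⟨U, hU⟩ := subst_add_pow_mul φ (PowerSeries.HasSubst.of_constantCoeff_zero ht) 1
  rw [hU]
  simp [ht]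

lemma laurentCoeff_zero_hermiteProd_mul (lam : ℝ) (n : Fin N → ℤ) :
    laurentCoeff ℝ 0 (hermiteProd ℝ lam n * vandermondeSeries ℝ N lam) = 1 := by
  rw [laurentCoeff_of_isCone isCone_zero, expo_zero,
    MvPowerSeries.coeff_zero_eq_constantCoeff_apply,
    map_mul, hermiteProd, vandermondeSeries, map_prod, map_prod]
  simp_rw [constantCoeff_subst_eq _ (constantCoeff_mon_two _),
    constantCoeff_subst_eq _ (constantCoeff_ratio _)]
  simp [hermiteSeries, binomSeries, hermiteCoeff, poch]

/-- By the rearrangement inequality a decreasing `n` has the least height among its permutations,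
whereas a non-zero vector of the cone has positive height. -/
lemma eq_of_isCone_sub_comp_perm {n : Fin N → ℤ} (hn : Antitone n) (σ : Equiv.Perm (Fin N))
    (h : IsCone (n - n ∘ σ)) : n - n ∘ σ = 0 := by
  by_contra h0
  have h1 := h.one_le_height h0
  have hanti : Antivary (fun i : Fin N => (i : ℤ) + 1) n := fun i j hij => by
    by_contra! hlt
    have : i ≤ j := by
      simp only [add_lt_add_iff_right, Nat.cast_lt] at hlt
      exact hlt.le
    exact absurd (hn this) (not_le.2 hij)
  have h2 := hanti.sum_mul_le_sum_mul_comp_perm (σ := σ)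
  simp only [height, Pi.sub_apply, Function.comp_apply, mul_sub, sum_sub_distrib] at h1
  omega

lemma eigenPoly_ne_zero {lam : ℝ} (hlam : 0 < lam) {n : Fin N → ℤ} (hn : Antitone n)
    (h0 : ∀ j, 0 ≤ n j) : eigenPoly lam n ≠ 0 := by
  intro hP
  lift n to Fin N → ℕ using h0
  set d := ∑ i, n i with hd
  have hA : pairing (coeffFunctional lam fun i => (n i : ℤ))
      (PowerSeries.coeff d (gradedKernel N lam)) = 0 := by
    rw [pairing_coeffFunctional, ← homogeneousComponent_eigenPoly lam _ (by simp [hd]), hP,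
      map_zero, map_zero]
  -- The test polynomial: on it the functional counts the permutations that fix `n`, among them the
  -- identity, so its value cannot be zero.
  set h : MvPolynomial (Fin N) ℝ :=
    ∑ σ : Equiv.Perm (Fin N), ∏ i, MvPolynomial.X i ^ n (σ i) with hh
  have hsymm : h.IsSymmetric := by
    intro τ
    rw [hh, map_sum]
    refine Fintype.sum_equiv (Equiv.mulRight τ⁻¹) _ _ fun σ => ?_
    rw [map_prod]
    refine Fintype.prod_equiv τ _ _ fun i => ?_
    simp
  have hhom : h.IsHomogeneous d := MvPolynomial.IsHomogeneous.sum _ _ _ fun σ _ => by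
    rw [hd, ← Equiv.sum_comp σ]
    exact MvPolynomial.IsHomogeneous.prod _ _ _ fun i _ => MvPolynomial.isHomogeneous_X_pow _ _
  have hz := map_eq_zero_of_isSymmetric hlam hA hsymm hhom
  rw [hh, map_sum] at hz
  have hval : ∀ σ : Equiv.Perm (Fin N),
      coeffFunctional lam (fun i => (n i : ℤ)) (∏ i, MvPolynomial.X i ^ n (σ i))
        = if (fun i => (n i : ℤ)) - (fun i => (n i : ℤ)) ∘ σ = 0 then 1 else 0 := fun σ => by
    have hs : ∑ i, n (σ i) • (Pi.single i 1 : Fin N → ℤ) = (fun i => (n i : ℤ)) ∘ σ := by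
      ext j
      simp [Finset.sum_apply, Pi.single_apply]
    refine (coeffFunctional_prod lam _ (fun i => i) fun i => n (σ i)).trans ?_
    rw [hs]
    split_ifs with h1
    · rw [h1, laurentCoeff_zero_hermiteProd_mul]
    · exact laurentCoeff_of_not_isCone (fun hc => h1 (eq_of_isCone_sub_comp_perm hn σ hc)) _
  simp_rw [hval] at hz
  rw [sum_eq_zero_iff_of_nonneg fun σ _ => by split_ifs <;> norm_num] at hz
  have := hz 1 (mem_univ _)
  simp at this

end

end Calogero

theorem theorem3p5 (N : ℕ) (lam : ℝ) (hlam : 0 < lam) (n : Fin N → ℤ) :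
    (∀ m : Fin N → ℤ, (Calogero.residueTerms lam m).Finite) ∧
    (∀ m : Fin N → ℤ, (Function.support (Calogero.chainTerm lam n m)).Finite) ∧
    (Function.support (fun m : Fin N → ℤ => Calogero.beta lam n m • Calogero.fH lam m)).Finite ∧
    Calogero.IsReducedEigenfunction lam (Calogero.energy lam n) (Calogero.eigenPoly lam n) ∧
    (Antitone n → (∀ j, 0 ≤ n j) → Calogero.eigenPoly lam n ≠ 0) :=
  ⟨Calogero.finite_residueTerms lam, Calogero.finite_support_chainTerm lam n,
    Calogero.finite_support_beta_smul_fH lam n, Calogero.isReducedEigenfunction_eigenPoly lam n,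
    fun hn h0 => Calogero.eigenPoly_ne_zero hlam hn h0⟩
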